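/- Let $N\ge 1$, $n=\lfloor N/2\rfloor$, and index the rows and columns of $N\times N$ matrices by $\{-n,\dots,n\}$ if $N=2n+1$ and by $\{-n,\dots,-1,1,\dots,n\}$ if $N=2n$. Consider the orthogonal case ($N$ arbitrary, upper signs, $\theta_{ij}=1$) or the symplectic case ($N=2n$, lower signs, $\theta_{ij}=\operatorname{sgn} i\cdot\operatorname{sgn} j$), and the matrix transposition with $(e_{ij})^t=\theta_{ij}e_{-j,-i}$. The Yangian $\mathrm Y(N)$ is the unital associative $\mathbb C$-algebra with generators $t_{ij}^{(r)}$, $r\ge1$, and relations $$[t^{(r+1)}_{ij}, t^{(s)}_{kl}]-[t^{(r)}_{ij}, t^{(s+1)}_{kl}]=t^{(r)}_{kj} t^{(s)}_{il}-t^{(s)}_{kj} t^{(r)}_{il},\qquad r,s\ge 0,\quad t^{(0)}_{ij}=\delta_{ij}.$$ The twisted Yangian $\mathrm Y^{\pm}(N)$ is the unital associative $\mathbb C$-algebra with generators $s_{ij}^{(r)}$, $r\ge 1$, whose defining relations, written with $s_{ij}(u)=\delta_{ij}+\sum_{r\ge1}s_{ij}^{(r)}u^{-r}$, are $$\begin{aligned}(u^2-v^2)[s_{ij}(u),s_{kl}(v)]={}&(u+v)\big(s_{kj}(u)s_{il}(v)-s_{kj}(v)s_{il}(u)\big)\\&-(u-v)\big(\theta_{k,-j}s_{i,-k}(u)s_{-j,l}(v)-\theta_{i,-l}s_{k,-i}(v)s_{-l,j}(u)\big)\\&+\theta_{i,-j}\big(s_{k,-i}(u)s_{-j,l}(v)-s_{k,-i}(v)s_{-j,l}(u)\big)\end{aligned}$$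 and $\theta_{ij}s_{-j,-i}(-u)=s_{ij}(u)\pm\dfrac{s_{ij}(u)-s_{ij}(-u)}{2u}$. Let $T(u)=(t_{ij}(u))$, where $t_{ij}(u)=\sum_{r\ge0}t_{ij}^{(r)}u^{-r}$, and $S(u)=(s_{ij}(u))$. For a matrix $M$ and $1\le a\le N$ let $M_a$ be $M$ acting in the $a$-th copy of $\operatorname{End}\mathbb C^N$ in $(\operatorname{End}\mathbb C^N)^{\otimes N}$; let $Q=\sum_{i,j}e_{ij}^t\otimes e_{ji}$, $R^t(u)=1-Qu^{-1}$, $u_a=u-a+1$, and for $a<b$ let $R^t_{ab}=R^t_{ba}=1+Q_{ab}\,(u_a+u_b)^{-1}$, where $Q_{ab}$ is $Q$ acting in the $a$-th and $b$-th copies. Put $$\langle S_{p_1},\dots,S_{p_N}\rangle=S_{p_1}(u_{p_1})\big(R^t_{p_1p_2}\cdots R^t_{p_1p_N}\big)S_{p_2}(u_{p_2})\big(R^t_{p_2p_3}\cdots R^t_{p_2p_N}\big)\cdots S_{p_N}(u_{p_N}),$$ and let $A_N$ be the antisymmetrizer, $A_N(e_{i_1}\otimes\cdots\otimes e_{i_N})=\sum_{\sigma\in\mathfrak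 S_N}\operatorname{sgn}\sigma\; e_{i_{\sigma(1)}}\otimes\cdots\otimes e_{i_{\sigma(N)}}$. All expressions are expanded as formal series in $u^{-1}$. **Theorem.** There are unique series $\operatorname{qdet}T(u)\in 1+u^{-1}\mathrm Y(N)[[u^{-1}]]$ and $\operatorname{sdet}S(u)\in 1+u^{-1}\mathrm Y^\pm(N)[[u^{-1}]]$ (the quantum determinant and the Sklyanin determinant) such that $$A_N\,T_1(u)\cdots T_N(u-N+1)=T_N(u-N+1)\cdots T_1(u)\,A_N=A_N\operatorname{qdet}T(u),$$ $$A_N\langle S_1,\dots,S_N\rangle=\langle S_N,\dots,S_1\rangle A_N=A_N\operatorname{sdet}S(u),$$ and there is a unique algebra homomorphism $\mathrm Y^\pm(N)\to\mathrm Y(N)$ with $S(u)\mapsto T(u)\,T^t(-u)$. Regarding series over $\mathrm Y^\pm(N)$ as series over $\mathrm Y(N)$ through this homomorphism, we have $$\operatorname{sdet}S(u)=\gamma_n(u)\,\operatorname{qdet}T(u)\,\operatorname{qdet}T(-u+N-1),$$ where $\gamma_n(u)=1$ in the orthogonal case and $\gamma_n(u)=\dfrac{2u+1}{2u-2n+1}$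 in the symplectic case. -/

import Mathlib

noncomputable section

namespace TwYang

/-! ### Index sets and the two classical cases -/

/-- The set `{-n, …, n}` if `N = 2n + 1`, and `{-n, …, -1, 1, …, n}` if `N = 2n`. -/
def idxSet (N : ℕ) : Finset ℤ :=
  (Finset.Icc (-((N / 2 : ℕ) : ℤ)) ((N / 2 : ℕ) : ℤ)).filter fun i => Even N → i ≠ 0

/-- The type of the row and column indices of `N × N` matrices. -/
abbrev Idx (N : ℕ) : Type := {i : ℤ // i ∈ idxSet N}

instance (N : ℕ) : Neg (Idx N) where
  neg i := ⟨-i.1, by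
    have h := i.2
    simp only [idxSet, Finset.mem_filter, Finset.mem_Icc] at h ⊢
    refine ⟨⟨by omega, by omega⟩, fun hN => ?_⟩
    have := h.2 hN
    omega⟩

/-- The orthogonal case (upper signs) and the symplectic case (lower signs). -/
inductive Kind : Type
  | orthogonal
  | symplectic

/-- The double sign `±`: `+1` in the orthogonal case and `-1` in the symplectic case. -/
def Kind.pm : Kind → ℂ
  | .orthogonal => 1
  | .symplectic => -1

/-- `θ_{ij}`: `1` in the orthogonal case, `sgn i · sgn j` in the symplectic case. -/
def θ {N : ℕ} : Kind → Idx N → Idx N → ℤ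
  | .orthogonal, _, _ => 1
  | .symplectic, i, j => i.1.sign * j.1.sign

/-- The transposition with `(e_{ij})^t = θ_{ij} e_{-j,-i}` on matrices with entries in `A`. -/
def twT {N : ℕ} (c : Kind) {A : Type*} [AddGroup A] (M : Matrix (Idx N) (Idx N) A) :
    Matrix (Idx N) (Idx N) A :=
  Matrix.of fun i j => θ c (-j) (-i) • M (-j) (-i)

/-! ### The Yangian and the twisted Yangian -/

/-- The free associative algebra on symbols `x_{ij}^{(1)}, x_{ij}^{(2)}, …`; the generator
`(i, j, r)` stands for `x_{ij}^{(r + 1)}`. -/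
abbrev FreeAlg (N : ℕ) : Type := FreeAlgebra ℂ (Idx N × Idx N × ℕ)

/-- `x_{ij}^{(r)}` for `r ≥ 0`, where `x_{ij}^{(0)} = δ_{ij}`. -/
def gen {N : ℕ} (i j : Idx N) : ℕ → FreeAlg N
  | 0 => if i = j then 1 else 0
  | r + 1 => FreeAlgebra.ι ℂ (i, j, r)

/-- The coefficient of `u^{-r}` in `x_{ij}(u) = δ_{ij} + x_{ij}^{(1)} u^{-1} + ⋯` for any integer
`r`: it is zero for negative `r`. -/
def genZ {N : ℕ} (i j : Idx N) (r : ℤ) : FreeAlg N :=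
  if r < 0 then 0 else gen i j r.toNat

/-- The defining relations of the Yangian `Y(N)`. -/
inductive YangianRel (N : ℕ) : FreeAlg N → FreeAlg N → Prop
  | rtt (i j k l : Idx N) (r s : ℕ) : YangianRel N
      (⁅gen i j (r + 1), gen k l s⁆ - ⁅gen i j r, gen k l (s + 1)⁆)
      (gen k j r * gen i l s - gen k j s * gen i l r)

/-- The Yangian `Y(N)` for `gl_N`, with generators indexed by `{-n, …, n}`. -/
abbrev Yangian (N : ℕ) : Type := RingQuot (YangianRel N)

/-- The defining relations of the twisted Yangian. `quat` is the equality of the coefficients of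
`u^{-r} v^{-s}`, for all integers `r` and `s`, in

  `(u² - v²) [s_{ij}(u), s_{kl}(v)] = (u + v) (s_{kj}(u) s_{il}(v) - s_{kj}(v) s_{il}(u))`
  `  - (u - v) (θ_{k,-j} s_{i,-k}(u) s_{-j,l}(v) - θ_{i,-l} s_{k,-i}(v) s_{-l,j}(u))`
  `  + θ_{i,-j} (s_{k,-i}(u) s_{-j,l}(v) - s_{k,-i}(v) s_{-j,l}(u))`,

and `symm` is the equality of the coefficients of `u^{-r}` in

  `θ_{ij} s_{-j,-i}(-u) = s_{ij}(u) ± (s_{ij}(u) - s_{ij}(-u)) / (2u)`. -/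
inductive TwistedRel (c : Kind) (N : ℕ) : FreeAlg N → FreeAlg N → Prop
  | quat (i j k l : Idx N) (r s : ℤ) : TwistedRel c N
      (⁅genZ i j (r + 2), genZ k l s⁆ - ⁅genZ i j r, genZ k l (s + 2)⁆)
      ((genZ k j (r + 1) * genZ i l s - genZ k j s * genZ i l (r + 1))
        + (genZ k j r * genZ i l (s + 1) - genZ k j (s + 1) * genZ i l r)
        - (θ c k (-j) • (genZ i (-k) (r + 1) * genZ (-j) l s)
            - θ c i (-l) • (genZ k (-i) s * genZ (-l) j (r + 1)))
        + (θ c k (-j) • (genZ i (-k) r * genZ (-j) l (s + 1))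
            - θ c i (-l) • (genZ k (-i) (s + 1) * genZ (-l) j r))
        + θ c i (-j) • (genZ k (-i) r * genZ (-j) l s - genZ k (-i) s * genZ (-j) l r))
  | symm (i j : Idx N) (r : ℤ) : TwistedRel c N
      (θ c i j • ((-1 : ℂ) ^ r • genZ (-j) (-i) r))
      (genZ i j r
        + (c.pm / 2) • (genZ i j (r - 1) - (-1 : ℂ) ^ (r - 1) • genZ i j (r - 1)))

/-- The twisted Yangian: `Y⁺(N)` in the orthogonal case, `Y⁻(N)` (for even `N`) in the
symplectic case. -/
abbrev TwistedYangian (c : Kind) (N : ℕ) : Type := RingQuot (TwistedRel c N)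

/-! ### Formal series in `u⁻¹`

A series in `A[[u⁻¹]]` is a `PowerSeries A`, the variable `X` being `u⁻¹`. -/

/-- The matrix `T(u)` of generating series of the Yangian. -/
def Tmat (N : ℕ) : Matrix (Idx N) (Idx N) (PowerSeries (Yangian N)) :=
  Matrix.of fun i j => PowerSeries.mk fun r => RingQuot.mkAlgHom ℂ (YangianRel N) (gen i j r)

/-- The matrix `S(u)` of generating series of the twisted Yangian. -/
def Smat (c : Kind) (N : ℕ) : Matrix (Idx N) (Idx N) (PowerSeries (TwistedYangian c N)) :=
  Matrix.of fun i j => PowerSeries.mk fun r => RingQuot.mkAlgHom ℂ (TwistedRel c N) (gen i j r)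

/-- The expansion of `(a u + b)⁻¹` in powers of `u⁻¹`, for `a ≠ 0`. -/
def linInv (a b : ℂ) : PowerSeries ℂ :=
  PowerSeries.X * (PowerSeries.C a + PowerSeries.C b * PowerSeries.X)⁻¹

/-- `f(a u + b)` as a series in `u⁻¹`, for `a ≠ 0`: the sum over `r` of `f_r (a u + b)^{-r}`. The
series `(a u + b)^{-r}` starts with `u^{-r}`, so only `r ≤ m` contribute to `u^{-m}`. -/
def atLin {A : Type*} [Ring A] [Algebra ℂ A] (a b : ℂ) (f : PowerSeries A) : PowerSeries A :=
  PowerSeries.mk fun m => ∑ r ∈ Finset.range (m + 1),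
    PowerSeries.coeff m (linInv a b ^ r) • PowerSeries.coeff r f

/-- A series with complex coefficients, regarded as a series with coefficients in `A`. -/
def scalarSeries (A : Type*) [Ring A] [Algebra ℂ A] : PowerSeries ℂ →+* PowerSeries A :=
  PowerSeries.map (algebraMap ℂ A)

/-! ### The algebra `A[[u⁻¹]] ⊗ (End ℂ^N)^{⊗m}`

It is realized as the algebra of matrices over `A[[u⁻¹]]` whose rows and columns are indexed by
the standard basis `e_{i_1} ⊗ ⋯ ⊗ e_{i_m}` of `(ℂ^N)^{⊗m}`, i.e. by functions `Fin m → Idx N`.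
The copies of `End ℂ^N` are numbered from `0`. -/

/-- `M_a`: the matrix `M` acting in the `a`-th copy. -/
def onCopy {N m : ℕ} {B : Type*} [Zero B] (a : Fin m) (M : Matrix (Idx N) (Idx N) B) :
    Matrix (Fin m → Idx N) (Fin m → Idx N) B :=
  Matrix.of fun x y => if ∀ d, d ≠ a → x d = y d then M (x a) (y a) else 0

/-- `C_{ab}`: the element `C` of `End ℂ^N ⊗ End ℂ^N` acting in the `a`-th and `b`-th copies. -/
def onCopies {N m : ℕ} {B : Type*} [Zero B] (a b : Fin m)
    (C : Matrix (Idx N × Idx N) (Idx N × Idx N) B) :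
    Matrix (Fin m → Idx N) (Fin m → Idx N) B :=
  Matrix.of fun x y =>
    if ∀ d, d ≠ a → d ≠ b → x d = y d then C (x a, x b) (y a, y b) else 0

/-- `Q = ∑_{i,j} (e_{ij})^t ⊗ e_{ji}`. -/
def Qmat (c : Kind) (N : ℕ) : Matrix (Idx N × Idx N) (Idx N × Idx N) ℂ :=
  ∑ i : Idx N, ∑ j : Idx N,
    Matrix.kronecker (twT c (Matrix.single i j (1 : ℂ))) (Matrix.single j i (1 : ℂ))

/-- The antisymmetrizer
`A_m (e_{i_1} ⊗ ⋯ ⊗ e_{i_m}) = ∑_σ sgn σ · e_{i_{σ(1)}} ⊗ ⋯ ⊗ e_{i_{σ(m)}}`. -/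
def antisym (N m : ℕ) (B : Type*) [Ring B] : Matrix (Fin m → Idx N) (Fin m → Idx N) B :=
  Matrix.of fun x y => ∑ σ : Equiv.Perm (Fin m),
    if x = y ∘ σ then ((Equiv.Perm.sign σ : ℤ) : B) else 0

section Determinants

variable {N : ℕ} {A : Type*} [Ring A] [Algebra ℂ A]

/-- `M_a(u_a)` with `u_a = u - a + 1`; since copies are numbered from `0`, this is `u - a`. -/
def shifted {m : ℕ} (M : Matrix (Idx N) (Idx N) (PowerSeries A)) (a : Fin m) :
    Matrix (Fin m → Idx N) (Fin m → Idx N) (PowerSeries A) :=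
  onCopy a (M.map (atLin 1 (-((a : ℕ) : ℂ))))

/-- `R^t_{ab} = R^t_{ba} = R^t_{ab}(-u_a - u_b)` for `a < b`, where `R^t(u) = 1 - Q u⁻¹` and
`-u_a - u_b = -2u + a + b`, the copies being numbered from `0`. -/
def Rt (c : Kind) {m : ℕ} (a b : Fin m) :
    Matrix (Fin m → Idx N) (Fin m → Idx N) (PowerSeries A) :=
  1 - onCopies (min a b) (max a b) ((Qmat c N).map fun z =>
    scalarSeries A (PowerSeries.C z * linInv (-2) (((a : ℕ) : ℂ) + ((b : ℕ) : ℂ))))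

/-- `⟨S_{p_1}, …, S_{p_m}⟩ = S_{p_1} (R^t_{p_1p_2} ⋯ R^t_{p_1p_m}) S_{p_2}
(R^t_{p_2p_3} ⋯ R^t_{p_2p_m}) ⋯ S_{p_m}`, where `S_a = S_a(u_a)`. -/
def bracket (c : Kind) {m : ℕ} (S : Matrix (Idx N) (Idx N) (PowerSeries A)) :
    List (Fin m) → Matrix (Fin m → Idx N) (Fin m → Idx N) (PowerSeries A)
  | [] => 1
  | p :: ps => shifted S p * (ps.map (Rt c p)).prod * bracket c S ps

/-- `q` is the quantum determinant of `T(u)`: `q = 1 + d_1 u⁻¹ + ⋯` and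
`A_N T_1(u) ⋯ T_N(u - N + 1) = T_N(u - N + 1) ⋯ T_1(u) A_N = A_N q`. -/
def IsQdet (T : Matrix (Idx N) (Idx N) (PowerSeries A)) (q : PowerSeries A) : Prop :=
  PowerSeries.constantCoeff q = 1 ∧
  antisym N N (PowerSeries A) * ((List.finRange N).map (shifted T)).prod
      = antisym N N (PowerSeries A) * Matrix.scalar (Fin N → Idx N) q ∧
  ((List.finRange N).reverse.map (shifted T)).prod * antisym N N (PowerSeries A)
      = antisym N N (PowerSeries A) * Matrix.scalar (Fin N → Idx N) q

/-- `d` is the Sklyanin determinant of `S(u)`: `d = 1 + c_1 u⁻¹ + ⋯` and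
`A_N ⟨S_1, …, S_N⟩ = ⟨S_N, …, S_1⟩ A_N = A_N d`. -/
def IsSdet (c : Kind) (S : Matrix (Idx N) (Idx N) (PowerSeries A)) (d : PowerSeries A) : Prop :=
  PowerSeries.constantCoeff d = 1 ∧
  antisym N N (PowerSeries A) * bracket c S (List.finRange N)
      = antisym N N (PowerSeries A) * Matrix.scalar (Fin N → Idx N) d ∧
  bracket c S (List.finRange N).reverse * antisym N N (PowerSeries A)
      = antisym N N (PowerSeries A) * Matrix.scalar (Fin N → Idx N) d

end Determinants

/-- `φ` is the homomorphism `S(u) ↦ T(u) T^t(-u)` from the twisted Yangian to the Yangian. -/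
def IsEmb {c : Kind} {N : ℕ} (φ : TwistedYangian c N →ₐ[ℂ] Yangian N) : Prop :=
  (Smat c N).map (PowerSeries.map (φ : TwistedYangian c N →+* Yangian N))
    = Tmat N * twT c ((Tmat N).map (atLin (-1) 0))

/-- `γ_n(u)` as a series in `u⁻¹`, with `n = ⌊N/2⌋`: it is `1` in the orthogonal case and
`(2u + 1) / (2u - 2n + 1) = (2 + u⁻¹) / (2 + (1 - 2n) u⁻¹)` in the symplectic case. -/
def γ (N : ℕ) : Kind → PowerSeries ℂ
  | .orthogonal => 1
  | .symplectic => (PowerSeries.C 2 + PowerSeries.X) *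
      (PowerSeries.C 2 + PowerSeries.C (1 - 2 * ((N / 2 : ℕ) : ℂ)) * PowerSeries.X)⁻¹

end TwYang

end

set_option linter.unusedSectionVars false

/-! ### Substitution into series with noncommutative coefficients. -/

noncomputable section

namespace TwYang

open PowerSeries Finset

section Series

variable {A : Type*} [Ring A] [Algebra ℂ A]

/-! With `R = 1 - P / (u - v)`, `P` the flip, the Yangian relations read `R T₁(u) T₂(v) = T₂(v)
T₁(u) R`. The quaternary relation is the reflection equation `R S₁(u) Rᵗ S₂(v) = S₂(v) Rᵗ S₁(u) R`
with `Rᵗ = 1 + Q / (u + v)`. The relations are given coefficientwise but needed at arguments such as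
`u - a` and `-u + a`, so they are first shown to survive substitution of nonzero series `p`, `q`
without constant term for `u⁻¹` and `v⁻¹`, provided the scalars `1 / (u - v)` and `1 / (u + v)`
exist as series (`rtt_evalAt`, `reflection_evalAt`).

Both determinants come from one argument. Let products `F`, indexed by orderings of the copies,
satisfy `R_{ab} F(…, a, b, …) = F(…, b, a, …) R_{ab}` for `a < b` (`Exchange`). For `b = a + 1` the
operator is `1 - P_{ab}`, which makes `A F(1, …, N)` alternating on both sides. Antisymmetric
tensors of degree `N` over `ℂ^N` form a line, so this matrix is `A` times a series. Each `R_{ab}`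
acts on `A` by the nonzero scalar `1 + 1 / (b - a)`, so `A F A` is the same for the increasing and
the reversed ordering, and the left and right determinants agree (`Exchange.exists_det`). For the
brackets the exchange property also needs the Yang–Baxter equation for one `P` and two operators `Q`
(`word_exchange`, `yang_baxter`).

The matrix `T(u) Tᵗ(-u)` satisfies the reflection equation because of the `RTT` relation and its
transposes (`reflection_of_rtt`), and the symmetry relation because `T(-u)` can be moved past `T(u)`
(`smul_mul_twT_eq`).

For the formula, the crossing relation `Tᵗ_a(-u_a) Rᵗ_{ab} T_b(u_b) = T_b(u_b) Rᵗ_{ab} Tᵗ_a(-u_a)`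
sorts the bracket into `∏ T_a(u_a) · ∏ Rᵗ_{ab} · ∏ Tᵗ_a(-u_a)` (`word_mul`), and `A` absorbs the
three products in turn. The first yields `qdet T(u)`. The last yields `qdet T(-u + N - 1)`, by a
substitution, a reversal of the copies and a transposition (`IsQdet.antisym_mul_prod_twT`). The
middle one yields `γ` (`antisym_mul_word_one`): in the orthogonal case `P Q = Q` forces `A Q = 0`,
while in the symplectic case one entry is computed two copies at a time, and the factors `(2u - 2k +
1) / (2u - 2k - 1)` telescope. -/

theorem coeff_pow_mul_pow_eq_zero {p q : ℂ⟦X⟧} (hp : constantCoeff p = 0)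
    (hq : constantCoeff q = 0) {r s m : ℕ} (h : m < r + s) : coeff m (p ^ r * q ^ s) = 0 := by
  have hp' : (X : ℂ⟦X⟧) ∣ p := X_dvd_iff.2 hp
  have hq' : (X : ℂ⟦X⟧) ∣ q := X_dvd_iff.2 hq
  have : (X : ℂ⟦X⟧) ^ (r + s) ∣ p ^ r * q ^ s := by
    rw [pow_add]; exact mul_dvd_mul (pow_dvd_pow_of_dvd hp' r) (pow_dvd_pow_of_dvd hq' s)
  exact X_pow_dvd_iff.1 this m h

theorem coeff_pow_eq_zero {p : ℂ⟦X⟧} (hp : constantCoeff p = 0) {r m : ℕ} (h : m < r) :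
    coeff m (p ^ r) = 0 := by
  simpa using coeff_pow_mul_pow_eq_zero hp hp (r := r) (s := 0) (by omega)

/-- The series `∑ F_{rs} p^r q^s` over all `r, s ≥ 0`. -/
def biSeries (p q : ℂ⟦X⟧) (F : ℤ → ℤ → A) : A⟦X⟧ :=
  PowerSeries.mk fun m => ∑ r ∈ range (m + 1), ∑ s ∈ range (m + 1),
    coeff m (p ^ r * q ^ s) • F r s

/-- The series `f(p)` for a series `p` without constant term. -/
def evalAt (p : ℂ⟦X⟧) (f : A⟦X⟧) : A⟦X⟧ :=
  PowerSeries.mk fun m => ∑ r ∈ range (m + 1), coeff m (p ^ r) • coeff r f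

/-- The coefficients of a series as a function on the integers. -/
def zcoeff (f : A⟦X⟧) (r : ℤ) : A := if r < 0 then 0 else coeff r.toNat f

@[simp] theorem zcoeff_natCast (f : A⟦X⟧) (r : ℕ) : zcoeff f r = coeff r f := by
  simp [zcoeff]

theorem zcoeff_of_neg (f : A⟦X⟧) {r : ℤ} (h : r < 0) : zcoeff f r = 0 := by
  simp [zcoeff, h]

theorem atLin_eq (a b : ℂ) (f : A⟦X⟧) : atLin a b f = evalAt (linInv a b) f := rfl

/-- As `p ^ r * q ^ s` is divisible by `X ^ (r + s)`, raising either truncation bound adds only zero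
terms. The bounds are independent so that a shift of one index can be absorbed. -/
theorem coeff_biSeries (p q : ℂ⟦X⟧) (hp : constantCoeff p = 0) (hq : constantCoeff q = 0)
    (F : ℤ → ℤ → A) (m k l : ℕ) (hk : m < k) (hl : m < l) :
    coeff m (biSeries p q F)
      = ∑ r ∈ range k, ∑ s ∈ range l, coeff m (p ^ r * q ^ s) • F r s := by
  rw [biSeries, coeff_mk]
  have h1 : ∀ r : ℕ, ∑ s ∈ range (m + 1), coeff m (p ^ r * q ^ s) • F r s
      = ∑ s ∈ range l, coeff m (p ^ r * q ^ s) • F r s := fun r => by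
    apply sum_subset (range_mono hl)
    intro s _ hs
    rw [mem_range] at hs
    rw [coeff_pow_mul_pow_eq_zero hp hq (by omega), zero_smul]
  simp_rw [h1]
  apply sum_subset (range_mono hk)
  intro r _ hr
  rw [mem_range] at hr
  refine sum_eq_zero fun s _ => ?_
  rw [coeff_pow_mul_pow_eq_zero hp hq (by omega), zero_smul]

theorem coeff_evalAt (p : ℂ⟦X⟧) (hp : constantCoeff p = 0)
    (f : A⟦X⟧) (m k : ℕ) (hk : m < k) :
    coeff m (evalAt p f) = ∑ r ∈ range k, coeff m (p ^ r) • coeff r f := by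
  rw [evalAt, coeff_mk]
  apply sum_subset (range_mono hk)
  intro r _ hr
  rw [mem_range] at hr
  rw [coeff_pow_eq_zero hp (by omega), zero_smul]

theorem coeff_biSeries_mul {p q : ℂ⟦X⟧} (hp : constantCoeff p = 0) (hq : constantCoeff q = 0)
    (f g : A⟦X⟧) : evalAt p f * evalAt q g = biSeries p q fun r s => zcoeff f r * zcoeff g s := by
  ext m
  rw [biSeries, coeff_mk, coeff_mul]
  have h : ∀ x ∈ antidiagonal m, coeff x.1 (evalAt p f) * coeff x.2 (evalAt q g)
      = ∑ r ∈ range (m + 1), ∑ s ∈ range (m + 1),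
        (coeff x.1 (p ^ r) * coeff x.2 (q ^ s)) • (coeff r f * coeff s g) := by
    intro x hx
    have := mem_antidiagonal.1 hx
    rw [coeff_evalAt p hp f _ (m + 1) (by omega), coeff_evalAt q hq g _ (m + 1) (by omega),
      sum_mul_sum]
    simp_rw [smul_mul_smul_comm]
  rw [sum_congr rfl h, sum_comm]
  refine sum_congr rfl fun r _ => ?_
  rw [sum_comm]
  refine sum_congr rfl fun s _ => ?_
  rw [← sum_smul, ← coeff_mul]
  simp

theorem biSeries_add (p q : ℂ⟦X⟧) (F G : ℤ → ℤ → A) :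
    biSeries p q (fun r s => F r s + G r s) = biSeries p q F + biSeries p q G := by
  ext m; simp [biSeries, smul_add, sum_add_distrib]

theorem biSeries_sub (p q : ℂ⟦X⟧) (F G : ℤ → ℤ → A) :
    biSeries p q (fun r s => F r s - G r s) = biSeries p q F - biSeries p q G := by
  ext m; simp [biSeries, smul_sub, sum_sub_distrib]

theorem biSeries_zsmul (p q : ℂ⟦X⟧) (F : ℤ → ℤ → A) (z : ℤ) :
    biSeries p q (fun r s => z • F r s) = z • biSeries p q F := by
  ext m
  simp only [biSeries, coeff_mk, map_zsmul, smul_sum]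
  refine sum_congr rfl fun r _ => sum_congr rfl fun s _ => ?_
  exact smul_comm _ _ _

/-- Complex series act on series over `A` by multiplication. -/
abbrev seriesAlgebra (A : Type*) [Ring A] [Algebra ℂ A] : Algebra ℂ⟦X⟧ A⟦X⟧ :=
  (scalarSeries A).toAlgebra' fun c f => by
    ext m
    rw [coeff_mul, coeff_mul, ← Nat.sum_antidiagonal_swap]
    refine sum_congr rfl fun x _ => ?_
    simp only [scalarSeries, coeff_map, Prod.fst_swap, Prod.snd_swap]
    exact Algebra.commutes _ _

attribute [local instance] seriesAlgebra

theorem series_smul_def (c : ℂ⟦X⟧) (f : A⟦X⟧) : c • f = scalarSeries A c * f := rfl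

theorem coeff_series_smul (c : ℂ⟦X⟧) (f : A⟦X⟧) (m : ℕ) :
    coeff m (c • f) = ∑ x ∈ antidiagonal m, coeff x.1 c • coeff x.2 f := by
  rw [series_smul_def, coeff_mul]
  refine sum_congr rfl fun x _ => ?_
  rw [scalarSeries, coeff_map, Algebra.smul_def]

theorem C_series_smul (z : ℂ) (f : A⟦X⟧) : (PowerSeries.C z) • f = z • f := by
  ext m
  rw [series_smul_def, scalarSeries, map_C, coeff_C_mul, coeff_smul, Algebra.smul_def]

theorem X_series_smul (f : A⟦X⟧) : (X : ℂ⟦X⟧) • f = X * f := by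
  rw [series_smul_def, scalarSeries, map_X]

/-- Multiplication by `p` raises the exponent of `p` by one; `hF` removes the boundary term that the
shift creates at `r = 0`. -/
theorem biSeries_shift_left {p q : ℂ⟦X⟧} (hp : constantCoeff p = 0) (hq : constantCoeff q = 0)
    (F : ℤ → ℤ → A) (hF : ∀ s, F (-1) s = 0) :
    biSeries p q (fun r s => F (r - 1) s) = p • biSeries p q F := by
  ext m
  rw [coeff_series_smul, coeff_biSeries p q hp hq _ m (m + 1 + 1) (m + 1) (by omega) (by omega),
    sum_range_succ']
  have h : ∀ x ∈ antidiagonal m, coeff x.1 p • coeff x.2 (biSeries p q F)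
      = ∑ r ∈ range (m + 1), ∑ s ∈ range (m + 1),
        (coeff x.1 p * coeff x.2 (p ^ r * q ^ s)) • F r s := by
    intro x hx
    have := mem_antidiagonal.1 hx
    rw [coeff_biSeries p q hp hq F _ (m + 1) (m + 1) (by omega) (by omega)]
    simp_rw [smul_sum, smul_smul]
  rw [sum_congr rfl h, sum_comm (s := antidiagonal m)]
  simp only [Nat.cast_add, Nat.cast_one, add_sub_cancel_right, Nat.cast_zero, zero_sub, hF,
    smul_zero, sum_const_zero, add_zero]
  refine sum_congr rfl fun r _ => ?_
  rw [sum_comm (s := antidiagonal m)]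
  refine sum_congr rfl fun s _ => ?_
  rw [← sum_smul, ← coeff_mul, pow_succ']
  simp only [mul_assoc]

theorem biSeries_swap (p q : ℂ⟦X⟧) (F : ℤ → ℤ → A) :
    biSeries q p (fun r s => F s r) = biSeries p q F := by
  ext m
  rw [biSeries, biSeries, coeff_mk, coeff_mk, sum_comm]
  simp_rw [mul_comm]

theorem biSeries_shift_right {p q : ℂ⟦X⟧} (hp : constantCoeff p = 0)
    (hq : constantCoeff q = 0) (F : ℤ → ℤ → A) (hF : ∀ r, F r (-1) = 0) :
    biSeries p q (fun r s => F r (s - 1)) = q • biSeries p q F := by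
  rw [← biSeries_swap p q F, ← biSeries_swap p q fun r s => F r (s - 1)]
  exact biSeries_shift_left hq hp (fun s r => F r s) hF

theorem evalAt_add (p : ℂ⟦X⟧) (f g : A⟦X⟧) : evalAt p (f + g) = evalAt p f + evalAt p g := by
  ext m; simp [evalAt, smul_add, sum_add_distrib]

/-- Substitution is multiplicative over a noncommutative `A` because the substituted series has
central, scalar coefficients. -/
theorem evalAt_mul {p : ℂ⟦X⟧} (hp : constantCoeff p = 0) (f g : A⟦X⟧) :
    evalAt p (f * g) = evalAt p f * evalAt p g := by
  rw [coeff_biSeries_mul hp hp]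
  ext m
  rw [evalAt, coeff_mk, coeff_biSeries p p hp hp _ m (m + 1) (m + 1) (by omega) (by omega)]
  simp only [zcoeff_natCast, coeff_mul, smul_sum, ← sum_product', ← pow_add]
  rw [sum_sigma']
  symm
  -- Pairs with `r + s > m` contribute nothing; the others are regrouped by their sum into
  -- antidiagonals.
  refine sum_subset_zero_on_sdiff (s₁ := (range (m+1) ×ˢ range (m+1)).filter fun x => x.1 + x.2 ≤ m)
    (filter_subset _ _) ?_ (fun _ _ => rfl) |>.symm.trans ?_
  · intro x hx
    simp only [mem_sdiff, mem_product, mem_range, mem_filter] at hx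
    rw [coeff_pow_eq_zero hp (by omega), zero_smul]
  · refine sum_bij' (fun x _ => ⟨x.1 + x.2, x⟩) (fun y _ => y.2) ?_ ?_ ?_ ?_ ?_
    · intro x hx
      simp only [mem_product, mem_range, mem_filter, mem_sigma, HasAntidiagonal.mem_antidiagonal] at hx ⊢
      exact ⟨by omega, trivial⟩
    · intro x hx
      simp only [mem_product, mem_range, mem_filter, mem_sigma, HasAntidiagonal.mem_antidiagonal] at hx ⊢
      omega
    · intro x _; rfl
    · rintro ⟨k, x⟩ hx
      simp only [mem_sigma, HasAntidiagonal.mem_antidiagonal] at hx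
      obtain ⟨_, rfl⟩ := hx
      rfl
    · intro x _; rfl

theorem evalAt_one (p : ℂ⟦X⟧) : evalAt p (1 : A⟦X⟧) = 1 := by
  ext m
  rw [evalAt, coeff_mk, sum_eq_single 0]
  · by_cases h : m = 0 <;> simp [coeff_one, h]
  · intro r _ hr; simp [coeff_one, hr]
  · simp

theorem evalAt_zero (p : ℂ⟦X⟧) : evalAt p (0 : A⟦X⟧) = 0 := by
  ext m; simp [evalAt]

/-- Substitution of a series without constant term, as a ring homomorphism. -/
def evalHom (A : Type*) [Ring A] [Algebra ℂ A] {p : ℂ⟦X⟧} (hp : constantCoeff p = 0) :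
    A⟦X⟧ →+* A⟦X⟧ where
  toFun := evalAt p
  map_one' := evalAt_one p
  map_mul' := evalAt_mul hp
  map_zero' := evalAt_zero p
  map_add' := evalAt_add p

@[simp] theorem evalHom_apply {p : ℂ⟦X⟧} (hp : constantCoeff p = 0) (f : A⟦X⟧) :
    evalHom A hp f = evalAt p f := rfl

theorem constantCoeff_evalAt (p : ℂ⟦X⟧) (f : A⟦X⟧) :
    constantCoeff (evalAt p f) = constantCoeff f := by
  rw [← coeff_zero_eq_constantCoeff_apply, evalAt, coeff_mk]
  simp

theorem evalAt_evalAt {p q : ℂ⟦X⟧} (hp : constantCoeff p = 0) (hq : constantCoeff q = 0)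
    (f : A⟦X⟧) : evalAt p (evalAt q f) = evalAt (evalAt p q) f := by
  have hpq : constantCoeff (evalAt p q) = 0 := by rw [constantCoeff_evalAt, hq]
  ext m
  rw [coeff_evalAt p hp _ m (m + 1) (by omega), coeff_evalAt _ hpq _ m (m + 1) (by omega)]
  have h : ∀ r ∈ range (m + 1), coeff m (p ^ r) • coeff r (evalAt q f)
      = ∑ s ∈ range (m + 1), (coeff m (p ^ r) * coeff r (q ^ s)) • coeff s f := by
    intro r hr
    rw [mem_range] at hr
    rw [coeff_evalAt q hq _ r (m + 1) (by omega), smul_sum]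
    simp_rw [smul_smul]
  rw [sum_congr rfl h, sum_comm]
  refine sum_congr rfl fun s _ => ?_
  rw [← sum_smul]
  congr 1
  have : evalAt p q ^ s = evalAt p (q ^ s) := by
    rw [← evalHom_apply hp, ← evalHom_apply hp, map_pow]
  rw [this, coeff_evalAt p hp _ m (m + 1) (by omega)]
  rfl

theorem constantCoeff_linInv (a b : ℂ) : constantCoeff (linInv a b) = 0 := by
  simp [linInv]

theorem linInv_spec {a : ℂ} (ha : a ≠ 0) (b : ℂ) :
    (PowerSeries.C a + PowerSeries.C b * X) * linInv a b = X := by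
  rw [linInv, mul_left_comm, PowerSeries.mul_inv_cancel, mul_one]
  simpa using ha

theorem lin_ne_zero {a : ℂ} (ha : a ≠ 0) (b : ℂ) :
    (PowerSeries.C a + PowerSeries.C b * X : ℂ⟦X⟧) ≠ 0 := by
  intro h
  have := congrArg constantCoeff h
  simp at this
  exact ha this

theorem linInv_unique {a : ℂ} (ha : a ≠ 0) (b : ℂ) {f : ℂ⟦X⟧}
    (h : (PowerSeries.C a + PowerSeries.C b * X) * f = X) : f = linInv a b :=
  mul_left_cancel₀ (lin_ne_zero ha b) (h.trans (linInv_spec ha b).symm)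

theorem evalAt_X {p : ℂ⟦X⟧} (hp : constantCoeff p = 0) : evalAt p X = p := by
  ext m
  rw [coeff_evalAt p hp _ m (m + 2) (by omega), sum_eq_single 1]
  · simp
  · intro r _ hr; simp [coeff_X, hr]
  · intro h; simp at h

theorem evalAt_C (p : ℂ⟦X⟧) (z : A) :
    evalAt p (PowerSeries.C z) = PowerSeries.C z := by
  ext m
  rw [evalAt, coeff_mk, sum_eq_single 0]
  · by_cases h : m = 0 <;> simp [coeff_C, coeff_one, h]
  · intro r _ hr; simp [coeff_C, hr]
  · simp

theorem evalAt_linInv {a b a' b' : ℂ} (ha : a ≠ 0) (ha' : a' ≠ 0) :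
    evalAt (linInv a' b') (linInv a b) = linInv (a * a') (a * b' + b) := by
  have hp := constantCoeff_linInv a' b'
  apply linInv_unique (mul_ne_zero ha ha')
  have h := congrArg (evalHom ℂ hp) (linInv_spec ha b)
  simp only [map_mul, map_add, evalHom_apply, evalAt_X hp, evalAt_C] at h
  have h2 := linInv_spec ha' b'
  set E := evalAt (linInv a' b') (linInv a b)
  set p := linInv a' b'
  have : (PowerSeries.C a' + PowerSeries.C b' * X) * ((PowerSeries.C a + PowerSeries.C b * p) * E)
    = X := by rw [h, h2]
  refine Eq.trans ?_ this
  simp only [map_mul, map_add]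
  linear_combination (-(PowerSeries.C b) * E) * h2

theorem atLin_atLin {a b a' b' : ℂ} (ha : a ≠ 0) (ha' : a' ≠ 0) (f : A⟦X⟧) :
    atLin a' b' (atLin a b f) = atLin (a * a') (a * b' + b) f := by
  rw [atLin_eq, atLin_eq, atLin_eq, evalAt_evalAt (constantCoeff_linInv _ _)
    (constantCoeff_linInv _ _), evalAt_linInv ha ha']

/-- A nonzero scalar series is a power of `X` times a unit, and multiplication by `X` merely shifts
coefficients, so nothing is required of `A`. -/
theorem smul_cancel_of_ne_zero {c : ℂ⟦X⟧} (hc : c ≠ 0) {f g : A⟦X⟧} (h : c • f = c • g) :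
    f = g := by
  have hu := X_pow_order_mul_divXPowOrder (f := c)
  rw [← Unit_of_divided_by_X_pow_order_nonzero hc] at hu
  rw [← hu, mul_smul, mul_smul] at h
  have hX : ∀ (n : ℕ) (f g : A⟦X⟧), (X ^ n : ℂ⟦X⟧) • f = (X ^ n : ℂ⟦X⟧) • g → f = g := by
    intro n
    induction n with
    | zero => intro f g h; simpa using h
    | succ n ih =>
      intro f g h
      rw [pow_succ, mul_smul, mul_smul] at h
      have h2 := ih _ _ h
      rw [X_series_smul, X_series_smul] at h2
      ext k
      have := congrArg (coeff (k + 1)) h2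
      rwa [coeff_succ_X_mul, coeff_succ_X_mul] at this
  have h2 := congrArg (fun z => ((Unit_of_divided_by_X_pow_order c)⁻¹ : ℂ⟦X⟧ˣ).1 • z) (hX _ _ _ h)
  simpa only [smul_smul, Units.inv_mul, one_smul] using h2

end Series

end TwYang

end

/-! ### From coefficient relations to relations between series, and back. -/

noncomputable section

namespace TwYang

open PowerSeries Finset

attribute [local instance] seriesAlgebra

section Relations

variable {N : ℕ} {K B : Type*} [CommRing K] [Ring B] [Algebra K B]

/-- The relation `[T_{ij}, T'_{kl}] = α (T_{kj} T'_{il} - T'_{kj} T_{il})`. -/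
def RTT (T T' : Matrix (Idx N) (Idx N) B) (α : K) : Prop :=
  ∀ i j k l, T i j * T' k l - T' k l * T i j = α • (T k j * T' i l - T' k j * T i l)

/-- The quaternary relation divided by `u² - v²`, with `α = (u - v)⁻¹` and `β = (u + v)⁻¹`. -/
def Reflection (c : Kind) (S S' : Matrix (Idx N) (Idx N) B) (α β : K) : Prop :=
  ∀ i j k l, S i j * S' k l - S' k l * S i j
    = α • (S k j * S' i l - S' k j * S i l)
      - β • (θ c k (-j) • (S i (-k) * S' (-j) l) - θ c i (-l) • (S' k (-i) * S (-l) j))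
      + (α * β) • (θ c i (-j) • (S k (-i) * S' (-j) l - S' k (-i) * S (-j) l))

end Relations

section Coefficients

variable {N : ℕ} {A : Type*} [Ring A] [Algebra ℂ A]

/-- Extension of the coefficients by zero to negative indices makes every index shift a
multiplication by `p ^ a * q ^ b`, without boundary terms. This converts coefficient relations into
relations between series. -/
theorem biSeries_mul_shift {p q : ℂ⟦X⟧} (hp : constantCoeff p = 0) (hq : constantCoeff q = 0)
    (f g : A⟦X⟧) (a b : ℕ) :
    biSeries p q (fun r s => zcoeff f (r - a) * zcoeff g (s - b))
      = (p ^ a * q ^ b) • (evalAt p f * evalAt q g) := by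
  induction a with
  | zero =>
    induction b with
    | zero => simp [coeff_biSeries_mul hp hq]
    | succ b ih =>
      have := biSeries_shift_right hp hq
        (fun r s => zcoeff f (r - (0 : ℕ)) * zcoeff g (s - b))
        (fun r => by rw [zcoeff_of_neg g (by omega), mul_zero])
      rw [ih, smul_smul] at this
      convert this using 1
      · congr; ext r s; congr 2; push_cast; ring
      · congr 1; ring
  | succ a ih =>
    have := biSeries_shift_left hp hq (fun r s => zcoeff f (r - a) * zcoeff g (s - b))
      (fun r => by rw [zcoeff_of_neg f (by omega), zero_mul])
    rw [ih, smul_smul] at this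
    convert this using 1
    · congr; ext r s; congr 2; push_cast; ring
    · congr 1; ring

theorem biSeries_mul_shift_rev {p q : ℂ⟦X⟧} (hp : constantCoeff p = 0)
    (hq : constantCoeff q = 0) (f g : A⟦X⟧) (a b : ℕ) :
    biSeries p q (fun r s => zcoeff f (s - b) * zcoeff g (r - a))
      = (p ^ a * q ^ b) • (evalAt q f * evalAt p g) := by
  rw [mul_comm (p ^ a), ← biSeries_mul_shift hq hp f g b a]
  exact biSeries_swap q p fun s r => zcoeff f (s - b) * zcoeff g (r - a)

theorem biSeries_zero (p q : ℂ⟦X⟧) (F : ℤ → ℤ → A) (h : ∀ r s : ℕ, F r s = 0) :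
    biSeries p q F = 0 := by
  ext m; simp [biSeries, h]

theorem genZ_natCast (i j : Idx N) (r : ℕ) : genZ i j r = gen i j r := by simp [genZ]

theorem genZ_of_neg (i j : Idx N) {r : ℤ} (h : r < 0) : genZ i j r = 0 := by simp [genZ, h]

theorem zcoeff_mk (f : ℕ → A) (r : ℤ) :
    zcoeff (PowerSeries.mk f) r = if r < 0 then 0 else f r.toNat := by simp [zcoeff]

theorem zcoeff_Tmat (i j : Idx N) (r : ℤ) :
    zcoeff (Tmat N i j) r = RingQuot.mkAlgHom ℂ (YangianRel N) (genZ i j r) := by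
  simp only [Tmat, Matrix.of_apply, zcoeff_mk, genZ]
  split_ifs <;> simp

theorem zcoeff_Smat (c : Kind) (i j : Idx N) (r : ℤ) :
    zcoeff (Smat c N i j) r = RingQuot.mkAlgHom ℂ (TwistedRel c N) (genZ i j r) := by
  simp only [Smat, Matrix.of_apply, zcoeff_mk, genZ]
  split_ifs <;> simp

/-- At `r = -1` or `s = -1` only a commutator with the scalar `t^{(0)}` is left, and below that
everything vanishes. The relation can therefore be summed over all integers. -/
theorem yangian_relation (i j k l : Idx N) (r s : ℤ) :
    (zcoeff (Tmat N i j) (r + 1) * zcoeff (Tmat N k l) s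
        - zcoeff (Tmat N k l) s * zcoeff (Tmat N i j) (r + 1))
      - (zcoeff (Tmat N i j) r * zcoeff (Tmat N k l) (s + 1)
        - zcoeff (Tmat N k l) (s + 1) * zcoeff (Tmat N i j) r)
    = zcoeff (Tmat N k j) r * zcoeff (Tmat N i l) s
      - zcoeff (Tmat N k j) s * zcoeff (Tmat N i l) r := by
  have hone : ∀ (i j : Idx N) (x : FreeAlg N), gen i j 0 * x = x * gen i j 0 := by
    intro i j x; simp only [gen]; split_ifs <;> simp
  have hpos : ∀ r s : ℕ, (genZ i j (r + 1) * genZ k l s - genZ k l s * genZ i j (r + 1))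
      - (genZ i j r * genZ k l (s + 1) - genZ k l (s + 1) * genZ i j r)
        = ⁅gen i j (r + 1), gen k l s⁆ - ⁅gen i j r, gen k l (s + 1)⁆ := by
    intro r s
    have := genZ_natCast i j (r + 1)
    have := genZ_natCast k l (s + 1)
    push_cast at *
    simp only [genZ_natCast, Ring.lie_def, *]
  simp only [zcoeff_Tmat, ← map_mul, ← map_sub]
  rcases lt_or_ge r 0 with hr | hr
  · congr 1
    rw [genZ_of_neg i j hr, genZ_of_neg k j hr, genZ_of_neg i l hr]
    rcases lt_or_ge r (-1) with hr' | hr'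
    · rw [genZ_of_neg i j (by omega)]; simp
    · obtain rfl : r = -1 := by omega
      have := genZ_natCast i j 0
      simp only [Nat.cast_zero] at this
      simp [this, hone]
  · rcases lt_or_ge s 0 with hs | hs
    · congr 1
      rw [genZ_of_neg k l hs, genZ_of_neg k j hs, genZ_of_neg i l hs]
      rcases lt_or_ge s (-1) with hs' | hs'
      · rw [genZ_of_neg k l (by omega)]; simp
      · obtain rfl : s = -1 := by omega
        have := genZ_natCast k l 0
        simp only [Nat.cast_zero] at this
        simp [this, hone]
    · lift r to ℕ using hr
      lift s to ℕ using hs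
      rw [hpos]
      simp only [genZ_natCast]
      exact RingQuot.mkAlgHom_rel ℂ (YangianRel.rtt i j k l r s)

theorem smul_rtt_aux {K M : Type*} [CommRing K] [AddCommGroup M] [Module K M] (p q : K)
    (a1 a2 a3 a4 : M)
    (h : (p ^ 0 * q ^ 1) • a1 - (p ^ 0 * q ^ 1) • a2 - ((p ^ 1 * q ^ 0) • a1 - (p ^ 1 * q ^ 0) • a2)
      - ((p ^ 1 * q ^ 1) • a3 - (p ^ 1 * q ^ 1) • a4) = 0) :
    (q - p) • (a1 - a2) = (p * q) • (a3 - a4) := by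
  rw [← sub_eq_zero, ← h]
  module

/-- Multiplication by `α * β` clears the polynomial factors: those of the commutator, of the
`P`-terms and of the `Q`-terms become `(p * q) ^ 2` times `1`, `α` and `β`. The explicit zero
exponents match the output of `biSeries_mul_shift`. -/
theorem smul_quat_aux {K M : Type*} [CommRing K] [AddCommGroup M] [Module K M] {p q α β : K}
    (hα : α * (q - p) = p * q) (hβ : β * (p + q) = p * q) (z1 z2 z3 : ℤ)
    (a1 a2 a3 a4 a5 a6 a7 a8 : M) :
    (α * β) • ((p ^ 0 * q ^ 2) • a1 - (p ^ 0 * q ^ 2) • a2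
      - ((p ^ 2 * q ^ 0) • a1 - (p ^ 2 * q ^ 0) • a2)
      - ((p ^ 1 * q ^ 2) • a3 - (p ^ 1 * q ^ 2) • a4
        + ((p ^ 2 * q ^ 1) • a3 - (p ^ 2 * q ^ 1) • a4)
        - (z1 • (p ^ 1 * q ^ 2) • a5 - z2 • (p ^ 1 * q ^ 2) • a6)
        + (z1 • (p ^ 2 * q ^ 1) • a5 - z2 • (p ^ 2 * q ^ 1) • a6)
        + z3 • ((p ^ 2 * q ^ 2) • a7 - (p ^ 2 * q ^ 2) • a8)))
    = (p * q) ^ 2 • (a1 - a2 - (α • (a3 - a4) - β • (z1 • a5 - z2 • a6)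
        + (α * β) • z3 • (a7 - a8))) := by
  have h1 : α * β * (q ^ 2 - p ^ 2) = (p * q) ^ 2 := by
    linear_combination (β * (p + q)) * hα + p * q * hβ
  have h2 : α * β * (p * q ^ 2 + p ^ 2 * q) = (p * q) ^ 2 * α := by
    linear_combination (α * p * q) * hβ
  have h3 : α * β * (p * q ^ 2 - p ^ 2 * q) = (p * q) ^ 2 * β := by
    linear_combination (β * p * q) * hα
  calc _ = (α * β * (q ^ 2 - p ^ 2)) • (a1 - a2)
      - ((α * β * (p * q ^ 2 + p ^ 2 * q)) • (a3 - a4)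
        - (α * β * (p * q ^ 2 - p ^ 2 * q)) • (z1 • a5 - z2 • a6)
        + (α * β * (p * q) ^ 2) • z3 • (a7 - a8)) := by module
    _ = _ := by
      rw [h1, h2, h3]
      module

/-- For `p = u⁻¹` and `q = v⁻¹` the condition `hα` says `α = 1 / (u - v)`. Summing the coefficient
relations against powers of `p` and `q` gives the claim multiplied by `p * q`, which cancels. -/
theorem rtt_of_zcoeff (T : Matrix (Idx N) (Idx N) A⟦X⟧) {p q α : ℂ⟦X⟧} (hp : constantCoeff p = 0) (hq : constantCoeff q = 0)
    (hp0 : p ≠ 0) (hq0 : q ≠ 0) (hα : α * (q - p) = p * q)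
    (hT : ∀ (i j k l : Idx N) (r s : ℤ),
      (zcoeff (T i j) (r + 1) * zcoeff (T k l) s - zcoeff (T k l) s * zcoeff (T i j) (r + 1))
        - (zcoeff (T i j) r * zcoeff (T k l) (s + 1) - zcoeff (T k l) (s + 1) * zcoeff (T i j) r)
      = zcoeff (T k j) r * zcoeff (T i l) s - zcoeff (T k j) s * zcoeff (T i l) r) :
    RTT (T.map (evalAt p)) (T.map (evalAt q)) α := by
  intro i j k l
  have h := biSeries_zero p q (fun r s =>
    ((zcoeff (T i j) (r - (0 : ℕ)) * zcoeff (T k l) (s - (1 : ℕ))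
        - zcoeff (T k l) (s - (1 : ℕ)) * zcoeff (T i j) (r - (0 : ℕ)))
      - (zcoeff (T i j) (r - (1 : ℕ)) * zcoeff (T k l) (s - (0 : ℕ))
        - zcoeff (T k l) (s - (0 : ℕ)) * zcoeff (T i j) (r - (1 : ℕ))))
    - (zcoeff (T k j) (r - (1 : ℕ)) * zcoeff (T i l) (s - (1 : ℕ))
      - zcoeff (T k j) (s - (1 : ℕ)) * zcoeff (T i l) (r - (1 : ℕ)))) (by
    intro r s
    have := hT i j k l (r - 1) (s - 1)
    rw [← sub_eq_zero] at this
    simpa using this)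
  simp only [biSeries_sub, biSeries_mul_shift hp hq, biSeries_mul_shift_rev hp hq] at h
  simp only [Matrix.map_apply]
  apply smul_cancel_of_ne_zero (mul_ne_zero hp0 hq0)
  have h2 := smul_rtt_aux _ _ _ _ _ _ h
  rw [← hα, mul_smul, h2, smul_smul, smul_smul, mul_comm, hα]

theorem rtt_evalAt {p q α : ℂ⟦X⟧} (hp : constantCoeff p = 0) (hq : constantCoeff q = 0)
    (hp0 : p ≠ 0) (hq0 : q ≠ 0) (hα : α * (q - p) = p * q) :
    RTT ((Tmat N).map (evalAt p)) ((Tmat N).map (evalAt q)) α :=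
  rtt_of_zcoeff _ hp hq hp0 hq0 hα yangian_relation

/-- The difference of the two sides of the coefficient of `u^{-r+2} v^{-s+2}` in the quaternary
relation. -/
def quatDefect (c : Kind) (S : Matrix (Idx N) (Idx N) A⟦X⟧) (i j k l : Idx N) (r s : ℤ) : A :=
  ((zcoeff (S i j) (r - (0 : ℕ)) * zcoeff (S k l) (s - (2 : ℕ))
      - zcoeff (S k l) (s - (2 : ℕ)) * zcoeff (S i j) (r - (0 : ℕ)))
    - (zcoeff (S i j) (r - (2 : ℕ)) * zcoeff (S k l) (s - (0 : ℕ))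
      - zcoeff (S k l) (s - (0 : ℕ)) * zcoeff (S i j) (r - (2 : ℕ))))
  - ((zcoeff (S k j) (r - (1 : ℕ)) * zcoeff (S i l) (s - (2 : ℕ))
        - zcoeff (S k j) (s - (2 : ℕ)) * zcoeff (S i l) (r - (1 : ℕ)))
      + (zcoeff (S k j) (r - (2 : ℕ)) * zcoeff (S i l) (s - (1 : ℕ))
        - zcoeff (S k j) (s - (1 : ℕ)) * zcoeff (S i l) (r - (2 : ℕ)))
      - (θ c k (-j) • (zcoeff (S i (-k)) (r - (1 : ℕ)) * zcoeff (S (-j) l) (s - (2 : ℕ)))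
        - θ c i (-l) • (zcoeff (S k (-i)) (s - (2 : ℕ)) * zcoeff (S (-l) j) (r - (1 : ℕ))))
      + (θ c k (-j) • (zcoeff (S i (-k)) (r - (2 : ℕ)) * zcoeff (S (-j) l) (s - (1 : ℕ)))
        - θ c i (-l) • (zcoeff (S k (-i)) (s - (1 : ℕ)) * zcoeff (S (-l) j) (r - (2 : ℕ))))
      + θ c i (-j) • (zcoeff (S k (-i)) (r - (2 : ℕ)) * zcoeff (S (-j) l) (s - (2 : ℕ))
        - zcoeff (S k (-i)) (s - (2 : ℕ)) * zcoeff (S (-j) l) (r - (2 : ℕ))))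

theorem smul_biSeries_quatDefect (c : Kind) (S : Matrix (Idx N) (Idx N) A⟦X⟧) (i j k l : Idx N)
    {p q α β : ℂ⟦X⟧} (hp : constantCoeff p = 0) (hq : constantCoeff q = 0)
    (hα : α * (q - p) = p * q) (hβ : β * (p + q) = p * q) :
    (α * β) • biSeries p q (quatDefect c S i j k l) = (p * q) ^ 2 •
      ((evalAt p (S i j) * evalAt q (S k l) - evalAt q (S k l) * evalAt p (S i j))
        - (α • (evalAt p (S k j) * evalAt q (S i l) - evalAt q (S k j) * evalAt p (S i l))
          - β • (θ c k (-j) • (evalAt p (S i (-k)) * evalAt q (S (-j) l))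
            - θ c i (-l) • (evalAt q (S k (-i)) * evalAt p (S (-l) j)))
          + (α * β) • (θ c i (-j) • (evalAt p (S k (-i)) * evalAt q (S (-j) l)
            - evalAt q (S k (-i)) * evalAt p (S (-j) l))))) := by
  unfold quatDefect
  simp only [biSeries_sub, biSeries_add, biSeries_zsmul, biSeries_mul_shift hp hq,
    biSeries_mul_shift_rev hp hq]
  exact smul_quat_aux hα hβ _ _ _ _ _ _ _ _ _ _ _

theorem reflection_of_quatDefect_eq_zero (c : Kind) (S : Matrix (Idx N) (Idx N) A⟦X⟧)
    {p q α β : ℂ⟦X⟧} (hp : constantCoeff p = 0)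
    (hq : constantCoeff q = 0) (hp0 : p ≠ 0) (hq0 : q ≠ 0) (hα : α * (q - p) = p * q)
    (hβ : β * (p + q) = p * q)
    (hS : ∀ (i j k l : Idx N) (r s : ℕ), quatDefect c S i j k l r s = 0) :
    Reflection c (S.map (evalAt p)) (S.map (evalAt q)) α β := by
  intro i j k l
  have h := smul_biSeries_quatDefect c S i j k l hp hq hα hβ
  rw [biSeries_zero _ _ _ (hS i j k l), smul_zero] at h
  have := smul_cancel_of_ne_zero (pow_ne_zero 2 (mul_ne_zero hp0 hq0)) ((smul_zero _).trans h)
  exact sub_eq_zero.1 this.symm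

theorem reflection_evalAt (c : Kind) {p q α β : ℂ⟦X⟧} (hp : constantCoeff p = 0)
    (hq : constantCoeff q = 0) (hp0 : p ≠ 0) (hq0 : q ≠ 0) (hα : α * (q - p) = p * q)
    (hβ : β * (p + q) = p * q) :
    Reflection c ((Smat c N).map (evalAt p)) ((Smat c N).map (evalAt q)) α β := by
  refine reflection_of_quatDefect_eq_zero c _ hp hq hp0 hq0 hα hβ fun i j k l r s => ?_
  have h := RingQuot.mkAlgHom_rel ℂ (TwistedRel.quat (c := c) i j k l ((r : ℤ) - 2) (s - 2))
  simp only [map_add, map_sub, map_mul, map_zsmul, Ring.lie_def, ← zcoeff_Smat] at h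
  rw [← sub_eq_zero] at h
  rw [quatDefect, ← h]
  have e1 : ∀ r : ℤ, r - 2 + 2 = r := fun r => by ring
  have e2 : ∀ r : ℤ, r - 2 + 1 = r - 1 := fun r => by ring
  simp only [e1, e2, Nat.cast_zero, sub_zero, Nat.cast_ofNat, Nat.cast_one]

theorem evalAt_X_left (f : A⟦X⟧) : evalAt X f = f := by
  ext m
  rw [evalAt, coeff_mk, sum_eq_single m]
  · simp
  · intro r _ hr; simp [coeff_X_pow, hr.symm]
  · simp

/-- On the line `q = a p` the coefficient of `X ^ (r + s)` is a polynomial in `a` whose coefficients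
are the values of `F` on an antidiagonal. It has infinitely many roots. Linear functionals on `A`
reduce this to complex polynomials. -/
theorem eq_zero_of_biSeries_eq_zero (F : ℤ → ℤ → A)
    (h : ∀ a : ℂ, a ≠ 0 → a ≠ 1 → a ≠ -1 → biSeries X (PowerSeries.C a * X) F = 0) (r s : ℕ) :
    F r s = 0 := by
  rw [← Module.forall_dual_apply_eq_zero_iff ℂ]
  intro f
  set P : Polynomial ℂ := ∑ t ∈ range (r + s + 1),
    Polynomial.monomial t (f (F ((r + s - t : ℕ) : ℤ) t)) with hP
  have hroot : ∀ a : ℂ, a ≠ 0 → a ≠ 1 → a ≠ -1 → P.IsRoot a := by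
    intro a h0 h1 h2
    have := congrArg f (congrArg (coeff (r + s)) (h a h0 h1 h2))
    rw [biSeries, coeff_mk, sum_comm] at this
    simp only [map_zero, map_sum] at this
    rw [Polynomial.IsRoot, hP, Polynomial.eval_finsetSum, ← this]
    refine sum_congr rfl fun t ht => ?_
    rw [mem_range] at ht
    rw [Polynomial.eval_monomial, sum_eq_single (r + s - t)]
    · have : (X : ℂ⟦X⟧) ^ (r + s - t) * (PowerSeries.C a * X) ^ t
          = PowerSeries.C (a ^ t) * X ^ (r + s) := by
        rw [mul_pow, mul_left_comm, ← pow_add, map_pow, Nat.sub_add_cancel (by omega)]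
      rw [this, coeff_C_mul, coeff_X_pow_self, mul_one, map_smul, smul_eq_mul, mul_comm]
    · intro k _ hk
      have : (X : ℂ⟦X⟧) ^ k * (PowerSeries.C a * X) ^ t
          = PowerSeries.C (a ^ t) * X ^ (k + t) := by
        rw [mul_pow, mul_left_comm, ← pow_add, map_pow]
      rw [this, coeff_C_mul, coeff_X_pow, if_neg (by omega), mul_zero, zero_smul, map_zero]
    · intro hk; simp at hk
  have hP0 : P = 0 := by
    apply Polynomial.eq_zero_of_infinite_isRoot
    refine Set.Infinite.mono (s := ({0, 1, -1} : Set ℂ)ᶜ) ?_ ?_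
    · intro a ha
      simp only [Set.mem_compl_iff, Set.mem_insert_iff, Set.mem_singleton_iff, not_or] at ha
      exact hroot a ha.1 ha.2.1 ha.2.2
    · exact (Set.toFinite _).infinite_compl
  have := congrArg (fun Q => Polynomial.coeff Q s) hP0
  simp only [hP, Polynomial.finsetSum_coeff, Polynomial.coeff_monomial, Polynomial.coeff_zero,
    sum_ite_eq', mem_range] at this
  rw [if_pos (by omega)] at this
  simpa using this

/-- The converse passage, tested at `v = u / a`, where `1 / (u - v)` and `1 / (u + v)` are multiples
of `u⁻¹`; their poles are the excluded values `1` and `-1`. -/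
theorem quatDefect_eq_zero (c : Kind) (S : Matrix (Idx N) (Idx N) A⟦X⟧)
    (hS : ∀ a : ℂ, a ≠ 0 → a ≠ 1 → a ≠ -1 → Reflection c S
      (S.map (evalAt (PowerSeries.C a * X))) (PowerSeries.C (a / (a - 1)) * X)
      (PowerSeries.C (a / (a + 1)) * X))
    (i j k l : Idx N) (r s : ℤ) : quatDefect c S i j k l r s = 0 := by
  rcases lt_or_ge r 0 with hr | hr
  · simp only [quatDefect, Nat.cast_zero, sub_zero]
    simp [zcoeff_of_neg, hr, show r - 1 < 0 by omega, show r - 2 < 0 by omega]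
  rcases lt_or_ge s 0 with hs | hs
  · simp only [quatDefect, Nat.cast_zero, sub_zero]
    simp [zcoeff_of_neg, hs, show s - 1 < 0 by omega, show s - 2 < 0 by omega]
  lift r to ℕ using hr
  lift s to ℕ using hs
  refine eq_zero_of_biSeries_eq_zero _ (fun a h0 h1 h2 => ?_) r s
  have h1' : a - 1 ≠ 0 := sub_ne_zero.2 h1
  have h2' : a + 1 ≠ 0 := fun h => h2 (eq_neg_of_add_eq_zero_left h)
  have hX0 : ∀ b : ℂ, b ≠ 0 → (PowerSeries.C b * X : ℂ⟦X⟧) ≠ 0 := fun b hb =>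
    mul_ne_zero (by simpa using hb) X_ne_zero
  have h := smul_biSeries_quatDefect c S i j k l (p := X) (q := PowerSeries.C a * X)
    (α := PowerSeries.C (a / (a - 1)) * X) (β := PowerSeries.C (a / (a + 1)) * X)
    (by simp) (by simp) (by
      have : (PowerSeries.C a : ℂ⟦X⟧) = PowerSeries.C (a / (a - 1)) * (PowerSeries.C a - 1) := by
        rw [← map_one PowerSeries.C, ← map_sub, ← map_mul, div_mul_cancel₀ _ h1']
      linear_combination (-X ^ 2) * this) (by
      have : (PowerSeries.C a : ℂ⟦X⟧) = PowerSeries.C (a / (a + 1)) * (PowerSeries.C a + 1) := by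
        rw [← map_one PowerSeries.C, ← map_add, ← map_mul, div_mul_cancel₀ _ h2']
      linear_combination (-X ^ 2) * this)
  have h3 := hS a h0 h1 h2 i j k l
  simp only [Matrix.map_apply] at h3
  simp only [evalAt_X_left] at h
  rw [h3, sub_self, smul_zero] at h
  exact smul_cancel_of_ne_zero (mul_ne_zero (hX0 _ (div_ne_zero h0 h1'))
    (hX0 _ (div_ne_zero h0 h2'))) (h.trans (smul_zero _).symm)

end Coefficients

end TwYang

end

/-! ### Signs of indices, and operators on tensor factors. -/

noncomputable section

namespace TwYang

open Finset Matrix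

instance (N : ℕ) : InvolutiveNeg (Idx N) :=
  { (inferInstance : Neg (Idx N)) with neg_neg := fun i => Subtype.ext (neg_neg i.1) }

/-- The signs with `θ_{ij} = ε_i ε_j`. -/
def eps {N : ℕ} (c : Kind) (i : Idx N) : ℤ :=
  match c with
  | .orthogonal => 1
  | .symplectic => i.1.sign

/-- The double sign as an integer. -/
def Kind.sgn : Kind → ℤ
  | .orthogonal => 1
  | .symplectic => -1

theorem θ_eq {N : ℕ} (c : Kind) (i j : Idx N) : θ c i j = eps c i * eps c j := by
  cases c <;> simp [θ, eps]

theorem eps_neg {N : ℕ} (c : Kind) (i : Idx N) : eps c (-i) = c.sgn * eps c i := by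
  cases c
  · rfl
  · change (-i.1).sign = -1 * i.1.sign
    simp

theorem Kind.sgn_mul_self (c : Kind) : c.sgn * c.sgn = 1 := by cases c <;> rfl

theorem eps_mul_self {N : ℕ} (c : Kind) (hc : c = .symplectic → Even N) (i : Idx N) :
    eps c i * eps c i = 1 := by
  cases c
  · rfl
  · have h := i.2
    simp only [idxSet, Finset.mem_filter] at h
    have h0 := h.2 (hc rfl)
    change i.1.sign * i.1.sign = 1
    rcases lt_or_gt_of_ne h0 with h1 | h1
    · rw [Int.sign_eq_neg_one_of_neg h1]; rfl
    · rw [Int.sign_eq_one_of_pos h1]; rfl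

section TwoCopies

variable {N : ℕ} {B : Type*} [Ring B]

/-- `M ⊗ 1`. -/
def fstCopy (M : Matrix (Idx N) (Idx N) B) : Matrix (Idx N × Idx N) (Idx N × Idx N) B :=
  Matrix.of fun x y => if x.2 = y.2 then M x.1 y.1 else 0

/-- `1 ⊗ M`. -/
def sndCopy (M : Matrix (Idx N) (Idx N) B) : Matrix (Idx N × Idx N) (Idx N × Idx N) B :=
  Matrix.of fun x y => if x.1 = y.1 then M x.2 y.2 else 0

/-- The permutation operator on two copies. -/
def flipMat (N : ℕ) (B : Type*) [Ring B] : Matrix (Idx N × Idx N) (Idx N × Idx N) B :=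
  Matrix.of fun x y => if x.swap = y then 1 else 0

/-- The operator `Q` over a general ring. -/
def qMat (c : Kind) (N : ℕ) (B : Type*) [Ring B] :
    Matrix (Idx N × Idx N) (Idx N × Idx N) B :=
  Matrix.of fun x y => if x.1 = -x.2 ∧ y.1 = -y.2 then (eps c x.2 * eps c y.2) • (1 : B) else 0

theorem fstCopy_mul_apply (M : Matrix (Idx N) (Idx N) B)
    (L : Matrix (Idx N × Idx N) (Idx N × Idx N) B) (i k : Idx N) (y : Idx N × Idx N) :
    (fstCopy M * L) (i, k) y = ∑ z, M i z * L (z, k) y := by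
  simp [Matrix.mul_apply, fstCopy, Fintype.sum_prod_type]

theorem sndCopy_mul_apply (M : Matrix (Idx N) (Idx N) B)
    (L : Matrix (Idx N × Idx N) (Idx N × Idx N) B) (i k : Idx N) (y : Idx N × Idx N) :
    (sndCopy M * L) (i, k) y = ∑ z, M k z * L (i, z) y := by
  simp [Matrix.mul_apply, sndCopy, Fintype.sum_prod_type]

theorem flipMat_mul_apply (L : Matrix (Idx N × Idx N) (Idx N × Idx N) B)
    (x y : Idx N × Idx N) : (flipMat N B * L) x y = L x.swap y := by
  simp [Matrix.mul_apply, flipMat]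

theorem mul_flipMat_apply (L : Matrix (Idx N × Idx N) (Idx N × Idx N) B)
    (x y : Idx N × Idx N) : (L * flipMat N B) x y = L x y.swap := by
  have : ∀ z : Idx N × Idx N, (z.swap = y) = (z = y.swap) := fun z =>
    propext ⟨fun h => by rw [← h]; rfl, fun h => by rw [h]; rfl⟩
  simp [Matrix.mul_apply, flipMat, this]

theorem fstCopy_mul_sndCopy_apply (M M' : Matrix (Idx N) (Idx N) B) (i k j l : Idx N) :
    (fstCopy M * sndCopy M') (i, k) (j, l) = M i j * M' k l := by
  simp [fstCopy_mul_apply, sndCopy]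

theorem sndCopy_mul_fstCopy_apply (M M' : Matrix (Idx N) (Idx N) B) (i k j l : Idx N) :
    (sndCopy M' * fstCopy M) (i, k) (j, l) = M' k l * M i j := by
  simp [sndCopy_mul_apply, fstCopy]

theorem qMat_mul_apply (c : Kind) (L : Matrix (Idx N × Idx N) (Idx N × Idx N) B)
    (i k : Idx N) (y : Idx N × Idx N) : (qMat c N B * L) (i, k) y
      = if i = -k then ∑ n, (eps c k * eps c n) • L (-n, n) y else 0 := by
  rw [Matrix.mul_apply, Fintype.sum_prod_type, sum_comm]
  split_ifs with h
  · refine sum_congr rfl fun n _ => ?_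
    rw [sum_eq_single (-n)]
    · simp [qMat, h]
    · intro z _ hz; simp [qMat, hz]
    · simp
  · simp [qMat, h]

/-- The source of the `θ_{k,-j}` terms of the quaternary relation: `Q` only connects pairs of
opposite indices, which collapses both summations. -/
theorem fstCopy_mul_qMat_mul_sndCopy_apply (c : Kind) (M M' : Matrix (Idx N) (Idx N) B)
    (i k j l : Idx N) : (fstCopy M * (qMat c N B * sndCopy M')) (i, k) (j, l)
      = (eps c k * eps c (-j)) • (M i (-k) * M' (-j) l) := by
  simp only [fstCopy_mul_apply, qMat_mul_apply, mul_ite, mul_zero, sum_ite_eq', mem_univ, if_true]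
  rw [sum_eq_single (-j)]
  · simp only [sndCopy, Matrix.of_apply, neg_neg, if_true, mul_smul_comm]
  · intro n _ hn
    simp only [sndCopy, Matrix.of_apply]
    rw [if_neg fun h => hn (by rw [← h, neg_neg]), smul_zero]
  · simp

theorem sndCopy_mul_qMat_mul_fstCopy_apply (c : Kind) (M M' : Matrix (Idx N) (Idx N) B)
    (i k j l : Idx N) : (sndCopy M' * (qMat c N B * fstCopy M)) (i, k) (j, l)
      = (eps c (-i) * eps c l) • (M' k (-i) * M (-l) j) := by
  simp only [sndCopy_mul_apply, qMat_mul_apply, mul_ite, mul_zero]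
  rw [sum_eq_single (-i)]
  · rw [if_pos (neg_neg i).symm, sum_eq_single l]
    · simp only [fstCopy, Matrix.of_apply, if_true, mul_smul_comm]
    · intro n _ hn
      simp only [fstCopy, Matrix.of_apply]
      rw [if_neg hn, smul_zero]
    · simp
  · intro z _ hz
    rw [if_neg fun h => hz (by rw [h, neg_neg])]
  · simp

end TwoCopies

section Copies

variable {N m : ℕ} {B : Type*} [Ring B]

theorem sum_eq_sum_update {a b : Fin m} (hab : a ≠ b) (x : Fin m → Idx N)
    (f : (Fin m → Idx N) → B) (hf : ∀ z, (¬ ∀ d, d ≠ a → d ≠ b → x d = z d) → f z = 0) :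
    ∑ z, f z = ∑ u : Idx N × Idx N, f (Function.update (Function.update x a u.1) b u.2) := by
  symm
  refine Fintype.sum_of_injective _ ?_ _ _ ?_ fun _ => rfl
  · intro u v h
    have ha := congrFun h a
    have hb := congrFun h b
    simp only [Function.update_self, Function.update_of_ne hab] at ha hb
    exact Prod.ext ha hb
  · intro z hz
    apply hf
    intro h
    apply hz
    refine ⟨(z a, z b), funext fun d => ?_⟩
    by_cases hd : d = b
    · subst hd; simp
    · by_cases hd' : d = a
      · subst hd'; simp [hd]
      · simp [hd, hd', h d hd' hd]

theorem onCopies_mul {a b : Fin m} (hab : a ≠ b)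
    (C D : Matrix (Idx N × Idx N) (Idx N × Idx N) B) :
    onCopies a b (C * D) = onCopies a b C * onCopies a b D := by
  ext x y
  rw [Matrix.mul_apply, sum_eq_sum_update hab x]
  · simp only [onCopies, Matrix.of_apply, Matrix.mul_apply, Function.update_self,
      Function.update_of_ne hab]
    have h1 : ∀ u : Idx N × Idx N, ∀ d, d ≠ a → d ≠ b →
        Function.update (Function.update x a u.1) b u.2 d = x d := by
      intro u d h1 h2; simp [h1, h2]
    split_ifs with h
    · refine sum_congr rfl fun u _ => ?_
      rw [if_pos (fun d h2 h3 => (h1 u d h2 h3).symm), if_pos]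
      intro d h2 h3; rw [h1 u d h2 h3, h d h2 h3]
    · symm
      refine sum_eq_zero fun u _ => ?_
      rw [mul_ite, if_neg, mul_zero]
      intro h4; apply h; intro d h2 h3; rw [← h1 u d h2 h3, h4 d h2 h3]
  · intro z hz
    simp only [onCopies, Matrix.of_apply]
    rw [if_neg hz, zero_mul]

theorem onCopies_one (a b : Fin m) :
    onCopies a b (1 : Matrix (Idx N × Idx N) (Idx N × Idx N) B) = 1 := by
  ext x y
  simp only [onCopies, Matrix.of_apply, Matrix.one_apply, Prod.mk.injEq]
  by_cases h : x = y
  · simp [h]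
  · rw [if_neg h]
    split_ifs with h1 h2
    · exfalso; apply h; funext d
      by_cases hd : d = a
      · rw [hd, h2.1]
      · by_cases hd' : d = b
        · rw [hd', h2.2]
        · exact h1 d hd hd'
    · rfl
    · rfl

theorem onCopies_add (a b : Fin m) (C D : Matrix (Idx N × Idx N) (Idx N × Idx N) B) :
    onCopies a b (C + D) = onCopies a b C + onCopies a b D := by
  ext x y
  simp only [onCopies, Matrix.of_apply, Matrix.add_apply]
  split_ifs <;> simp

theorem onCopies_sub (a b : Fin m) (C D : Matrix (Idx N × Idx N) (Idx N × Idx N) B) :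
    onCopies a b (C - D) = onCopies a b C - onCopies a b D := by
  ext x y
  simp only [onCopies, Matrix.of_apply, Matrix.sub_apply]
  split_ifs <;> simp

theorem onCopies_smul {K : Type*} [CommRing K] [Algebra K B] (a b : Fin m) (z : K)
    (C : Matrix (Idx N × Idx N) (Idx N × Idx N) B) :
    onCopies a b (z • C) = z • onCopies a b C := by
  ext x y
  simp only [onCopies, Matrix.of_apply, Matrix.smul_apply]
  split_ifs <;> simp

theorem onCopy_eq_fstCopy {a b : Fin m} (hab : a ≠ b) (M : Matrix (Idx N) (Idx N) B) :
    onCopy a M = onCopies a b (fstCopy M) := by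
  ext x y
  simp only [onCopy, onCopies, fstCopy, Matrix.of_apply]
  by_cases h : x b = y b
  · simp only [h, if_true]
    congr 1
    refine propext ⟨fun H d h1 _ => H d h1, fun H d h1 => ?_⟩
    by_cases hd : d = b
    · rw [hd, h]
    · exact H d h1 hd
  · rw [if_neg fun H => h (H b hab.symm)]
    simp [h]

theorem onCopy_eq_sndCopy {a b : Fin m} (hab : a ≠ b) (M : Matrix (Idx N) (Idx N) B) :
    onCopy b M = onCopies a b (sndCopy M) := by
  ext x y
  simp only [onCopy, onCopies, sndCopy, Matrix.of_apply]
  by_cases h : x a = y a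
  · simp only [h, if_true]
    congr 1
    refine propext ⟨fun H d _ h1 => H d h1, fun H d h1 => ?_⟩
    by_cases hd : d = a
    · rw [hd, h]
    · exact H d hd h1
  · rw [if_neg fun H => h (H a hab)]
    simp [h]

theorem onCopy_mul (a : Fin m) (M M' : Matrix (Idx N) (Idx N) B) :
    onCopy a (M * M') = onCopy a M * onCopy a M' := by
  ext x y
  rw [Matrix.mul_apply]
  have hz : ∀ z, z ∉ Set.range (Function.update x a) →
      onCopy a M x z * onCopy a M' z y = 0 := by
    intro z hz
    simp only [onCopy, Matrix.of_apply]
    rw [if_neg, zero_mul]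
    intro h
    refine hz ⟨z a, funext fun d => ?_⟩
    by_cases hd : d = a
    · subst hd; simp
    · simp [hd, h d hd]
  rw [← Fintype.sum_of_injective (Function.update x a) (Function.update_injective x a)
    (fun i => onCopy a M x (Function.update x a i) * onCopy a M' (Function.update x a i) y) _ hz
    fun _ => rfl]
  have h1 : ∀ i d, d ≠ a → Function.update x a i d = x d := by
    intro u d h1; simp [h1]
  simp only [onCopy, Matrix.of_apply, Matrix.mul_apply, Function.update_self]
  split_ifs with h
  · refine sum_congr rfl fun u _ => ?_
    rw [if_pos (fun d h2 => (h1 u d h2).symm), if_pos]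
    intro d h2; rw [h1 u d h2, h d h2]
  · symm
    refine sum_eq_zero fun u _ => ?_
    rw [mul_ite, if_neg, mul_zero]
    intro h4; apply h; intro d h2; rw [← h1 u d h2, h4 d h2]

/-- The operator permuting the tensor factors. -/
def permMat (N : ℕ) {m : ℕ} (B : Type*) [Ring B] (σ : Equiv.Perm (Fin m)) :
    Matrix (Fin m → Idx N) (Fin m → Idx N) B :=
  Matrix.of fun x y => if x = y ∘ σ then 1 else 0

theorem permMat_mul_apply (σ : Equiv.Perm (Fin m))
    (M : Matrix (Fin m → Idx N) (Fin m → Idx N) B) (x y : Fin m → Idx N) :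
    (permMat N B σ * M) x y = M (x ∘ σ.symm) y := by
  have : ∀ z : Fin m → Idx N, (x = z ∘ σ) = (x ∘ σ.symm = z) := fun z =>
    propext ⟨fun h => by rw [h]; ext; simp, fun h => by rw [← h]; ext; simp⟩
  simp [Matrix.mul_apply, permMat, this]

theorem mul_permMat_apply (σ : Equiv.Perm (Fin m))
    (M : Matrix (Fin m → Idx N) (Fin m → Idx N) B) (x y : Fin m → Idx N) :
    (M * permMat N B σ) x y = M x (y ∘ σ) := by
  simp [Matrix.mul_apply, permMat]

theorem permMat_mul_onCopies (σ : Equiv.Perm (Fin m)) (a b : Fin m)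
    (C : Matrix (Idx N × Idx N) (Idx N × Idx N) B) :
    permMat N B σ * onCopies (σ a) (σ b) C = onCopies a b C * permMat N B σ := by
  ext x y
  rw [permMat_mul_apply, mul_permMat_apply]
  simp only [onCopies, Matrix.of_apply, Function.comp_apply, Equiv.symm_apply_apply]
  congr 1
  refine propext ⟨fun h d h1 h2 => ?_, fun h d h1 h2 => ?_⟩
  · simpa using h (σ d) (by simpa using h1) (by simpa using h2)
  · simpa using h (σ.symm d) (fun h => h1 (by simp [← h])) (fun h => h2 (by simp [← h]))

theorem permMat_mul_onCopy (σ : Equiv.Perm (Fin m)) (a : Fin m)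
    (M : Matrix (Idx N) (Idx N) B) :
    permMat N B σ * onCopy (σ a) M = onCopy a M * permMat N B σ := by
  ext x y
  rw [permMat_mul_apply, mul_permMat_apply]
  simp only [onCopy, Matrix.of_apply, Function.comp_apply, Equiv.symm_apply_apply]
  congr 1
  refine propext ⟨fun h d h1 => ?_, fun h d h1 => ?_⟩
  · simpa using h (σ d) (by simpa using h1)
  · simpa using h (σ.symm d) (fun h => h1 (by simp [← h]))

theorem permMat_swap {a b : Fin m} (hab : a ≠ b) :
    permMat N B (Equiv.swap a b) = onCopies a b (flipMat N B) := by
  ext x y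
  simp only [permMat, onCopies, flipMat, Matrix.of_apply, Prod.swap_prod_mk, Prod.mk.injEq]
  rw [← ite_and]
  congr 1
  refine propext ⟨fun h => ?_, fun h => funext fun d => ?_⟩
  · subst h
    refine ⟨fun d h1 h2 => ?_, ?_, ?_⟩ <;> simp [Equiv.swap_apply_of_ne_of_ne, *]
  · by_cases hd : d = a
    · subst hd; simp [h.2.2]
    · by_cases hd' : d = b
      · subst hd'; simp [h.2.1]
      · simp [Equiv.swap_apply_of_ne_of_ne hd hd', h.1 d hd hd']

/-- `M` acts only on the copies in `s`. -/
def ActsOn (s : Set (Fin m)) (M : Matrix (Fin m → Idx N) (Fin m → Idx N) B) : Prop :=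
  (∀ x y, (∃ d, d ∉ s ∧ x d ≠ y d) → M x y = 0) ∧
  ∀ x y x' y', (∀ d ∈ s, x d = x' d ∧ y d = y' d) → (∀ d ∉ s, x d = y d ∧ x' d = y' d) →
    M x y = M x' y'

/-- `M` changes only coordinates in `s` and `L` changes none of them, so the one intermediate index
that can contribute agrees with `y` on `s` and with `x` elsewhere. -/
theorem ActsOn.mul_apply [DecidableEq (Fin m)] {s t : Set (Fin m)}
    {M L : Matrix (Fin m → Idx N) (Fin m → Idx N) B}
    (hM : ActsOn s M) (hL : ActsOn t L) (hst : Disjoint s t) (x y : Fin m → Idx N)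
    [DecidablePred (· ∈ s)] :
    (M * L) x y = M x (s.piecewise y x) * L (s.piecewise y x) y := by
  rw [Matrix.mul_apply]
  refine sum_eq_single _ (fun z _ hz => ?_) (by simp)
  by_contra hne
  apply hz
  funext d
  have h1 : M x z ≠ 0 := fun h => hne (by rw [h, zero_mul])
  have h2 : L z y ≠ 0 := fun h => hne (by rw [h, mul_zero])
  by_cases hd : d ∈ s
  · rw [Set.piecewise_eq_of_mem _ _ _ hd]
    by_contra h
    exact h2 (hL.1 _ _ ⟨d, Set.disjoint_left.1 hst hd, h⟩)
  · rw [Set.piecewise_eq_of_notMem _ _ _ hd]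
    by_contra h
    exact h1 (hM.1 _ _ ⟨d, hd, Ne.symm h⟩)

theorem ActsOn.commute {s t : Set (Fin m)} {M L : Matrix (Fin m → Idx N) (Fin m → Idx N) B}
    (hM : ActsOn s M) (hL : ActsOn t L) (hst : Disjoint s t)
    (h : ∀ x y x' y', Commute (M x y) (L x' y')) : Commute M L := by
  classical
  ext x y
  rw [hM.mul_apply hL hst, hL.mul_apply hM hst.symm, (h _ _ _ _).eq]
  by_cases hxy : ∀ d, d ∉ s → d ∉ t → x d = y d
  · have e1 : M x (s.piecewise y x) = M (t.piecewise y x) y := by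
      apply hM.2
      · intro d hd
        simp [hd, Set.disjoint_left.1 hst hd]
      · intro d hd
        by_cases hd' : d ∈ t
        · simp [hd, hd']
        · simp [hd, hd', hxy d hd hd']
    have e2 : L (s.piecewise y x) y = L x (t.piecewise y x) := by
      apply hL.2
      · intro d hd
        simp [hd, Set.disjoint_right.1 hst hd]
      · intro d hd
        by_cases hd' : d ∈ s
        · simp [hd, hd']
        · simp [hd, hd', hxy d hd' hd]
    rw [e1, e2]
  · push Not at hxy
    obtain ⟨d, h1, h2, h3⟩ := hxy
    rw [hL.1 (s.piecewise y x) y ⟨d, h2, by simpa [h1] using h3⟩,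
      hM.1 (t.piecewise y x) y ⟨d, h1, by simpa [h2] using h3⟩, zero_mul, mul_zero]

theorem actsOn_onCopy (a : Fin m) (M : Matrix (Idx N) (Idx N) B) :
    ActsOn {a} (onCopy a M) := by
  constructor
  · rintro x y ⟨d, h1, h2⟩
    simp only [onCopy, Matrix.of_apply]
    exact if_neg fun h => h2 (h d h1)
  · intro x y x' y' h1 h2
    simp only [onCopy, Matrix.of_apply]
    have e1 : ∀ d, d ≠ a → x d = y d := fun d hd => (h2 d hd).1
    have e2 : ∀ d, d ≠ a → x' d = y' d := fun d hd => (h2 d hd).2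
    rw [if_pos e1, if_pos e2, (h1 a rfl).1, (h1 a rfl).2]

theorem actsOn_onCopies (a b : Fin m) (C : Matrix (Idx N × Idx N) (Idx N × Idx N) B) :
    ActsOn {a, b} (onCopies a b C) := by
  constructor
  · rintro x y ⟨d, h1, h2⟩
    simp only [Set.mem_insert_iff, Set.mem_singleton_iff, not_or] at h1
    simp only [onCopies, Matrix.of_apply]
    exact if_neg fun h => h2 (h d h1.1 h1.2)
  · intro x y x' y' h1 h2
    simp only [Set.mem_insert_iff, Set.mem_singleton_iff, not_or] at h2
    have ha := h1 a (by simp)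
    have hb := h1 b (by simp)
    simp only [onCopies, Matrix.of_apply]
    have e1 : ∀ d, d ≠ a → d ≠ b → x d = y d := fun d hd hd' => (h2 d ⟨hd, hd'⟩).1
    have e2 : ∀ d, d ≠ a → d ≠ b → x' d = y' d := fun d hd hd' => (h2 d ⟨hd, hd'⟩).2
    rw [if_pos e1, if_pos e2,
      ha.1, ha.2, hb.1, hb.2]

end Copies

end TwYang

end

/-! ### The Yang–Baxter equation and the relations in matrix form. -/

noncomputable section

namespace TwYang

open Finset Matrix

/-- Expand both sides. The cubic terms agree since `P` exchanges `Q₁` and `Q₂`, and the quadratic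
terms differ by `ρ₁ρ₂ - α(ρ₁ - ρ₂)` times `Q₁P - Q₂P`. -/
theorem yang_baxter_of_relations {K R : Type*} [CommRing K] [Ring R] [Algebra K R] {P Q₁ Q₂ : R}
    (h1 : P * Q₁ = Q₂ * P) (h2 : P * Q₂ = Q₁ * P) (h12 : Q₁ * Q₂ = Q₁ * P)
    (h21 : Q₂ * Q₁ = Q₂ * P) {α ρ₁ ρ₂ : K} (h : ρ₁ * ρ₂ = α * (ρ₁ - ρ₂)) :
    (1 - α • P) * ((1 - ρ₁ • Q₁) * (1 - ρ₂ • Q₂))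
      = (1 - ρ₂ • Q₂) * (1 - ρ₁ • Q₁) * (1 - α • P) := by
  have e1 : P * (Q₁ * Q₂) = Q₂ * Q₁ * P := by rw [← mul_assoc, h1, mul_assoc, h2, mul_assoc]
  have e2 : (1 - α • P) * ((1 - ρ₁ • Q₁) * (1 - ρ₂ • Q₂))
      = 1 - ρ₁ • Q₁ - ρ₂ • Q₂ + (ρ₁ * ρ₂) • (Q₁ * Q₂) - α • P + (α * ρ₁) • (P * Q₁)
        + (α * ρ₂) • (P * Q₂) - (α * (ρ₁ * ρ₂)) • (P * (Q₁ * Q₂)) := by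
    simp only [sub_mul, mul_sub, one_mul, mul_one, smul_mul_assoc, mul_smul_comm, smul_smul,
      smul_sub]
    module
  have e3 : (1 - ρ₂ • Q₂) * (1 - ρ₁ • Q₁) * (1 - α • P)
      = 1 - ρ₁ • Q₁ - ρ₂ • Q₂ + (ρ₁ * ρ₂) • (Q₂ * Q₁) - α • P + (α * ρ₁) • (Q₁ * P)
        + (α * ρ₂) • (Q₂ * P) - (α * (ρ₁ * ρ₂)) • (Q₂ * Q₁ * P) := by
    simp only [sub_mul, mul_sub, one_mul, mul_one, smul_mul_assoc, mul_smul_comm, smul_smul,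
      smul_sub]
    module
  rw [e2, e3, e1, h1, h2, h12, h21, h]
  module

section TwoCopies

variable {N : ℕ} {K B : Type*} [CommRing K] [Ring B] [Algebra K B]

theorem rtt_two {T T' : Matrix (Idx N) (Idx N) B} {α : K} (h : RTT T T' α) :
    (1 - α • flipMat N B) * (fstCopy T * sndCopy T')
      = sndCopy T' * fstCopy T * (1 - α • flipMat N B) := by
  simp only [sub_mul, mul_sub, one_mul, mul_one, smul_mul_assoc, mul_smul_comm]
  ext ⟨i, k⟩ ⟨j, l⟩
  simp only [Matrix.sub_apply, Matrix.smul_apply, flipMat_mul_apply, mul_flipMat_apply,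
    Prod.swap_prod_mk, fstCopy_mul_sndCopy_apply, sndCopy_mul_fstCopy_apply]
  have := h i j k l
  rw [smul_sub] at this
  rw [sub_eq_sub_iff_sub_eq_sub, this]

theorem twT_apply (c : Kind) (M : Matrix (Idx N) (Idx N) B) (i j : Idx N) :
    twT c M i j = (eps c (-j) * eps c (-i)) • M (-j) (-i) := by
  rw [twT, Matrix.of_apply, θ_eq]

/-- The transpose of the `RTT` relation in the first copy only, which turns `P` into `Q`; the extra
signs occur squared. -/
theorem rtt_two_twT (c : Kind) (hc : c = .symplectic → Even N)
    {T T' : Matrix (Idx N) (Idx N) B} {α : K} (h : RTT T T' α) :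
    fstCopy (twT c T) * ((1 - α • qMat c N B) * sndCopy T')
      = sndCopy T' * ((1 - α • qMat c N B) * fstCopy (twT c T)) := by
  simp only [sub_mul, mul_sub, one_mul, smul_mul_assoc, mul_smul_comm]
  ext ⟨i, k⟩ ⟨j, l⟩
  simp only [Matrix.sub_apply, Matrix.smul_apply, fstCopy_mul_sndCopy_apply,
    sndCopy_mul_fstCopy_apply, fstCopy_mul_qMat_mul_sndCopy_apply,
    sndCopy_mul_qMat_mul_fstCopy_apply, twT_apply, neg_neg]
  have h1 := h (-j) (-i) k l
  have e1 : eps c k * eps c (-j) * (eps c k * eps c (-i)) = eps c (-j) * eps c (-i) := by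
    linear_combination (eps c (-j) * eps c (-i)) * eps_mul_self c hc k
  have e2 : eps c (-i) * eps c l * (eps c (-j) * eps c l) = eps c (-j) * eps c (-i) := by
    linear_combination (eps c (-j) * eps c (-i)) * eps_mul_self c hc l
  simp only [smul_mul_assoc, mul_smul_comm, smul_smul, e1, e2]
  rw [sub_eq_sub_iff_sub_eq_sub, ← smul_sub, h1, ← smul_sub, ← smul_sub]
  exact smul_comm _ _ _

/-- Transposing both factors sends `(i, j, k, l)` to `(-l, -k, -j, -i)`, so the two matrices
exchange roles and `α` stays. -/
theorem rtt_twT (c : Kind) {T T' : Matrix (Idx N) (Idx N) B} {α : K} (h : RTT T T' α) :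
    RTT (twT c T') (twT c T) α := by
  intro i j k l
  have h1 := h (-l) (-k) (-j) (-i)
  have e : eps c (-j) * eps c (-k) * (eps c (-l) * eps c (-i))
      = eps c (-j) * eps c (-i) * (eps c (-l) * eps c (-k)) := by ring
  simp only [twT_apply, smul_mul_assoc, mul_smul_comm, smul_smul]
  rw [mul_comm (eps c (-l) * eps c (-k)), mul_comm (eps c (-l) * eps c (-i)), e, ← smul_sub,
    ← smul_sub, smul_comm, ← neg_sub, h1, ← smul_neg, neg_sub]

/-- An entrywise comparison. One direction feeds the exchange argument; the other verifies the
relation for `T(u) Tᵗ(-u)` and for the identity matrix. -/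
theorem reflection_two_iff (c : Kind) {S S' : Matrix (Idx N) (Idx N) B} {α β : K} :
    (1 - α • flipMat N B) * (fstCopy S * ((1 + β • qMat c N B) * sndCopy S'))
      = sndCopy S' * ((1 + β • qMat c N B) * fstCopy S) * (1 - α • flipMat N B)
    ↔ Reflection c S S' α β := by
  have e1 : (1 - α • flipMat N B) * (fstCopy S * ((1 + β • qMat c N B) * sndCopy S'))
      = fstCopy S * sndCopy S' - α • (flipMat N B * (fstCopy S * sndCopy S'))
        + β • (fstCopy S * (qMat c N B * sndCopy S'))
        - (α * β) • (flipMat N B * (fstCopy S * (qMat c N B * sndCopy S'))) := by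
    simp only [sub_mul, add_mul, mul_add, one_mul, smul_mul_assoc, mul_smul_comm]
    module
  have e2 : sndCopy S' * ((1 + β • qMat c N B) * fstCopy S) * (1 - α • flipMat N B)
      = sndCopy S' * fstCopy S - α • (sndCopy S' * fstCopy S * flipMat N B)
        + β • (sndCopy S' * (qMat c N B * fstCopy S))
        - (α * β) • (sndCopy S' * (qMat c N B * fstCopy S) * flipMat N B) := by
    simp only [mul_sub, add_mul, mul_add, one_mul, mul_one, smul_mul_assoc, mul_smul_comm,
      smul_smul, smul_add]
    module
  rw [e1, e2, ← Matrix.ext_iff, Prod.forall]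
  simp only [Prod.forall, Matrix.sub_apply, Matrix.add_apply, Matrix.smul_apply,
    flipMat_mul_apply, mul_flipMat_apply,
    Prod.swap_prod_mk, fstCopy_mul_sndCopy_apply, sndCopy_mul_fstCopy_apply,
    fstCopy_mul_qMat_mul_sndCopy_apply, sndCopy_mul_qMat_mul_fstCopy_apply, Reflection, θ_eq]
  have key : ∀ i j k l, ((S i j * S' k l - α • (S k j * S' i l)
      + β • (eps c k * eps c (-j)) • (S i (-k) * S' (-j) l)
      - (α * β) • (eps c i * eps c (-j)) • (S k (-i) * S' (-j) l)
      = S' k l * S i j - α • (S' k j * S i l)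
      + β • (eps c (-i) * eps c l) • (S' k (-i) * S (-l) j)
      - (α * β) • (eps c (-i) * eps c j) • (S' k (-i) * S (-j) l)) ↔
      (S i j * S' k l - S' k l * S i j = α • (S k j * S' i l - S' k j * S i l)
        - β • ((eps c k * eps c (-j)) • (S i (-k) * S' (-j) l)
          - (eps c i * eps c (-l)) • (S' k (-i) * S (-l) j))
        + (α * β) • (eps c i * eps c (-j)) • (S k (-i) * S' (-j) l - S' k (-i) * S (-j) l))) := by
    intro i j k l
    have f : ∀ i l : Idx N, eps c (-i) * eps c l = eps c i * eps c (-l) := by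
      intro i l; rw [eps_neg, eps_neg]; ring
    rw [f i l, f i j, ← sub_eq_zero, ← sub_eq_zero (a := S i j * S' k l - S' k l * S i j)]
    apply Eq.congr _ rfl
    module
  constructor
  · intro h i j k l
    exact (key i j k l).1 (h i k j l)
  · intro h i k j l
    exact (key i j k l).2 (h i j k l)

theorem qMat_swap (c : Kind) (x y : Idx N × Idx N) :
    qMat c N B x.swap y.swap = qMat c N B x y := by
  have hs : ∀ x : Idx N × Idx N, (x.2 = -x.1) = (x.1 = -x.2) := fun x =>
    propext ⟨fun h => by rw [h, neg_neg], fun h => by rw [h, neg_neg]⟩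
  simp only [qMat, Matrix.of_apply, Prod.fst_swap, Prod.snd_swap, hs]
  split_ifs with h
  · rw [h.1, h.2, eps_neg, eps_neg]
    congr 1
    linear_combination (eps c x.2 * eps c y.2) * c.sgn_mul_self
  · rfl

/-- The flip replaces the sign of `x.2` by that of `x.1 = -x.2`, which costs `c.sgn`. This sign is
what separates the two values of `γ`. -/
theorem flipMat_mul_qMat (c : Kind) : flipMat N B * qMat c N B = c.sgn • qMat c N B := by
  ext x y
  have hs : ∀ x : Idx N × Idx N, (x.2 = -x.1) = (x.1 = -x.2) := fun x =>
    propext ⟨fun h => by rw [h, neg_neg], fun h => by rw [h, neg_neg]⟩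
  rw [flipMat_mul_apply, Matrix.smul_apply]
  simp only [qMat, Matrix.of_apply, Prod.fst_swap, Prod.snd_swap, hs]
  split_ifs with h
  · rw [h.1, eps_neg, smul_smul, mul_assoc]
  · simp

theorem qMat_mul_flipMat (c : Kind) : qMat c N B * flipMat N B = c.sgn • qMat c N B := by
  ext x y
  have h := congrFun (congrFun (flipMat_mul_qMat (N := N) (B := B) c) x) y
  rw [flipMat_mul_apply] at h
  rw [mul_flipMat_apply, ← qMat_swap, Prod.swap_swap, h]

end TwoCopies

section Copies

variable {N m : ℕ} {K B : Type*} [CommRing K] [Ring B] [Algebra K B]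

theorem onCopies_qMat_comm (c : Kind) (a b : Fin m) :
    onCopies b a (qMat c N B) = onCopies a b (qMat c N B) := by
  ext x y
  simp only [onCopies, Matrix.of_apply]
  rw [← qMat_swap]
  simp only [Prod.swap_prod_mk]
  congr 1
  exact propext ⟨fun h d h1 h2 => h d h2 h1, fun h d h1 h2 => h d h2 h1⟩

theorem permMat_swap_mul_onCopies_qMat (c : Kind) {a b r : Fin m} (har : a ≠ r) (hbr : b ≠ r) :
    permMat N B (Equiv.swap a b) * onCopies a r (qMat c N B)
      = onCopies b r (qMat c N B) * permMat N B (Equiv.swap a b) := by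
  have := permMat_mul_onCopies (B := B) (Equiv.swap a b) b r (qMat c N B)
  rwa [Equiv.swap_apply_right, Equiv.swap_apply_of_ne_of_ne har.symm hbr.symm] at this

/-- A Brauer algebra relation. Only the intermediate index with `y a` in copy `a` and `-y a` in copy
`r` survives, and its sign occurs squared. -/
theorem onCopies_qMat_mul_onCopies_qMat (c : Kind) (hc : c = .symplectic → Even N)
    {a b r : Fin m} (hab : a ≠ b) (har : a ≠ r) (hbr : b ≠ r) :
    onCopies a r (qMat c N B) * onCopies b r (qMat c N B)
      = onCopies a r (qMat c N B) * permMat N B (Equiv.swap a b) := by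
  ext x y
  rw [mul_permMat_apply, Matrix.mul_apply,
    sum_eq_single (Function.update (Function.update x a (y a)) r (-y a))]
  · simp only [onCopies, Matrix.of_apply, qMat, Function.comp_apply, Equiv.swap_apply_left,
      Equiv.swap_apply_of_ne_of_ne har.symm hbr.symm, Function.update_self,
      Function.update_of_ne har, Function.update_of_ne hbr, Function.update_of_ne hab.symm]
    rw [if_pos (by intro d h1 h2; simp [h1, h2])]
    have e1 : (∀ d, d ≠ b → d ≠ r → Function.update (Function.update x a (y a)) r (-y a) d = y d)
        ↔ ∀ d, d ≠ a → d ≠ b → d ≠ r → x d = y d := by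
      constructor
      · intro h d h1 h2 h3
        simpa [h1, h2, h3] using h d h2 h3
      · intro h d h1 h2
        by_cases h3 : d = a
        · subst h3; simp [h2]
        · simpa [h2, h3] using h d h3 h1 h2
    have e2 : (∀ d, d ≠ a → d ≠ r → x d = y (Equiv.swap a b d))
        ↔ (∀ d, d ≠ a → d ≠ b → d ≠ r → x d = y d) ∧ x b = y a := by
      constructor
      · intro h
        refine ⟨fun d h1 h2 h3 => ?_, ?_⟩
        · have := h d h1 h3
          rwa [Equiv.swap_apply_of_ne_of_ne h1 h2] at this
        · have := h b hab.symm hbr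
          rwa [Equiv.swap_apply_right] at this
      · intro h d h1 h2
        by_cases h3 : d = b
        · subst h3; rw [Equiv.swap_apply_right, h.2]
        · rw [Equiv.swap_apply_of_ne_of_ne h1 h3, h.1 d h1 h3 h2]
    simp only [e1, e2, neg_neg]
    by_cases g1 : ∀ d, d ≠ a → d ≠ b → d ≠ r → x d = y d
    · by_cases g2 : x b = y a
      · by_cases g3 : x a = -x r
        · by_cases g4 : y b = -y r
          · rw [if_pos ⟨g3, trivial⟩, if_pos g1, if_pos ⟨g2, g4⟩, if_pos ⟨g1, g2⟩, if_pos ⟨g3, g4⟩,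
              smul_mul_smul_comm, mul_one]
            congr 1
            linear_combination (eps c (x r) * eps c (y r)) * eps_mul_self c hc (-y a)
          · simp [g4]
        · simp [g3]
      · simp [g2]
    · simp [g1]
  · intro z _ hz
    by_contra hne
    apply hz
    simp only [onCopies, Matrix.of_apply, qMat] at hne
    have h1 := left_ne_zero_of_mul hne
    have h2 := right_ne_zero_of_mul hne
    rw [ne_eq, ite_eq_right_iff, Classical.not_imp, ite_eq_right_iff, Classical.not_imp] at h1 h2
    obtain ⟨h1, ⟨_, h3⟩, _⟩ := h1
    obtain ⟨h2, ⟨h4, _⟩, _⟩ := h2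
    have h5 := h2 a hab har
    funext d
    by_cases hd : d = r
    · subst hd
      rw [Function.update_self, ← h5, h3, neg_neg]
    · by_cases hd' : d = a
      · subst hd'; simp [hd, h5]
      · simp [hd, hd', h1 d hd' hd]
  · simp

theorem yang_baxter (c : Kind) (hc : c = .symplectic → Even N) {a b r : Fin m} (hab : a ≠ b)
    (har : a ≠ r) (hbr : b ≠ r) {α ρ₁ ρ₂ : K} (h : ρ₁ * ρ₂ = α * (ρ₁ - ρ₂)) :
    (1 - α • permMat N B (Equiv.swap a b))
        * ((1 - ρ₁ • onCopies a r (qMat c N B)) * (1 - ρ₂ • onCopies b r (qMat c N B)))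
      = (1 - ρ₂ • onCopies b r (qMat c N B)) * (1 - ρ₁ • onCopies a r (qMat c N B))
        * (1 - α • permMat N B (Equiv.swap a b)) := by
  apply yang_baxter_of_relations _ _ _ _ h
  · exact permMat_swap_mul_onCopies_qMat c har hbr
  · rw [Equiv.swap_comm]; exact permMat_swap_mul_onCopies_qMat c hbr har
  · exact onCopies_qMat_mul_onCopies_qMat c hc hab har hbr
  · rw [Equiv.swap_comm]; exact onCopies_qMat_mul_onCopies_qMat c hc hab.symm hbr har

theorem rtt_copies {a b : Fin m} (hab : a ≠ b) {T T' : Matrix (Idx N) (Idx N) B} {α : K}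
    (h : RTT T T' α) :
    (1 - α • permMat N B (Equiv.swap a b)) * (onCopy a T * onCopy b T')
      = onCopy b T' * onCopy a T * (1 - α • permMat N B (Equiv.swap a b)) := by
  rw [permMat_swap hab, ← onCopies_smul, ← onCopies_one a b, ← onCopies_sub,
    onCopy_eq_fstCopy hab, onCopy_eq_sndCopy hab]
  simp only [← onCopies_mul hab, rtt_two h]

theorem rtt_copies_twT (c : Kind) (hc : c = .symplectic → Even N) {a b : Fin m} (hab : a ≠ b)
    {T T' : Matrix (Idx N) (Idx N) B} {α : K} (h : RTT T T' α) :
    onCopy a (twT c T) * ((1 - α • onCopies a b (qMat c N B)) * onCopy b T')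
      = onCopy b T' * ((1 - α • onCopies a b (qMat c N B)) * onCopy a (twT c T)) := by
  rw [← onCopies_smul, ← onCopies_one a b, ← onCopies_sub,
    onCopy_eq_fstCopy hab, onCopy_eq_sndCopy hab]
  simp only [← onCopies_mul hab, rtt_two_twT c hc h]

theorem reflection_copies (c : Kind) {a b : Fin m} (hab : a ≠ b)
    {S S' : Matrix (Idx N) (Idx N) B} {α β : K} (h : Reflection c S S' α β) :
    (1 - α • permMat N B (Equiv.swap a b))
        * (onCopy a S * ((1 + β • onCopies a b (qMat c N B)) * onCopy b S'))
      = onCopy b S' * ((1 + β • onCopies a b (qMat c N B)) * onCopy a S)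
        * (1 - α • permMat N B (Equiv.swap a b)) := by
  rw [permMat_swap hab, ← onCopies_smul, ← onCopies_smul, ← onCopies_one a b, ← onCopies_sub,
    ← onCopies_add, onCopy_eq_fstCopy hab, onCopy_eq_sndCopy hab]
  simp only [← onCopies_mul hab, (reflection_two_iff c).2 h]

end Copies

end TwYang

end

/-! ### Antisymmetric tensors and an abstract determinant. -/

noncomputable section

namespace TwYang

open Finset Matrix

/-- The increasing enumeration of the index set. -/
def enum (N : ℕ) : Fin N ≃ Idx N where
  toFun i := ⟨(i : ℤ) - (N / 2 : ℕ) + if N % 2 = 0 ∧ N / 2 ≤ (i : ℕ) then 1 else 0, by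
    have := i.2
    simp only [idxSet, mem_filter, mem_Icc, Nat.even_iff]
    split_ifs <;> omega⟩
  invFun z := ⟨(z.1 + (N / 2 : ℕ) - if N % 2 = 0 ∧ 0 < z.1 then 1 else 0).toNat, by
    have h := z.2
    simp only [idxSet, mem_filter, mem_Icc, Nat.even_iff] at h
    split_ifs <;> omega⟩
  left_inv i := by
    have := i.2
    apply Fin.ext
    dsimp only
    split_ifs <;> omega
  right_inv z := by
    have h := z.2
    simp only [idxSet, mem_filter, mem_Icc, Nat.even_iff] at h
    apply Subtype.ext
    dsimp only
    split_ifs <;> omega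

theorem enum_rev (N : ℕ) (i : Fin N) : enum N i.rev = -enum N i := by
  have := i.2
  apply Subtype.ext
  change _ = -(enum N i).1
  simp only [enum, Equiv.coe_fn_mk, Fin.val_rev]
  split_ifs <;> omega

section Antisymmetrizer

variable {N m : ℕ} {B : Type*} [Ring B] [Algebra ℂ B]

theorem eq_zero_of_eq_neg {M : Type*} [AddCommGroup M] [Module ℂ M] {x : M} (h : x = -x) :
    x = 0 := by
  have : (2 : ℂ) • x = 0 := by rw [two_smul]; nth_rewrite 1 [h]; simp
  exact (smul_eq_zero.1 this).resolve_left two_ne_zero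

theorem permMat_one : permMat N B (1 : Equiv.Perm (Fin m)) = 1 := by
  ext x y; simp [permMat, Matrix.one_apply]

/-- `permMat` acts through precomposition and therefore reverses products. -/
theorem permMat_mul_permMat (σ τ : Equiv.Perm (Fin m)) :
    permMat N B σ * permMat N B τ = permMat N B (τ * σ) := by
  ext x y
  rw [mul_permMat_apply]
  simp only [permMat, Matrix.of_apply, Function.comp_assoc]
  rfl

theorem permMat_swap_mul_self (a b : Fin m) :
    permMat N B (Equiv.swap a b) * permMat N B (Equiv.swap a b) = 1 := by
  rw [permMat_mul_permMat, Equiv.swap_mul_self, permMat_one]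

theorem antisym_eq_sum :
    antisym N m B = ∑ σ : Equiv.Perm (Fin m), (Equiv.Perm.sign σ : ℤ) • permMat N B σ := by
  ext x y
  simp [antisym, Matrix.sum_apply, permMat]

theorem antisym_mul_permMat (σ : Equiv.Perm (Fin m)) :
    antisym N m B * permMat N B σ = (Equiv.Perm.sign σ : ℤ) • antisym N m B := by
  rw [antisym_eq_sum, sum_mul, smul_sum, ← Equiv.sum_comp (Equiv.mulLeft σ) (fun τ => _ • _)]
  refine sum_congr rfl fun τ _ => ?_
  simp only [Equiv.coe_mulLeft, smul_mul_assoc, permMat_mul_permMat, map_mul, smul_smul,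
    Units.val_mul, ← mul_assoc]
  rw [← Units.val_mul, Int.units_mul_self, Units.val_one, one_mul]

theorem permMat_mul_antisym (σ : Equiv.Perm (Fin m)) :
    permMat N B σ * antisym N m B = (Equiv.Perm.sign σ : ℤ) • antisym N m B := by
  rw [antisym_eq_sum, mul_sum, smul_sum, ← Equiv.sum_comp (Equiv.mulRight σ) (fun τ => _ • _)]
  refine sum_congr rfl fun τ _ => ?_
  simp only [Equiv.coe_mulRight, mul_smul_comm, permMat_mul_permMat, map_mul, smul_smul,
    Units.val_mul]
  rw [mul_left_comm, ← Units.val_mul, Int.units_mul_self, Units.val_one, mul_one]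

theorem antisym_mul_permMat_swap {a b : Fin m} (hab : a ≠ b) :
    antisym N m B * permMat N B (Equiv.swap a b) = -antisym N m B := by
  rw [antisym_mul_permMat, Equiv.Perm.sign_swap hab]; simp

theorem permMat_swap_mul_antisym {a b : Fin m} (hab : a ≠ b) :
    permMat N B (Equiv.swap a b) * antisym N m B = -antisym N m B := by
  rw [permMat_mul_antisym, Equiv.Perm.sign_swap hab]; simp

/-- Reduces antisymmetry to neighbouring copies, the only place where `R_{ab}` equals `1 - P_{ab}`.
-/
theorem closure_adjacent_swaps (m : ℕ) :
    Submonoid.closure {σ : Equiv.Perm (Fin m) | ∃ a b : Fin m, (b : ℕ) = a + 1 ∧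
      σ = Equiv.swap a b} = ⊤ := by
  cases m with
  | zero => exact Subsingleton.elim _ _
  | succ n =>
    rw [eq_top_iff, ← Equiv.Perm.mclosure_swap_castSucc_succ n]
    apply Submonoid.closure_mono
    rintro _ ⟨i, rfl⟩
    exact ⟨i.castSucc, i.succ, by simp, rfl⟩

theorem mul_permMat_of_adjacent {X : Matrix (Fin m → Idx N) (Fin m → Idx N) B}
    (h : ∀ a b : Fin m, (b : ℕ) = a + 1 → X * permMat N B (Equiv.swap a b) = -X)
    (σ : Equiv.Perm (Fin m)) : X * permMat N B σ = (Equiv.Perm.sign σ : ℤ) • X := by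
  have hσ : σ ∈ Submonoid.closure {σ : Equiv.Perm (Fin m) | ∃ a b : Fin m, (b : ℕ) = a + 1 ∧
      σ = Equiv.swap a b} := by rw [closure_adjacent_swaps]; trivial
  induction hσ using Submonoid.closure_induction with
  | mem σ hσ =>
    obtain ⟨a, b, hab, rfl⟩ := hσ
    rw [h a b hab, Equiv.Perm.sign_swap (by rintro rfl; omega)]
    simp
  | one => simp [permMat_one]
  | mul σ τ _ _ h1 h2 =>
    rw [← permMat_mul_permMat, ← mul_assoc, h2, smul_mul_assoc, h1, smul_smul, map_mul,
      Units.val_mul, mul_comm]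

theorem permMat_mul_of_adjacent {X : Matrix (Fin m → Idx N) (Fin m → Idx N) B}
    (h : ∀ a b : Fin m, (b : ℕ) = a + 1 → permMat N B (Equiv.swap a b) * X = -X)
    (σ : Equiv.Perm (Fin m)) : permMat N B σ * X = (Equiv.Perm.sign σ : ℤ) • X := by
  have hσ : σ ∈ Submonoid.closure {σ : Equiv.Perm (Fin m) | ∃ a b : Fin m, (b : ℕ) = a + 1 ∧
      σ = Equiv.swap a b} := by rw [closure_adjacent_swaps]; trivial
  induction hσ using Submonoid.closure_induction with
  | mem σ hσ =>
    obtain ⟨a, b, hab, rfl⟩ := hσ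
    rw [h a b hab, Equiv.Perm.sign_swap (by rintro rfl; omega)]
    simp
  | one => simp [permMat_one]
  | mul σ τ _ _ h1 h2 =>
    rw [← permMat_mul_permMat, mul_assoc, h1, mul_smul_comm, h2, smul_smul, map_mul,
      Units.val_mul]

/-- Both sided antisymmetry. -/
def Alternating (X : Matrix (Fin m → Idx N) (Fin m → Idx N) B) : Prop :=
  ∀ σ, X * permMat N B σ = (Equiv.Perm.sign σ : ℤ) • X ∧
    permMat N B σ * X = (Equiv.Perm.sign σ : ℤ) • X

theorem alternating_antisym : Alternating (antisym N m B) := fun σ =>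
  ⟨antisym_mul_permMat σ, permMat_mul_antisym σ⟩

theorem apply_comp_right {X : Matrix (Fin m → Idx N) (Fin m → Idx N) B}
    {σ : Equiv.Perm (Fin m)} (h : X * permMat N B σ = (Equiv.Perm.sign σ : ℤ) • X)
    (x y : Fin m → Idx N) : X x (y ∘ σ) = (Equiv.Perm.sign σ : ℤ) • X x y := by
  have := congrFun (congrFun h x) y
  rwa [mul_permMat_apply] at this

theorem apply_comp_left {X : Matrix (Fin m → Idx N) (Fin m → Idx N) B}
    {σ : Equiv.Perm (Fin m)} (h : permMat N B σ⁻¹ * X = (Equiv.Perm.sign σ⁻¹ : ℤ) • X)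
    (x y : Fin m → Idx N) : X (x ∘ σ) y = (Equiv.Perm.sign σ : ℤ) • X x y := by
  have := congrFun (congrFun h x) y
  rw [permMat_mul_apply, Equiv.Perm.sign_inv] at this
  exact this

theorem apply_eq_zero_of_not_injective {X : Matrix (Fin m → Idx N) (Fin m → Idx N) B}
    (h : ∀ σ, X * permMat N B σ = (Equiv.Perm.sign σ : ℤ) • X) (x y : Fin m → Idx N)
    (hy : ¬ Function.Injective y) : X x y = 0 := by
  simp only [Function.Injective, not_forall] at hy
  obtain ⟨a, b, hab, hne⟩ := hy
  have h1 := apply_comp_right (h (Equiv.swap a b)) x y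
  have h2 : y ∘ Equiv.swap a b = y := by
    funext d
    by_cases hd : d = a
    · subst hd; simp [hab]
    · by_cases hd' : d = b
      · subst hd'; simp [hab]
      · simp [Equiv.swap_apply_of_ne_of_ne hd hd']
  rw [h2, Equiv.Perm.sign_swap hne] at h1
  exact eq_zero_of_eq_neg (by simpa using h1)

theorem apply_eq_zero_of_not_injective_left {X : Matrix (Fin m → Idx N) (Fin m → Idx N) B}
    (h : ∀ σ, permMat N B σ * X = (Equiv.Perm.sign σ : ℤ) • X) (x y : Fin m → Idx N)
    (hx : ¬ Function.Injective x) : X x y = 0 := by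
  simp only [Function.Injective, not_forall] at hx
  obtain ⟨a, b, hab, hne⟩ := hx
  have h1 := apply_comp_left (h (Equiv.swap a b)⁻¹) x y
  have h2 : x ∘ Equiv.swap a b = x := by
    funext d
    by_cases hd : d = a
    · subst hd; simp [hab]
    · by_cases hd' : d = b
      · subst hd'; simp [hab]
      · simp [Equiv.swap_apply_of_ne_of_ne hd hd']
  rw [h2, Equiv.Perm.sign_swap hne] at h1
  exact eq_zero_of_eq_neg (by simpa using h1)

theorem antisym_apply_enum : antisym N N B (enum N) (enum N) = 1 := by
  rw [antisym, Matrix.of_apply, sum_eq_single 1]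
  · simp
  · intro σ _ hσ
    rw [if_neg]
    intro h
    apply hσ
    ext d
    have := congrFun h d
    simp only [Function.comp_apply, EmbeddingLike.apply_eq_iff_eq] at this
    simp [← this]
  · simp

theorem exists_eq_enum_comp {x : Fin N → Idx N} (hx : Function.Injective x) :
    ∃ σ : Equiv.Perm (Fin N), x = enum N ∘ σ := by
  have hb : Function.Bijective x :=
    (Fintype.bijective_iff_injective_and_card x).2 ⟨hx, Fintype.card_congr (enum N)⟩
  exact ⟨(Equiv.ofBijective x hb).trans (enum N).symm, by ext; simp⟩

theorem mul_scalar_apply (X : Matrix (Fin m → Idx N) (Fin m → Idx N) B) (q : B)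
    (x y : Fin m → Idx N) : (X * Matrix.scalar (Fin m → Idx N) q) x y = X x y * q := by
  rw [Matrix.scalar_apply, Matrix.mul_diagonal]

/-- One-dimensionality of the top exterior power: noninjective multi-indices give zero entries, and
every injective one is a permutation of `enum N`, so a single entry determines the matrix. -/
theorem Alternating.eq_antisym_mul {X : Matrix (Fin N → Idx N) (Fin N → Idx N) B}
    (h : Alternating X) :
    X = antisym N N B * Matrix.scalar (Fin N → Idx N) (X (enum N) (enum N)) := by
  ext x y
  rw [mul_scalar_apply]
  by_cases hx : Function.Injective x
  · by_cases hy : Function.Injective y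
    · obtain ⟨σ, rfl⟩ := exists_eq_enum_comp hx
      obtain ⟨τ, rfl⟩ := exists_eq_enum_comp hy
      have hA := alternating_antisym (N := N) (m := N) (B := B)
      rw [apply_comp_right (h τ).1, apply_comp_left (h σ⁻¹).2,
        apply_comp_right (hA τ).1, apply_comp_left (hA σ⁻¹).2, antisym_apply_enum,
        smul_mul_assoc, smul_mul_assoc, one_mul]
    · rw [apply_eq_zero_of_not_injective (fun σ => (h σ).1) x y hy,
        apply_eq_zero_of_not_injective antisym_mul_permMat x y hy, zero_mul]
  · rw [apply_eq_zero_of_not_injective_left (fun σ => (h σ).2) x y hx,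
      apply_eq_zero_of_not_injective_left permMat_mul_antisym x y hx, zero_mul]

theorem antisym_mul_scalar_injective {q q' : B}
    (h : antisym N N B * Matrix.scalar (Fin N → Idx N) q
      = antisym N N B * Matrix.scalar (Fin N → Idx N) q') : q = q' := by
  have := congrFun (congrFun h (enum N)) (enum N)
  rwa [mul_scalar_apply, mul_scalar_apply, antisym_apply_enum, one_mul, one_mul] at this

theorem antisym_mul_of_left {X : Matrix (Fin m → Idx N) (Fin m → Idx N) B}
    (h : ∀ σ, permMat N B σ * X = (Equiv.Perm.sign σ : ℤ) • X) :
    antisym N m B * X = (m.factorial : ℂ) • X := by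
  rw [antisym_eq_sum, sum_mul]
  have : ∀ σ ∈ (univ : Finset (Equiv.Perm (Fin m))),
      ((Equiv.Perm.sign σ : ℤ) • permMat N B σ) * X = X := by
    intro σ _
    rw [smul_mul_assoc, h, smul_smul, ← Units.val_mul, Int.units_mul_self, Units.val_one, one_smul]
  rw [sum_congr rfl this, sum_const, card_univ, Fintype.card_perm, Fintype.card_fin,
    Nat.cast_smul_eq_nsmul]

theorem mul_antisym_of_right {X : Matrix (Fin m → Idx N) (Fin m → Idx N) B}
    (h : ∀ σ, X * permMat N B σ = (Equiv.Perm.sign σ : ℤ) • X) :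
    X * antisym N m B = (m.factorial : ℂ) • X := by
  rw [antisym_eq_sum, mul_sum]
  have : ∀ σ ∈ (univ : Finset (Equiv.Perm (Fin m))),
      X * ((Equiv.Perm.sign σ : ℤ) • permMat N B σ) = X := by
    intro σ _
    rw [mul_smul_comm, h, smul_smul, ← Units.val_mul, Int.units_mul_self, Units.val_one, one_smul]
  rw [sum_congr rfl this, sum_const, card_univ, Fintype.card_perm, Fintype.card_fin,
    Nat.cast_smul_eq_nsmul]

/-- `R_{ab}(u_a - u_b) = 1 - P_{ab} (b - a)⁻¹`. -/
def rMat (N : ℕ) {m : ℕ} (B : Type*) [Ring B] [Algebra ℂ B] (a b : Fin m) :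
    Matrix (Fin m → Idx N) (Fin m → Idx N) B :=
  1 - ((b : ℂ) - (a : ℂ))⁻¹ • permMat N B (Equiv.swap a b)

/-- Adjacent copies `a < b` in a list may be exchanged by means of `R_{ab}`. -/
def Exchange (F : List (Fin m) → Matrix (Fin m → Idx N) (Fin m → Idx N) B) : Prop :=
  ∀ (l₁ l₂ : List (Fin m)) (a b : Fin m), a < b → (l₁ ++ a :: b :: l₂).Nodup →
    rMat N B a b * F (l₁ ++ a :: b :: l₂) = F (l₁ ++ b :: a :: l₂) * rMat N B a b

theorem rMat_adjacent {a b : Fin m} (h : (b : ℕ) = a + 1) :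
    rMat N B a b = 1 - permMat N B (Equiv.swap a b) := by
  rw [rMat, h]; simp

variable {F : List (Fin m) → Matrix (Fin m → Idx N) (Fin m → Idx N) B}

/-- Multiply the exchange relation by `A` on the left and by `1 + P` on the right: one side is `2 A
F (1 + P)` because `A (1 - P) = 2 A`, the other vanishes because `(1 - P)(1 + P) = 0`. -/
theorem Exchange.antisym_mul (hF : Exchange F) {l₁ l₂ : List (Fin m)} {a b : Fin m}
    (h : (b : ℕ) = a + 1) (hl : (l₁ ++ a :: b :: l₂).Nodup) :
    antisym N m B * F (l₁ ++ a :: b :: l₂) * permMat N B (Equiv.swap a b)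
      = -(antisym N m B * F (l₁ ++ a :: b :: l₂)) := by
  have hlt : a < b := by rw [Fin.lt_def]; omega
  have h1 := hF l₁ l₂ a b hlt hl
  rw [rMat_adjacent h] at h1
  set P := permMat N B (Equiv.swap a b)
  have hPP : P * P = 1 := permMat_swap_mul_self a b
  have hA : antisym N m B * P = -antisym N m B := antisym_mul_permMat_swap hlt.ne
  set G := F (l₁ ++ a :: b :: l₂)
  have h2 : antisym N m B * ((1 - P) * G) * (1 + P) = 0 := by
    rw [h1, mul_assoc, mul_assoc, mul_add, mul_one, sub_mul, hPP, one_mul]; simp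
  have h3 : (2 : ℂ) • (antisym N m B * G * (1 + P)) = 0 := by
    rw [← h2, ← mul_assoc, mul_sub, hA, mul_one, two_smul]; noncomm_ring
  have h4 := (smul_eq_zero.1 h3).resolve_left two_ne_zero
  rw [mul_add, mul_one] at h4
  exact eq_neg_of_add_eq_zero_right h4

theorem Exchange.mul_antisym (hF : Exchange F) {l₁ l₂ : List (Fin m)} {a b : Fin m}
    (h : (b : ℕ) = a + 1) (hl : (l₁ ++ a :: b :: l₂).Nodup) :
    permMat N B (Equiv.swap a b) * (F (l₁ ++ b :: a :: l₂) * antisym N m B)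
      = -(F (l₁ ++ b :: a :: l₂) * antisym N m B) := by
  have hlt : a < b := by rw [Fin.lt_def]; omega
  have h1 := hF l₁ l₂ a b hlt hl
  rw [rMat_adjacent h] at h1
  set P := permMat N B (Equiv.swap a b)
  have hPP : P * P = 1 := permMat_swap_mul_self a b
  have hA : P * antisym N m B = -antisym N m B := permMat_swap_mul_antisym hlt.ne
  set G := F (l₁ ++ b :: a :: l₂)
  have h2 : (1 + P) * (G * (1 - P)) * antisym N m B = 0 := by
    rw [← h1, ← mul_assoc, add_mul, one_mul, mul_sub, hPP, mul_one]; simp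
  have h3 : (2 : ℂ) • ((1 + P) * (G * antisym N m B)) = 0 := by
    rw [← h2, mul_assoc, mul_assoc, sub_mul, hA, one_mul, two_smul]; noncomm_ring
  have h4 := (smul_eq_zero.1 h3).resolve_left two_ne_zero
  rw [add_mul, one_mul] at h4
  exact eq_neg_of_add_eq_zero_right h4

/-- `F l` and `F l'` are intertwined by an operator acting on antisymmetric tensors by a nonzero
scalar. -/
def Intertwined (F : List (Fin m) → Matrix (Fin m → Idx N) (Fin m → Idx N) B)
    (l l' : List (Fin m)) : Prop :=
  ∃ (M : Matrix (Fin m → Idx N) (Fin m → Idx N) B) (z : ℂ), z ≠ 0 ∧ M * F l = F l' * M ∧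
    antisym N m B * M = z • antisym N m B ∧ M * antisym N m B = z • antisym N m B

theorem Intertwined.refl (l : List (Fin m)) : Intertwined F l l :=
  ⟨1, 1, one_ne_zero, by simp, by simp, by simp⟩

theorem Intertwined.trans {l l' l'' : List (Fin m)} (h : Intertwined F l l')
    (h' : Intertwined F l' l'') : Intertwined F l l'' := by
  obtain ⟨M, z, hz, h1, h2, h3⟩ := h
  obtain ⟨M', z', hz', h1', h2', h3'⟩ := h'
  refine ⟨M' * M, z' * z, mul_ne_zero hz' hz, ?_, ?_, ?_⟩
  · rw [mul_assoc, h1, ← mul_assoc, h1', mul_assoc]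
  · rw [← mul_assoc, h2', smul_mul_assoc, h2, smul_smul]
  · rw [mul_assoc, h3, mul_smul_comm, h3', smul_smul, mul_comm]

/-- `z A F(l) A = A M F(l) A = A F(l') M A = z A F(l') A`, and `z` is invertible. -/
theorem Intertwined.antisym_mul_mul_antisym {l l' : List (Fin m)} (h : Intertwined F l l') :
    antisym N m B * F l * antisym N m B = antisym N m B * F l' * antisym N m B := by
  obtain ⟨M, z, hz, h1, h2, h3⟩ := h
  have : z • (antisym N m B * F l * antisym N m B)
      = z • (antisym N m B * F l' * antisym N m B) := by
    rw [← smul_mul_assoc, ← smul_mul_assoc, ← h2, mul_assoc (antisym N m B), h1,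
      ← mul_smul_comm z, ← h3]
    simp only [mul_assoc]
  exact smul_right_injective _ hz this

/-- `P` acts on `A` by `-1`, so `R_{ab}` acts by `1 + 1 / (b - a)`, which is nonzero as `a < b`. No
identification of a product of the `R_{ab}` with `A` is needed. -/
theorem Exchange.intertwined (hF : Exchange F) {l₁ l₂ : List (Fin m)} {a b : Fin m}
    (hab : a < b) (hl : (l₁ ++ a :: b :: l₂).Nodup) :
    Intertwined F (l₁ ++ a :: b :: l₂) (l₁ ++ b :: a :: l₂) := by
  refine ⟨rMat N B a b, 1 + ((b : ℂ) - (a : ℂ))⁻¹, ?_, hF _ _ _ _ hab hl, ?_, ?_⟩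
  · have h : ((b : ℂ) - (a : ℂ)) = ((b - a : ℕ) : ℂ) := by
      rw [Nat.cast_sub (Fin.le_def.1 hab.le)]
    have hpos : 0 < (b - a : ℕ) := Nat.sub_pos_of_lt hab
    rw [h]
    generalize (b - a : ℕ) = k at hpos
    have hk : (k : ℂ) ≠ 0 := by exact_mod_cast hpos.ne'
    have e : 1 + (k : ℂ)⁻¹ = ((k + 1 : ℕ) : ℂ) / k := by push_cast; field_simp
    rw [e]
    exact div_ne_zero (by exact_mod_cast k.succ_ne_zero) hk
  · rw [rMat, mul_sub, mul_one, mul_smul_comm, antisym_mul_permMat_swap hab.ne]; module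
  · rw [rMat, sub_mul, one_mul, smul_mul_assoc, permMat_swap_mul_antisym hab.ne]; module

theorem Exchange.intertwined_move (hF : Exchange F) (p : Fin m) (ps l₂ : List (Fin m)) :
    ∀ l₁ : List (Fin m), (∀ q ∈ ps, p < q) → (l₁ ++ p :: (ps ++ l₂)).Nodup →
      Intertwined F (l₁ ++ p :: (ps ++ l₂)) (l₁ ++ (ps ++ p :: l₂)) := by
  induction ps with
  | nil => intro l₁ _ _; exact Intertwined.refl _
  | cons q ps ih =>
    intro l₁ h hl
    refine (hF.intertwined (h q (by simp)) hl).trans ?_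
    have := ih (l₁ ++ [q]) (fun r hr => h r (by simp [hr])) (by
      refine (List.Perm.nodup_iff ?_).1 hl
      simp only [List.append_assoc, List.cons_append, List.nil_append]
      exact List.Perm.append_left _ (List.Perm.swap _ _ _))
    simpa using this

theorem Exchange.intertwined_reverse (hF : Exchange F) (l : List (Fin m)) :
    ∀ l₂ : List (Fin m), l.Pairwise (· < ·) → (l ++ l₂).Nodup →
      Intertwined F (l ++ l₂) (l.reverse ++ l₂) := by
  induction l with
  | nil => intro l₂ _ _; exact Intertwined.refl _
  | cons p ps ih =>
    intro l₂ h hl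
    rw [List.pairwise_cons] at h
    refine (hF.intertwined_move p ps l₂ [] h.1 hl).trans ?_
    have := ih (p :: l₂) h.2 ((List.Perm.nodup_iff List.perm_middle).2 hl)
    simpa using this

theorem eq_take_append (l : List (Fin m)) {i : ℕ} (h : i + 1 < l.length) :
    l = l.take i ++ l[i] :: l[i + 1] :: l.drop (i + 2) := by
  rw [← List.drop_eq_getElem_cons h, ← List.drop_eq_getElem_cons (by omega), List.take_append_drop]

end Antisymmetrizer

section Determinant

variable {N : ℕ} {B : Type*} [Ring B] [Algebra ℂ B]

/-- Alternation on the side of `A` is automatic, and on the other side it follows from adjacent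
exchanges. Compressing `A F` and `F A` by a second `A` multiplies each by `N!`, and the two
compressions coincide because the orderings are intertwined. -/
theorem Exchange.exists_det
    {F : List (Fin N) → Matrix (Fin N → Idx N) (Fin N → Idx N) B} (hF : Exchange F) :
    ∃ q : B, antisym N N B * F (List.finRange N)
        = antisym N N B * Matrix.scalar (Fin N → Idx N) q ∧
      F (List.finRange N).reverse * antisym N N B
        = antisym N N B * Matrix.scalar (Fin N → Idx N) q := by
  set A := antisym N N B
  have hX : Alternating (A * F (List.finRange N)) := by
    intro σ
    refine ⟨mul_permMat_of_adjacent (fun a b hab => ?_) σ, ?_⟩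
    · have hb := b.2
      have e := eq_take_append (List.finRange N) (i := a) (by simp; omega)
      have e1 : (List.finRange N)[(a : ℕ)]'(by simp) = a := by simp
      have e2 : (List.finRange N)[(a : ℕ) + 1]'(by simp; omega) = b := by
        ext; simp [hab]
      rw [e1, e2] at e
      have hn := List.nodup_finRange N
      rw [e] at hn ⊢
      exact hF.antisym_mul hab hn
    · rw [← mul_assoc, permMat_mul_antisym, smul_mul_assoc]
  have hY : ∀ σ, permMat N B σ * (F (List.finRange N).reverse * A)
      = (Equiv.Perm.sign σ : ℤ) • (F (List.finRange N).reverse * A) := by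
    intro σ
    refine permMat_mul_of_adjacent (fun a b hab => ?_) σ
    have hb := b.2
    have e := eq_take_append (List.finRange N) (i := a) (by simp; omega)
    have e1 : (List.finRange N)[(a : ℕ)]'(by simp) = a := by simp
    have e2 : (List.finRange N)[(a : ℕ) + 1]'(by simp; omega) = b := by
      ext; simp [hab]
    rw [e1, e2] at e
    have hn := List.nodup_finRange N
    rw [e] at hn ⊢
    have hr : ∀ l₁ l₂ : List (Fin N), (l₁ ++ a :: b :: l₂).reverse
        = l₂.reverse ++ b :: a :: l₁.reverse := by intro l₁ l₂; simp
    rw [hr]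
    refine hF.mul_antisym hab ?_
    refine (List.Perm.nodup_iff ?_).1 (List.nodup_reverse.2 hn)
    rw [hr]
    exact List.Perm.append_left _ (List.Perm.swap _ _ _)
  have hinter := (hF.intertwined_reverse (List.finRange N) [] (List.pairwise_lt_finRange N)
    (by simpa using List.nodup_finRange N)).antisym_mul_mul_antisym
  rw [List.append_nil, List.append_nil, mul_antisym_of_right fun σ => (hX σ).1, mul_assoc,
    antisym_mul_of_left hY] at hinter
  have hXY := smul_right_injective _ (by exact_mod_cast N.factorial_ne_zero : (N.factorial : ℂ) ≠ 0)
    hinter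
  exact ⟨_, hX.eq_antisym_mul, hXY.symm.trans hX.eq_antisym_mul⟩

end Determinant

end TwYang

end

/-! ### Ordered products in a monoid and their rearrangement. -/

noncomputable section

namespace TwYang

open Finset Matrix PowerSeries

section Words

variable {ι M : Type*} [Monoid M]

/-- `σ_{p_1} (R_{p_1p_2} ⋯ R_{p_1p_m}) σ_{p_2} (R_{p_2p_3} ⋯ R_{p_2p_m}) ⋯ σ_{p_m}` in a monoid. -/
def word (R : ι → ι → M) (σ : ι → M) : List ι → M
  | [] => 1
  | p :: ps => σ p * (ps.map (R p)).prod * word R σ ps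

theorem commute_word {R : ι → ι → M} {σ : ι → M} {x : M} (l : List ι)
    (hσ : ∀ p ∈ l, Commute x (σ p))
    (hR : ∀ p ∈ l, ∀ q ∈ l, p ≠ q → Commute x (R p q)) (hl : l.Nodup) :
    Commute x (word R σ l) := by
  induction l with
  | nil => exact Commute.one_right _
  | cons p ps ih =>
    rw [List.nodup_cons] at hl
    refine ((hσ p (by simp)).mul_right (Commute.list_prod_right _ _ ?_)).mul_right
      (ih (fun q hq => hσ q (by simp [hq]))
        (fun q hq q' hq' h => hR q (by simp [hq]) q' (by simp [hq']) h) hl.2)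
    intro y hy
    rw [List.mem_map] at hy
    obtain ⟨q, hq, rfl⟩ := hy
    exact hR p (by simp) q (by simp [hq]) (by rintro rfl; exact hl.1 hq)

/-- Scalar operators `R_{ab}` on pairs of copies. -/
structure PairOperators (R : ι → ι → M) : Prop where
  symm : ∀ a b, R a b = R b a
  commute : ∀ a b p q, a ≠ p → a ≠ q → b ≠ p → b ≠ q → Commute (R a b) (R p q)

/-- Interleaves two rows of factors, so that the Yang–Baxter equation can be applied to one pair `R
a q`, `R b q` at a time. -/
theorem prod_map_mul_prod_map {R : ι → ι → M} (hR : PairOperators R) {a b : ι}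
    (l : List ι) (hl : l.Nodup) (hab : a ≠ b) (ha : a ∉ l) (hb : b ∉ l) :
    (l.map (R a)).prod * (l.map (R b)).prod = (l.map fun q => R a q * R b q).prod := by
  induction l with
  | nil => simp
  | cons q l ih =>
    rw [List.nodup_cons] at hl
    simp only [List.mem_cons, not_or] at ha hb
    simp only [List.map_cons, List.prod_cons]
    rw [← ih hl.2 ha.2 hb.2]
    have : Commute (l.map (R a)).prod (R b q) := by
      refine (Commute.list_prod_right _ _ fun y hy => ?_).symm
      rw [List.mem_map] at hy
      obtain ⟨r, hr, rfl⟩ := hy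
      refine hR.commute _ _ _ _ hab.symm ?_ (fun h => ha.1 h.symm) ?_
      · rintro rfl; exact hb.2 hr
      · rintro rfl; exact hl.1 hr
    rw [mul_assoc, mul_assoc, ← mul_assoc _ (R b q), this.eq]
    simp only [mul_assoc]

theorem semiconj_prod {r : M} {f g : ι → M} (l : List ι) (h : ∀ q ∈ l, r * f q = g q * r) :
    r * (l.map f).prod = (l.map g).prod * r := by
  induction l with
  | nil => simp
  | cons q l ih =>
    simp only [List.map_cons, List.prod_cons]
    rw [← mul_assoc, h q (by simp), mul_assoc, ih fun p hp => h p (by simp [hp]), mul_assoc]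

/-- The block `σ a * (R a b * σ b)` is handled by `hrefl`, and the pairs `R a q`, `R b q` with later
`q` by `hyb`. An earlier `p` contributes `R p a * R p b`, handled by `hyb` and the symmetry of `R`.
All other factors commute with `r`. -/
theorem word_exchange {R : ι → ι → M} {σ : ι → M} {r : M} (hR : PairOperators R)
    (hσR : ∀ p a b, p ≠ a → p ≠ b → Commute (σ p) (R a b)) {a b : ι} (hab : a ≠ b)
    (hrσ : ∀ p, p ≠ a → p ≠ b → Commute r (σ p))
    (hrR : ∀ p q, p ≠ a → p ≠ b → q ≠ a → q ≠ b → p ≠ q → Commute r (R p q))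
    (hrefl : r * (σ a * (R a b * σ b)) = σ b * (R a b * σ a) * r)
    (hyb : ∀ q, q ≠ a → q ≠ b → r * (R a q * R b q) = R b q * R a q * r) (l₂ : List ι) :
    ∀ l₁ : List ι, (l₁ ++ a :: b :: l₂).Nodup →
      r * word R σ (l₁ ++ a :: b :: l₂) = word R σ (l₁ ++ b :: a :: l₂) * r := by
  intro l₁
  induction l₁ with
  | nil =>
    intro hl
    simp only [List.nil_append, List.nodup_cons, List.mem_cons, not_or] at hl
    obtain ⟨⟨_, ha⟩, hb, hl⟩ := hl
    have hne : ∀ q ∈ l₂, q ≠ a ∧ q ≠ b := fun q hq =>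
      ⟨by rintro rfl; exact ha hq, by rintro rfl; exact hb hq⟩
    have hc1 : ∀ a b : ι, a ≠ b → b ∉ l₂ → Commute (l₂.map (R a)).prod (σ b) := by
      intro a b hab hb
      refine (Commute.list_prod_right _ _ fun y hy => ?_).symm
      rw [List.mem_map] at hy
      obtain ⟨q, hq, rfl⟩ := hy
      exact hσR b a q hab.symm (by rintro rfl; exact hb hq)
    have hc2 : Commute r (word R σ l₂) :=
      commute_word l₂ (fun p hp => hrσ p (hne p hp).1 (hne p hp).2)
        (fun p hp q hq h => hrR p q (hne p hp).1 (hne p hp).2 (hne q hq).1 (hne q hq).2 h) hl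
    have hc3 : r * ((l₂.map (R a)).prod * (l₂.map (R b)).prod)
        = (l₂.map (R b)).prod * (l₂.map (R a)).prod * r := by
      rw [prod_map_mul_prod_map hR l₂ hl hab ha hb, prod_map_mul_prod_map hR l₂ hl hab.symm hb ha]
      exact semiconj_prod l₂ fun q hq => hyb q (hne q hq).1 (hne q hq).2
    have e : ∀ a b : ι, a ≠ b → b ∉ l₂ → word R σ (a :: b :: l₂) = (σ a * (R a b * σ b))
        * (((l₂.map (R a)).prod * (l₂.map (R b)).prod) * word R σ l₂) := by
      intro a b hab hb
      simp only [word, List.map_cons, List.prod_cons]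
      have := (hc1 a b hab hb).eq
      calc _ = σ a * R a b * ((l₂.map (R a)).prod * σ b) * (l₂.map (R b)).prod * word R σ l₂ := by
            simp only [mul_assoc]
        _ = _ := by rw [this]; simp only [mul_assoc]
    rw [List.nil_append, List.nil_append, e a b hab hb, e b a hab.symm ha, ← mul_assoc, hrefl,
      mul_assoc, ← mul_assoc r, hc3, mul_assoc _ r, hc2.eq, hR.symm b a]
    simp only [mul_assoc]
  | cons p l₁ ih =>
    intro hl
    rw [List.cons_append, List.nodup_cons] at hl
    have hp := hl.1
    simp only [List.mem_append, List.mem_cons, not_or] at hp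
    obtain ⟨hp1, hpa, hpb, hp2⟩ := hp
    have hl2 := hl.2
    rw [List.nodup_append] at hl2
    obtain ⟨_, hn2, hd⟩ := hl2
    have hca : ∀ l : List ι, (∀ q ∈ l, q ≠ a ∧ q ≠ b ∧ p ≠ q) →
        Commute r (l.map (R p)).prod := by
      intro l h
      refine Commute.list_prod_right _ _ fun y hy => ?_
      rw [List.mem_map] at hy
      obtain ⟨q, hq, rfl⟩ := hy
      exact hrR p q hpa hpb (h q hq).1 (h q hq).2.1 (h q hq).2.2
    have h1 := hca l₁ fun q hq => ⟨hd q hq a (by simp), hd q hq b (by simp),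
      by rintro rfl; exact hp1 hq⟩
    simp only [List.nodup_cons, List.mem_cons, not_or] at hn2
    have h2 := hca l₂ fun q hq => ⟨by rintro rfl; exact hn2.1.2 hq,
      by rintro rfl; exact hn2.2.1 hq, by rintro rfl; exact hp2 hq⟩
    have h3 := hyb p hpa hpb
    rw [hR.symm a p, hR.symm b p] at h3
    simp only [List.cons_append, word, List.map_append, List.map_cons, List.prod_append,
      List.prod_cons]
    calc _ = (r * σ p) * (l₁.map (R p)).prod * (R p a * (R p b * (l₂.map (R p)).prod))
          * word R σ (l₁ ++ a :: b :: l₂) := by simp only [mul_assoc]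
      _ = σ p * (r * (l₁.map (R p)).prod) * (R p a * (R p b * (l₂.map (R p)).prod))
          * word R σ (l₁ ++ a :: b :: l₂) := by
          rw [(hrσ p hpa hpb).eq]; simp only [mul_assoc]
      _ = σ p * (l₁.map (R p)).prod * ((r * (R p a * R p b)) * (l₂.map (R p)).prod)
          * word R σ (l₁ ++ a :: b :: l₂) := by
          rw [h1.eq]; simp only [mul_assoc]
      _ = σ p * (l₁.map (R p)).prod * (R p b * R p a * (r * (l₂.map (R p)).prod))
          * word R σ (l₁ ++ a :: b :: l₂) := by
          rw [h3]; simp only [mul_assoc]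
      _ = σ p * (l₁.map (R p)).prod * (R p b * R p a * ((l₂.map (R p)).prod))
          * (r * word R σ (l₁ ++ a :: b :: l₂)) := by
          rw [h2.eq]; simp only [mul_assoc]
      _ = _ := by rw [ih hl.2]; simp only [mul_assoc]

/-- Each `t' p` moves right, crossing the `t q` of later copies by `h`; the `t` thereby gather on
the left. What remains in its way involves only later copies and commutes with it. -/
theorem word_mul {R : ι → ι → M} {t t' : ι → M}
    (ht : ∀ p a b, p ≠ a → p ≠ b → Commute (t p) (R a b))
    (ht' : ∀ p a b, p ≠ a → p ≠ b → Commute (t' p) (R a b))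
    (h : ∀ p q, p ≠ q → t' p * (R p q * t q) = t q * (R p q * t' p)) (l : List ι)
    (hl : l.Nodup) : word R (fun p => t p * t' p) l
      = (l.map t).prod * word R (fun _ => 1) l * (l.map t').prod := by
  induction l with
  | nil => simp [word]
  | cons p ps ih =>
    rw [List.nodup_cons] at hl
    have hmove : ∀ l : List ι, l.Nodup → p ∉ l →
        t' p * (l.map (R p)).prod * (l.map t).prod
          = (l.map t).prod * (l.map (R p)).prod * t' p := by
      intro l
      induction l with
      | nil => simp
      | cons q l ih =>
        intro hl hp
        rw [List.nodup_cons] at hl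
        simp only [List.mem_cons, not_or] at hp
        simp only [List.map_cons, List.prod_cons]
        have c1 : Commute (l.map (R p)).prod (t q) := by
          refine (Commute.list_prod_right _ _ fun y hy => ?_).symm
          rw [List.mem_map] at hy
          obtain ⟨s, hs, rfl⟩ := hy
          exact ht q p s (Ne.symm hp.1) (by rintro rfl; exact hl.1 hs)
        have c2 : Commute (R p q) (l.map t).prod := by
          refine Commute.list_prod_right _ _ fun y hy => ?_
          rw [List.mem_map] at hy
          obtain ⟨s, hs, rfl⟩ := hy
          exact (ht s p q (by rintro rfl; exact hp.2 hs) (by rintro rfl; exact hl.1 hs)).symm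
        calc _ = t' p * R p q * ((l.map (R p)).prod * t q) * (l.map t).prod := by
              simp only [mul_assoc]
          _ = (t' p * (R p q * t q)) * (l.map (R p)).prod * (l.map t).prod := by
              rw [c1.eq]; simp only [mul_assoc]
          _ = t q * R p q * (t' p * (l.map (R p)).prod * (l.map t).prod) := by
              rw [h p q hp.1]; simp only [mul_assoc]
          _ = t q * (R p q * (l.map t).prod) * (l.map (R p)).prod * t' p := by
              rw [ih hl.2 hp.2]; simp only [mul_assoc]
          _ = _ := by rw [c2.eq]; simp only [mul_assoc]
    have c : Commute (t' p) (word R (fun _ => (1 : M)) ps) := by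
      refine commute_word ps (fun _ _ => Commute.one_right _) (fun a ha b hb _ => ?_) hl.2
      exact ht' p a b (by rintro rfl; exact hl.1 ha) (by rintro rfl; exact hl.1 hb)
    simp only [word, List.map_cons, List.prod_cons, one_mul]
    calc _ = t p * (t' p * (ps.map (R p)).prod * (ps.map t).prod) * word R (fun _ => 1) ps
          * (ps.map t').prod := by rw [ih hl.2]; simp only [mul_assoc]
      _ = t p * (ps.map t).prod * (ps.map (R p)).prod * (t' p * word R (fun _ => 1) ps)
          * (ps.map t').prod := by rw [hmove ps hl.2 hl.1]; simp only [mul_assoc]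
      _ = _ := by rw [c.eq]; simp only [mul_assoc]

/-- Groups the factors by the later copy of each pair instead of the earlier one, so that the
product can be built by adjoining one copy at a time. -/
theorem word_concat {R : ι → ι → M} (hR : PairOperators R) (l : List ι) (p : ι)
    (hl : (l ++ [p]).Nodup) : word R (fun _ => 1) (l ++ [p])
      = word R (fun _ => 1) l * (l.map fun q => R q p).prod := by
  induction l with
  | nil => simp [word]
  | cons q l ih =>
    rw [List.cons_append, List.nodup_cons] at hl
    have hq := hl.1
    simp only [List.mem_append, List.mem_singleton, not_or] at hq
    have hp : p ∉ l := fun h => by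
      have := hl.2
      rw [List.nodup_append] at this
      exact this.2.2 p h p (by simp) rfl
    have hn : l.Nodup := (List.nodup_append.1 hl.2).1
    simp only [List.cons_append, word, one_mul, List.map_append, List.prod_append, List.map_cons,
      List.map_nil, List.prod_cons, List.prod_nil, mul_one]
    have c : Commute (R q p) (word R (fun _ => (1 : M)) l) := by
      refine commute_word l (fun _ _ => Commute.one_right _) (fun a ha b hb _ => ?_) hn
      exact hR.commute _ _ _ _ (by rintro rfl; exact hq.1 ha) (by rintro rfl; exact hq.1 hb)
        (by rintro rfl; exact hp ha) (by rintro rfl; exact hp hb)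
    rw [ih hl.2, mul_assoc, ← mul_assoc (R q p), c.eq]
    simp only [mul_assoc]

end Words

section CommuteCopies

variable {N m : ℕ} {K B : Type*} [CommRing K] [Ring B] [Algebra K B]

theorem qMat_commute (c : Kind) (x y : Idx N × Idx N) (b : B) : Commute b (qMat c N B x y) := by
  simp only [qMat, Matrix.of_apply]
  split_ifs
  · exact (Commute.one_right b).smul_right _
  · exact Commute.zero_right b

theorem onCopies_qMat_commute (c : Kind) (p q : Fin m) (x y : Fin m → Idx N) (b : B) :
    Commute b (onCopies p q (qMat c N B) x y) := by
  simp only [onCopies, Matrix.of_apply]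
  split_ifs
  · exact qMat_commute _ _ _ _
  · exact Commute.zero_right b

theorem commute_permMat_swap_onCopy {a b p : Fin m} (h1 : p ≠ a) (h2 : p ≠ b)
    (M : Matrix (Idx N) (Idx N) B) :
    Commute (permMat N B (Equiv.swap a b)) (onCopy p M) := by
  have := permMat_mul_onCopy (Equiv.swap a b) p M
  rwa [Equiv.swap_apply_of_ne_of_ne h1 h2] at this

theorem commute_permMat_swap_onCopies {a b p q : Fin m} (h1 : p ≠ a) (h2 : p ≠ b)
    (h3 : q ≠ a) (h4 : q ≠ b) (C : Matrix (Idx N × Idx N) (Idx N × Idx N) B) :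
    Commute (permMat N B (Equiv.swap a b)) (onCopies p q C) := by
  have := permMat_mul_onCopies (Equiv.swap a b) p q C
  rwa [Equiv.swap_apply_of_ne_of_ne h1 h2, Equiv.swap_apply_of_ne_of_ne h3 h4] at this

theorem commute_one_sub_smul {R : Type*} [Ring R] [Algebra K R] {x y : R} (h : Commute x y)
    (z : K) : Commute x (1 - z • y) :=
  (Commute.one_right _).sub_right (h.smul_right z)

theorem exchange_prod [Algebra ℂ B] (t : Fin m → Matrix (Idx N) (Idx N) B)
    (ht : ∀ a b : Fin m, a < b → RTT (t a) (t b) (((b : ℂ) - (a : ℂ))⁻¹)) :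
    Exchange fun l => (l.map fun a => onCopy a (t a)).prod := by
  intro l₁ l₂ a b hab hl
  have hc : ∀ l : List (Fin m), a ∉ l → b ∉ l →
      Commute (rMat N B a b) (l.map fun a => onCopy a (t a)).prod := by
    intro l ha hb
    refine Commute.list_prod_right _ _ fun y hy => ?_
    rw [List.mem_map] at hy
    obtain ⟨q, hq, rfl⟩ := hy
    exact (commute_one_sub_smul (commute_permMat_swap_onCopy (by rintro rfl; exact ha hq)
      (by rintro rfl; exact hb hq) _).symm _).symm
  rw [List.nodup_append] at hl
  obtain ⟨_, hn2, hd⟩ := hl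
  simp only [List.nodup_cons, List.mem_cons, not_or] at hn2
  have h1 := hc l₁ (fun h => hd a h a (by simp) rfl) (fun h => hd b h b (by simp) rfl)
  have h2 := hc l₂ hn2.1.2 hn2.2.1
  have h3 : rMat N B a b * (onCopy a (t a) * onCopy b (t b))
      = onCopy b (t b) * onCopy a (t a) * rMat N B a b := rtt_copies hab.ne (ht a b hab)
  simp only [List.map_append, List.map_cons, List.prod_append, List.prod_cons]
  calc _ = (rMat N B a b * (l₁.map fun a => onCopy a (t a)).prod)
        * (onCopy a (t a) * (onCopy b (t b) * (l₂.map fun a => onCopy a (t a)).prod)) := by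
        rw [mul_assoc]
    _ = (l₁.map fun a => onCopy a (t a)).prod * (rMat N B a b * (onCopy a (t a) * onCopy b (t b)))
        * (l₂.map fun a => onCopy a (t a)).prod := by
        rw [h1.eq]; simp only [mul_assoc]
    _ = (l₁.map fun a => onCopy a (t a)).prod * (onCopy b (t b) * onCopy a (t a))
        * (rMat N B a b * (l₂.map fun a => onCopy a (t a)).prod) := by
        rw [h3]; simp only [mul_assoc]
    _ = _ := by rw [h2.eq]; simp only [mul_assoc]

end CommuteCopies

/-! ### Partial fractions of the spectral parameters. -/

section LinearFractions

theorem linInv_sub {a a' : ℂ} (ha : a ≠ 0) (ha' : a' ≠ 0) (b b' : ℂ) :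
    X * (linInv a b - linInv a' b')
      = (PowerSeries.C (a' - a) + PowerSeries.C (b' - b) * X) * (linInv a b * linInv a' b') := by
  have h := linInv_spec ha b
  have h' := linInv_spec ha' b'
  rw [map_sub, map_sub]
  linear_combination linInv a' b' * h - linInv a b * h'

theorem linInv_add {a a' : ℂ} (ha : a ≠ 0) (ha' : a' ≠ 0) (b b' : ℂ) :
    X * (linInv a b + linInv a' b')
      = (PowerSeries.C (a' + a) + PowerSeries.C (b' + b) * X) * (linInv a b * linInv a' b') := by
  have h := linInv_spec ha b
  have h' := linInv_spec ha' b'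
  rw [map_add, map_add]
  linear_combination -linInv a' b' * h - linInv a b * h'

theorem linInv_ne_zero {a : ℂ} (ha : a ≠ 0) (b : ℂ) : linInv a b ≠ 0 := by
  intro h
  have := linInv_spec ha b
  rw [h, mul_zero] at this
  exact X_ne_zero this.symm

theorem linInv_sub_same {a : ℂ} (ha : a ≠ 0) {b b' : ℂ} (hb : b' - b ≠ 0) :
    PowerSeries.C (b' - b)⁻¹ * (linInv a b - linInv a b') = linInv a b * linInv a b' := by
  have h := linInv_sub ha ha b b'
  have h1 : PowerSeries.C (b' - b)⁻¹ * PowerSeries.C (b' - b) = (1 : ℂ⟦X⟧) := by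
    rw [← map_mul, inv_mul_cancel₀ hb, map_one]
  apply mul_left_cancel₀ (X_ne_zero (R := ℂ))
  rw [sub_self, map_zero] at h
  linear_combination PowerSeries.C (b' - b)⁻¹ * h + X * linInv a b * linInv a b' * h1

/-- The `RTT` scalar for the arguments `-u + i` and `u - j`, whose difference is `-2u + i + j`. -/
theorem linInv_neg_two_mul_sub (i j : ℂ) :
    linInv (-2) (i + j) * (linInv 1 (-j) - linInv (-1) i) = linInv (-1) i * linInv 1 (-j) := by
  have h := linInv_sub (a := 1) (a' := -1) one_ne_zero (by norm_num) (-j) i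
  have h1 := linInv_spec (a := -2) (by norm_num) (i + j)
  have e : (-1 - 1 : ℂ) = -2 := by norm_num
  rw [e, sub_neg_eq_add] at h
  apply mul_left_cancel₀ (X_ne_zero (R := ℂ))
  linear_combination linInv (-2) (i + j) * h + linInv (-1) i * linInv 1 (-j) * h1

/-- The scalar `β = 1 / (u_a + u_b)` for the arguments `u - i` and `u - j`. The minus sign appears
because `Rt` is written in terms of `-u_a - u_b`. -/
theorem neg_linInv_neg_two_mul_add (i j : ℂ) :
    -linInv (-2) (i + j) * (linInv 1 (-i) + linInv 1 (-j)) = linInv 1 (-i) * linInv 1 (-j) := by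
  have h := linInv_add (a := 1) (a' := 1) one_ne_zero one_ne_zero (-i) (-j)
  have h1 := linInv_spec (a := -2) (by norm_num) (i + j)
  have e : PowerSeries.C (1 + 1 : ℂ) = -PowerSeries.C (-2) := by rw [← map_neg]; norm_num
  have e' : PowerSeries.C (-j + -i) = -PowerSeries.C (i + j) := by rw [← map_neg]; ring_nf
  rw [e, e'] at h
  apply mul_left_cancel₀ (X_ne_zero (R := ℂ))
  linear_combination -linInv (-2) (i + j) * h + linInv 1 (-i) * linInv 1 (-j) * h1

end LinearFractions

end TwYang

end

/-! ### The exchange property of the products of `T` and of the brackets. -/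

noncomputable section

namespace TwYang

open Finset Matrix PowerSeries

attribute [local instance] seriesAlgebra

section Brackets

variable {N m : ℕ} {A : Type*} [Ring A] [Algebra ℂ A]

theorem Qmat_eq (c : Kind) (N : ℕ) : Qmat c N = qMat c N ℂ := by
  ext ⟨i, k⟩ ⟨j, l⟩
  have h : ∀ a b : Idx N, (Matrix.kronecker (twT c (Matrix.single a b (1 : ℂ)))
      (Matrix.single b a (1 : ℂ))) (i, k) (j, l)
      = if b = k ∧ a = l then twT c (Matrix.single a b (1 : ℂ)) i j else 0 := by
    intro a b
    change _ * Matrix.single b a (1 : ℂ) k l = _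
    rw [Matrix.single_apply, mul_ite, mul_one, mul_zero]
  simp only [Qmat, Matrix.sum_apply, h]
  rw [sum_eq_single l (by intro b _ hb; simp [hb]) (by simp),
    sum_eq_single k (by intro b _ hb; simp [hb]) (by simp), if_pos ⟨rfl, rfl⟩, twT, Matrix.of_apply,
    Matrix.single_apply, θ_eq, qMat, Matrix.of_apply]
  have e1 : (l = -j) = (j = -l) := propext ⟨fun h => by rw [h, neg_neg], fun h => by rw [h, neg_neg]⟩
  have e2 : (k = -i) = (i = -k) := propext ⟨fun h => by rw [h, neg_neg], fun h => by rw [h, neg_neg]⟩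
  simp only [e1, e2, and_comm]
  split_ifs with h
  · rw [h.1, h.2, neg_neg, neg_neg, mul_comm]
  · simp

theorem Rt_comm (c : Kind) (a b : Fin m) : (Rt c a b : Matrix (Fin m → Idx N) (Fin m → Idx N) A⟦X⟧)
    = Rt c b a := by
  rw [Rt, Rt, min_comm, max_comm, add_comm ((a : ℕ) : ℂ)]

theorem Rt_eq (c : Kind) {a b : Fin m} :
    (Rt c a b : Matrix (Fin m → Idx N) (Fin m → Idx N) A⟦X⟧)
      = 1 - (linInv (-2) (((a : ℕ) : ℂ) + ((b : ℕ) : ℂ))) • onCopies a b (qMat c N A⟦X⟧) := by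
  have h : ∀ {a b : Fin m}, a ≤ b →
      (Rt c a b : Matrix (Fin m → Idx N) (Fin m → Idx N) A⟦X⟧)
      = 1 - (linInv (-2) (((a : ℕ) : ℂ) + ((b : ℕ) : ℂ))) • onCopies a b (qMat c N A⟦X⟧) := by
    intro a b hab
    rw [Rt, min_eq_left hab, max_eq_right hab, ← onCopies_smul, Qmat_eq]
    congr 2
    ext x y : 2
    simp only [Matrix.map_apply, Matrix.smul_apply, qMat, Matrix.of_apply]
    split_ifs
    · rw [series_smul_def, map_mul, mul_smul_comm, mul_one, zsmul_one, map_intCast, map_intCast,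
        zsmul_eq_mul]
    · simp
  rcases le_total a b with hab | hab
  · exact h hab
  · rw [Rt_comm, h hab, onCopies_qMat_comm, add_comm ((a : ℕ) : ℂ)]

theorem Rt_apply_commute (c : Kind) (a b : Fin m) {M : Matrix (Fin m → Idx N) (Fin m → Idx N) A⟦X⟧}
    {s : Set (Fin m)} (hM : ActsOn s M) (ha : a ∉ s) (hb : b ∉ s) : Commute M (Rt c a b) := by
  rw [Rt_eq]
  apply commute_one_sub_smul
  refine hM.commute (actsOn_onCopies a b _) ?_ fun _ _ _ _ => onCopies_qMat_commute _ _ _ _ _ _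
  rw [Set.disjoint_right]
  rintro d (rfl | rfl)
  · exact ha
  · exact hb

theorem pairOperators_Rt (c : Kind) :
    PairOperators (Rt c : Fin m → Fin m → Matrix (Fin m → Idx N) (Fin m → Idx N) A⟦X⟧) where
  symm := Rt_comm c
  commute a b p q h1 h2 h3 h4 := by
    rw [Rt_eq (a := a)]
    refine (commute_one_sub_smul ?_ _).symm
    exact (Rt_apply_commute c p q (actsOn_onCopies a b _) (by simp [h1.symm, h3.symm])
      (by simp [h2.symm, h4.symm])).symm

theorem commute_onCopy_Rt (c : Kind) (p a b : Fin m) (ha : p ≠ a) (hb : p ≠ b)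
    (M : Matrix (Idx N) (Idx N) A⟦X⟧) : Commute (onCopy p M) (Rt c a b) :=
  Rt_apply_commute c a b (actsOn_onCopy p M) (by simp [ha.symm]) (by simp [hb.symm])

theorem C_smul_matrix {ι κ : Type*} (z : ℂ) (M : Matrix ι κ A⟦X⟧) :
    (PowerSeries.C z) • M = z • M := by
  exact Matrix.ext fun x y => C_series_smul z (M x y)

theorem rMat_eq (a b : Fin m) : rMat N A⟦X⟧ a b
    = 1 - (PowerSeries.C ((b : ℂ) - (a : ℂ))⁻¹) • permMat N A⟦X⟧ (Equiv.swap a b) := by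
  rw [rMat, C_smul_matrix]

theorem commute_rMat_onCopy {a b p : Fin m} (h1 : p ≠ a) (h2 : p ≠ b)
    (M : Matrix (Idx N) (Idx N) A⟦X⟧) : Commute (rMat N A⟦X⟧ a b) (onCopy p M) :=
  (commute_one_sub_smul (K := ℂ) (commute_permMat_swap_onCopy h1 h2 _).symm _).symm

theorem commute_rMat_Rt (c : Kind) {a b p q : Fin m} (h1 : p ≠ a) (h2 : p ≠ b)
    (h3 : q ≠ a) (h4 : q ≠ b) : Commute (rMat N A⟦X⟧ a b) (Rt c p q) := by
  rw [Rt_eq]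
  refine commute_one_sub_smul (K := ℂ⟦X⟧) (Commute.symm (commute_one_sub_smul (K := ℂ) ?_ _)) _
  exact (commute_permMat_swap_onCopies h1 h2 h3 h4 _).symm

theorem cast_sub_ne_zero {a b : Fin m} (h : a ≠ b) : ((b : ℕ) : ℂ) - ((a : ℕ) : ℂ) ≠ 0 :=
  sub_ne_zero.2 fun e => h (Fin.ext (Nat.cast_injective e).symm)

/-- The Yang–Baxter scalars are `1 / (b - a)`, `1 / (-2u + a + q)` and `1 / (-2u + b + q)`; the
required identity is a partial fraction decomposition. -/
theorem rMat_mul_Rt_mul_Rt (c : Kind) (hc : c = .symplectic → Even N) {a b q : Fin m}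
    (hab : a ≠ b) (ha : q ≠ a) (hb : q ≠ b) :
    rMat N A⟦X⟧ a b * (Rt c a q * Rt c b q) = Rt c b q * Rt c a q * rMat N A⟦X⟧ a b := by
  rw [Rt_eq, Rt_eq, rMat_eq]
  apply yang_baxter c hc hab ha.symm hb.symm
  have h := linInv_sub_same (a := -2) (by norm_num) (b := (a : ℂ) + (q : ℂ))
    (b' := (b : ℂ) + (q : ℂ)) (by simpa using cast_sub_ne_zero hab)
  rw [← h]
  congr 3
  ring

theorem exchange_word (c : Kind) (hc : c = .symplectic → Even N)
    (σ : Fin m → Matrix (Idx N) (Idx N) A⟦X⟧)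
    (hσ : ∀ a b : Fin m, a < b → Reflection c (σ a) (σ b)
      (PowerSeries.C ((b : ℂ) - (a : ℂ))⁻¹) (-linInv (-2) (((a : ℕ) : ℂ) + ((b : ℕ) : ℂ)))) :
    Exchange (word (Rt c) fun a => onCopy a (σ a)) := by
  intro l₁ l₂ a b hab hl
  refine word_exchange (pairOperators_Rt c) ?_ hab.ne ?_ ?_ ?_ ?_ l₂ l₁ hl
  · intro p a b ha hb
    exact commute_onCopy_Rt c p a b ha hb _
  · intro p ha hb
    exact commute_rMat_onCopy ha hb _
  · intro p q h1 h2 h3 h4 _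
    exact commute_rMat_Rt c h1 h2 h3 h4
  · have := reflection_copies c hab.ne (hσ a b hab)
    rwa [neg_smul, ← sub_eq_add_neg, ← Rt_eq, ← rMat_eq] at this
  · intro q ha hb
    exact rMat_mul_Rt_mul_Rt c hc hab.ne ha hb

theorem bracket_eq_word (c : Kind) (S : Matrix (Idx N) (Idx N) A⟦X⟧) (l : List (Fin m)) :
    bracket c S l = word (Rt c) (shifted S) l := by
  induction l with
  | nil => rfl
  | cons p ps ih => rw [bracket, word, ih]

theorem exchange_bracket (c : Kind) (hc : c = .symplectic → Even N) :
    Exchange (bracket c (Smat c N) : List (Fin m) → _) := by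
  have h := exchange_word (m := m) c hc
    (fun a => (Smat c N).map (evalAt (linInv 1 (-((a : ℕ) : ℂ))))) (by
      intro a b hab
      have hb : (-(a : ℂ)) - (-(b : ℂ)) ≠ 0 := by
        have := cast_sub_ne_zero hab.ne
        rwa [neg_sub_neg]
      refine reflection_evalAt c (constantCoeff_linInv _ _) (constantCoeff_linInv _ _)
        (linInv_ne_zero one_ne_zero _) (linInv_ne_zero one_ne_zero _) ?_ ?_
      · rw [mul_comm (linInv 1 (-((a : ℕ) : ℂ))), ← linInv_sub_same one_ne_zero hb, neg_sub_neg]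
      · exact neg_linInv_neg_two_mul_add _ _)
  have e : (bracket c (Smat c N) : List (Fin m) → _) = word (Rt c) (shifted (Smat c N)) :=
    funext fun l => bracket_eq_word c _ l
  rw [e]
  exact h

theorem rtt_ℂ_of_C {T T' : Matrix (Idx N) (Idx N) A⟦X⟧} {z : ℂ}
    (h : RTT T T' (PowerSeries.C z)) : RTT T T' z := by
  intro i j k l
  rw [h i j k l, C_series_smul]

theorem exchange_Tmat : Exchange fun l : List (Fin m) =>
    (l.map (shifted (Tmat N))).prod := by
  refine exchange_prod (fun a => (Tmat N).map (evalAt (linInv 1 (-((a : ℕ) : ℂ))))) ?_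
  intro a b hab
  have hb : (-(a : ℂ)) - (-(b : ℂ)) ≠ 0 := by
    have := cast_sub_ne_zero hab.ne
    rwa [neg_sub_neg]
  refine rtt_ℂ_of_C (rtt_evalAt (constantCoeff_linInv _ _) (constantCoeff_linInv _ _)
    (linInv_ne_zero one_ne_zero _) (linInv_ne_zero one_ne_zero _) ?_)
  rw [mul_comm (linInv 1 (-((a : ℕ) : ℂ))), ← linInv_sub_same one_ne_zero hb, neg_sub_neg]

theorem fstCopy_one : fstCopy (1 : Matrix (Idx N) (Idx N) A) = 1 := by
  ext ⟨i, k⟩ ⟨j, l⟩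
  simp only [fstCopy, Matrix.of_apply, Matrix.one_apply, Prod.mk.injEq]
  split_ifs <;> simp_all

theorem sndCopy_one : sndCopy (1 : Matrix (Idx N) (Idx N) A) = 1 := by
  ext ⟨i, k⟩ ⟨j, l⟩
  simp only [sndCopy, Matrix.of_apply, Matrix.one_apply, Prod.mk.injEq]
  split_ifs <;> simp_all

/-- `P` and `Q` commute, so the identity matrix solves the reflection equation. Hence the exchange
argument also applies to the bare product of the `Rᵗ`, from which `γ` is computed. -/
theorem reflection_one (c : Kind) (α β : ℂ⟦X⟧) :
    Reflection c (1 : Matrix (Idx N) (Idx N) A⟦X⟧) 1 α β := by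
  rw [← reflection_two_iff, fstCopy_one, sndCopy_one, mul_one, one_mul]
  simp only [sub_mul, mul_add, mul_sub, add_mul, one_mul, mul_one, smul_mul_assoc, mul_smul_comm,
    flipMat_mul_qMat, qMat_mul_flipMat, smul_add, smul_sub]
  rw [smul_comm β α]
  abel

theorem onCopy_one (a : Fin m) : onCopy a (1 : Matrix (Idx N) (Idx N) A) = 1 := by
  ext x y
  simp only [onCopy, Matrix.of_apply, Matrix.one_apply]
  by_cases h : x = y
  · simp [h]
  · rw [if_neg h]
    split_ifs with h1 h2
    · exfalso; apply h; funext d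
      by_cases hd : d = a
      · rw [hd, h2]
      · exact h1 d hd
    · rfl
    · rfl

theorem exchange_word_one (c : Kind) (hc : c = .symplectic → Even N) :
    Exchange (word (Rt c) fun _ =>
      (1 : Matrix (Fin m → Idx N) (Fin m → Idx N) A⟦X⟧)) := by
  have h := exchange_word (m := m) c hc (fun _ => (1 : Matrix (Idx N) (Idx N) A⟦X⟧))
    fun a b _ => reflection_one c _ _
  simpa only [onCopy_one] using h

end Brackets

/-! ### Existence and uniqueness of the two determinants. -/

section Maps

variable {N m : ℕ}

theorem map_word {ι M M' : Type*} [Monoid M] [Monoid M'] (f : M →* M') (R : ι → ι → M)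
    (σ : ι → M) (l : List ι) :
    f (word R σ l) = word (fun a b => f (R a b)) (fun a => f (σ a)) l := by
  induction l with
  | nil => exact map_one f
  | cons p ps ih =>
    rw [word, word, map_mul, map_mul, ih, map_list_prod, List.map_map]
    rfl

theorem map_antisym {B B' : Type*} [Ring B] [Ring B'] (f : B →+* B') :
    (antisym N m B).map f = antisym N m B' := by
  ext x y
  simp only [antisym, Matrix.map_apply, Matrix.of_apply, map_sum, apply_ite f, map_intCast,
    map_zero]

theorem map_onCopy {B B' : Type*} [Ring B] [Ring B'] (f : B →+* B') (a : Fin m)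
    (M : Matrix (Idx N) (Idx N) B) : (onCopy a M).map f = onCopy a (M.map f) := by
  ext x y
  simp only [onCopy, Matrix.map_apply, Matrix.of_apply, apply_ite f, map_zero]

theorem map_onCopies {B B' : Type*} [Ring B] [Ring B'] (f : B →+* B') (a b : Fin m)
    (M : Matrix (Idx N × Idx N) (Idx N × Idx N) B) :
    (onCopies a b M).map f = onCopies a b (M.map f) := by
  ext x y
  simp only [onCopies, Matrix.map_apply, Matrix.of_apply, apply_ite f, map_zero]

theorem map_mul_scalar {ι B B' : Type*} [Fintype ι] [DecidableEq ι] [Ring B] [Ring B']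
    (f : B →+* B') (M : Matrix ι ι B) (q : B) :
    (M * Matrix.scalar ι q).map f = M.map f * Matrix.scalar ι (f q) := by
  rw [Matrix.map_mul]
  congr 1
  simp [Matrix.scalar_apply, Matrix.diagonal_map]

variable {A : Type*} [Ring A] [Algebra ℂ A]

theorem Rt_map_constantCoeff (c : Kind) (a b : Fin m) :
    (Rt c a b : Matrix (Fin m → Idx N) (Fin m → Idx N) A⟦X⟧).map constantCoeff = 1 := by
  rw [Rt, Matrix.map_sub _ (map_sub _), map_onCopies, Matrix.map_map]
  have : (Qmat c N).map (⇑(constantCoeff (R := A)) ∘ fun z => scalarSeries A (PowerSeries.C z *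
      linInv (-2) (((a : ℕ) : ℂ) + ((b : ℕ) : ℂ)))) = 0 := by
    ext x y
    simp only [Matrix.map_apply, Function.comp_apply, scalarSeries, Matrix.zero_apply]
    rw [← coeff_zero_eq_constantCoeff_apply, coeff_map, coeff_zero_eq_constantCoeff_apply, map_mul,
      constantCoeff_linInv, mul_zero, map_zero]
  rw [this]
  have h0 : onCopies (min a b) (max a b) (0 : Matrix (Idx N × Idx N) (Idx N × Idx N) A) = 0 := by
    ext x y; simp [onCopies]
  rw [h0, sub_zero, Matrix.map_one _ (map_zero _) (map_one _)]

theorem shifted_map_constantCoeff (a : Fin m) {M : Matrix (Idx N) (Idx N) A⟦X⟧}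
    (hM : M.map constantCoeff = 1) : (shifted M a).map constantCoeff = 1 := by
  rw [shifted, map_onCopy, Matrix.map_map]
  have : M.map (⇑(constantCoeff (R := A)) ∘ atLin 1 (-((a : ℕ) : ℂ))) = 1 := by
    rw [← hM]
    ext i j
    simp only [Matrix.map_apply, Function.comp_apply, atLin_eq, constantCoeff_evalAt]
  rw [this, onCopy_one]

theorem Tmat_map_constantCoeff : (Tmat N).map constantCoeff = 1 := by
  ext i j
  rw [Matrix.map_apply, Tmat, Matrix.of_apply, ← coeff_zero_eq_constantCoeff_apply, coeff_mk, gen,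
    Matrix.one_apply, apply_ite (RingQuot.mkAlgHom ℂ (YangianRel N)), map_one, map_zero]

theorem Smat_map_constantCoeff (c : Kind) : (Smat c N).map constantCoeff = 1 := by
  ext i j
  rw [Matrix.map_apply, Smat, Matrix.of_apply, ← coeff_zero_eq_constantCoeff_apply, coeff_mk, gen,
    Matrix.one_apply, apply_ite (RingQuot.mkAlgHom ℂ (TwistedRel c N)), map_one, map_zero]

/-- Modulo `u⁻¹` the equation becomes `A = A q₀`, and an entry of `A` equal to `1` gives `q₀ = 1`.
-/
theorem constantCoeff_eq_one {G : Matrix (Fin N → Idx N) (Fin N → Idx N) A⟦X⟧} {q : A⟦X⟧}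
    (hG : G.map constantCoeff = 1)
    (h : antisym N N A⟦X⟧ * G = antisym N N A⟦X⟧ * Matrix.scalar (Fin N → Idx N) q) :
    constantCoeff q = 1 := by
  have h1 := congrArg (fun M => M.map constantCoeff) h
  beta_reduce at h1
  rw [map_mul_scalar, Matrix.map_mul, map_antisym, hG, mul_one] at h1
  refine antisym_mul_scalar_injective (N := N) (h1.symm.trans ?_)
  simp

theorem exists_isQdet (N : ℕ) : ∃ q, IsQdet (Tmat N) q := by
  obtain ⟨q, h1, h2⟩ := (exchange_Tmat (N := N) (m := N)).exists_det
  refine ⟨q, constantCoeff_eq_one ?_ h1, h1, h2⟩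
  have e := map_list_prod (constantCoeff (R := Yangian N)).mapMatrix
    ((List.finRange N).map (shifted (Tmat N)))
  rw [RingHom.mapMatrix_apply] at e
  rw [e, List.map_map]
  refine List.prod_eq_one fun x hx => ?_
  rw [List.mem_map] at hx
  obtain ⟨a, _, rfl⟩ := hx
  exact shifted_map_constantCoeff a Tmat_map_constantCoeff

theorem word_one {ι M : Type*} [Monoid M] (l : List ι) :
    word (fun _ _ : ι => (1 : M)) (fun _ => 1) l = 1 := by
  induction l with
  | nil => rfl
  | cons p ps ih => simp [word, ih]

theorem exists_isSdet (c : Kind) (N : ℕ) (hc : c = .symplectic → Even N) :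
    ∃ d, IsSdet c (Smat c N) d := by
  obtain ⟨q, h1, h2⟩ := (exchange_bracket (N := N) (m := N) c hc).exists_det
  refine ⟨q, constantCoeff_eq_one ?_ h1, h1, h2⟩
  rw [bracket_eq_word]
  have e := map_word (constantCoeff (R := TwistedYangian c N)).mapMatrix.toMonoidHom (Rt c)
    (shifted (m := N) (Smat c N)) (List.finRange N)
  refine e.trans ?_
  rw [← word_one (M := Matrix (Fin N → Idx N) (Fin N → Idx N) (TwistedYangian c N))
    (List.finRange N)]
  congr 1
  · funext a b; exact Rt_map_constantCoeff c a b
  · funext a; exact shifted_map_constantCoeff a (Smat_map_constantCoeff c)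

theorem isQdet_unique {T : Matrix (Idx N) (Idx N) A⟦X⟧} {q q' : A⟦X⟧} (h : IsQdet T q)
    (h' : IsQdet T q') : q = q' :=
  antisym_mul_scalar_injective (h.2.1.symm.trans h'.2.1)

theorem isSdet_unique {c : Kind} {S : Matrix (Idx N) (Idx N) A⟦X⟧} {d d' : A⟦X⟧}
    (h : IsSdet c S d) (h' : IsSdet c S d') : d = d' :=
  antisym_mul_scalar_injective (h.2.1.symm.trans h'.2.1)

end Maps

end TwYang

end

/-! ### The homomorphism `S(u) ↦ T(u) Tᵗ(-u)`. -/

noncomputable section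

namespace TwYang

open Finset Matrix PowerSeries

attribute [local instance] seriesAlgebra

section TwoCopies

variable {N : ℕ} {K B : Type*} [CommRing K] [Ring B] [Algebra K B]

theorem fstCopy_mul (M M' : Matrix (Idx N) (Idx N) B) :
    fstCopy (M * M') = fstCopy M * fstCopy M' := by
  ext ⟨i, k⟩ ⟨j, l⟩
  rw [fstCopy_mul_apply]
  simp only [fstCopy, Matrix.of_apply, Matrix.mul_apply]
  split_ifs <;> simp

theorem sndCopy_mul (M M' : Matrix (Idx N) (Idx N) B) :
    sndCopy (M * M') = sndCopy M * sndCopy M' := by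
  ext ⟨i, k⟩ ⟨j, l⟩
  rw [sndCopy_mul_apply]
  simp only [sndCopy, Matrix.of_apply, Matrix.mul_apply]
  split_ifs <;> simp

theorem flipMat_mul_flipMat : flipMat N B * flipMat N B = 1 := by
  ext x y
  rw [flipMat_mul_apply, flipMat, Matrix.of_apply, Prod.swap_swap, Matrix.one_apply]

theorem flipMat_mul_fstCopy (M : Matrix (Idx N) (Idx N) B) :
    flipMat N B * fstCopy M = sndCopy M * flipMat N B := by
  ext x y
  rw [flipMat_mul_apply, mul_flipMat_apply]
  rfl

theorem flipMat_mul_sndCopy (M : Matrix (Idx N) (Idx N) B) :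
    flipMat N B * sndCopy M = fstCopy M * flipMat N B := by
  ext x y
  rw [flipMat_mul_apply, mul_flipMat_apply]
  rfl

theorem flipMat_commute (c : Kind) (β : K) :
    flipMat N B * (1 + β • qMat c N B) = (1 + β • qMat c N B) * flipMat N B := by
  simp only [mul_add, add_mul, one_mul, mul_one, smul_mul_assoc, mul_smul_comm,
    flipMat_mul_qMat, qMat_mul_flipMat]

/-- Intended for `T(u)`, `T(v)`, `T(-u)`, `T(-v)` in the roles of `T`, `T'`, `U`, `U'`: then `1 /
(-u - v) = -β` and `1 / (-v + u) = α`. The two partially transposed relations bring the untransposed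
factors together and later separate the factors again; in between, `R` passes the pair `T`, `T'`,
then `Rᵗ`, then the transposed pair. -/
theorem reflection_of_rtt (c : Kind) (hc : c = .symplectic → Even N)
    {T T' U U' : Matrix (Idx N) (Idx N) B} {α β : K} (h : RTT T T' α)
    (h1 : RTT U T' (-β)) (h2 : RTT U' T (-β)) (h3 : RTT U' U α) :
    Reflection c (T * twT c U) (T' * twT c U') α β := by
  rw [← reflection_two_iff, fstCopy_mul, sndCopy_mul]
  have e := rtt_two h
  have e1 := rtt_two_twT c hc h1
  have e2 := rtt_two_twT c hc h2
  have e3 := rtt_two (rtt_twT c h3)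
  rw [neg_smul, sub_neg_eq_add] at e1 e2
  have hFF := flipMat_mul_flipMat (N := N) (B := B)
  have hF1 := flipMat_mul_fstCopy (N := N) (B := B)
  have hF2 := flipMat_mul_sndCopy (N := N) (B := B)
  have hk := flipMat_commute (N := N) (B := B) c β
  -- `rtt_two_twT` puts the transposed matrix in the first copy; conjugation by the flip moves it to
  -- the second.
  have e2' : fstCopy T * ((1 + β • qMat c N B) * sndCopy (twT c U'))
      = sndCopy (twT c U') * ((1 + β • qMat c N B) * fstCopy T) := by
    have h4 := congrArg (fun M => flipMat N B * M * flipMat N B) e2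
    beta_reduce at h4
    have t1 : ∀ M M' : Matrix (Idx N) (Idx N) B,
        flipMat N B * (fstCopy M * ((1 + β • qMat c N B) * sndCopy M')) * flipMat N B
          = sndCopy M * ((1 + β • qMat c N B) * fstCopy M') := by
      intro M M'
      rw [← mul_assoc, hF1, mul_assoc, mul_assoc, ← mul_assoc _ (_ * _) _, ← mul_assoc _ _ (sndCopy _),
        hk, mul_assoc _ _ (sndCopy M'), hF2]
      simp only [mul_assoc, hFF, mul_one]
    have t2 : ∀ M M' : Matrix (Idx N) (Idx N) B,
        flipMat N B * (sndCopy M * ((1 + β • qMat c N B) * fstCopy M')) * flipMat N B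
          = fstCopy M * ((1 + β • qMat c N B) * sndCopy M') := by
      intro M M'
      rw [← mul_assoc, hF2, mul_assoc, mul_assoc, ← mul_assoc _ (_ * _) _, ← mul_assoc _ _ (fstCopy _),
        hk, mul_assoc _ _ (fstCopy M'), hF1]
      simp only [mul_assoc, hFF, mul_one]
    rw [t1, t2] at h4
    exact h4.symm
  have hrk : (1 - α • flipMat N B) * (1 + β • qMat c N B)
      = (1 + β • qMat c N B) * (1 - α • flipMat N B) := by
    rw [sub_mul, mul_sub, one_mul, mul_one, smul_mul_assoc, mul_smul_comm, hk]
  generalize 1 - α • flipMat N B = r at *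
  generalize 1 + β • qMat c N B = k at *
  generalize fstCopy T = T1 at *
  generalize sndCopy T' = T2 at *
  generalize fstCopy (twT c U) = U1 at *
  generalize sndCopy (twT c U') = U2 at *
  calc r * (T1 * U1 * (k * (T2 * U2))) = r * T1 * (U1 * (k * T2)) * U2 := by
        simp only [mul_assoc]
    _ = r * (T1 * T2) * k * (U1 * U2) := by rw [e1]; simp only [mul_assoc]
    _ = T2 * T1 * (r * k) * (U1 * U2) := by rw [e]; simp only [mul_assoc]
    _ = T2 * T1 * k * (r * (U1 * U2)) := by rw [hrk]; simp only [mul_assoc]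
    _ = T2 * (T1 * (k * U2)) * U1 * r := by rw [e3]; simp only [mul_assoc]
    _ = T2 * U2 * (k * (T1 * U1)) * r := by rw [e2']; simp only [mul_assoc]

/-- The two products contain the same entries in opposite orders. After the substitution `a ↦ -a`,
the commutators given by `hrtt` reassemble into the difference of the two matrices. For `U = T(-u)`
the scalar `h` is `1 / (2u)`. -/
theorem smul_mul_twT_eq (c : Kind) (hc : c = .symplectic → Even N)
    {T U : Matrix (Idx N) (Idx N) B} {h : K} (hrtt : RTT U T (-h)) (i j : Idx N) :
    θ c i j • (U * twT c T) (-j) (-i) = (T * twT c U) i j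
      + ((c.sgn : K) * h) • ((T * twT c U) i j - (U * twT c T) i j) := by
  have e1 : ∀ (T U : Matrix (Idx N) (Idx N) B) i j, (T * twT c U) i j
      = ∑ a, (eps c (-j) * eps c (-a)) • (T i a * U (-j) (-a)) := by
    intro T U i j
    rw [Matrix.mul_apply]
    refine sum_congr rfl fun a _ => ?_
    rw [twT_apply, mul_smul_comm]
  have e3 : θ c i j • (U * twT c T) (-j) (-i)
      = ∑ a, (eps c (-j) * eps c (-a)) • (U (-j) (-a) * T i a) := by
    rw [e1, smul_sum, ← Equiv.sum_comp (Equiv.neg (Idx N))]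
    refine sum_congr rfl fun a _ => ?_
    simp only [Equiv.neg_apply, neg_neg, smul_smul, θ_eq]
    congr 1
    rw [eps_neg c j, eps_neg c a]
    linear_combination (eps c j * eps c a) * eps_mul_self c hc i
      - (eps c j * eps c a) * c.sgn_mul_self
  have e4 : ∀ a, U (-j) (-a) * T i a = T i a * U (-j) (-a)
      - h • (U i (-a) * T (-j) a - T i (-a) * U (-j) a) := by
    intro a
    have := hrtt (-j) (-a) i a
    rw [sub_eq_iff_eq_add] at this
    rw [this, neg_smul]
    abel
  have e5 : ∑ a, (eps c (-j) * eps c (-a)) • (U i (-a) * T (-j) a - T i (-a) * U (-j) a)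
      = c.sgn • ((U * twT c T) i j - (T * twT c U) i j) := by
    rw [e1, e1, ← sum_sub_distrib, smul_sum, ← Equiv.sum_comp (Equiv.neg (Idx N))]
    refine sum_congr rfl fun a _ => ?_
    simp only [Equiv.neg_apply, neg_neg]
    rw [← smul_sub, smul_smul]
    congr 1
    rw [eps_neg c a]
    linear_combination (-eps c (-j) * eps c a) * c.sgn_mul_self
  rw [e3]
  simp only [e4, smul_sub (_ : ℤ) (_ * _) (h • _), smul_comm (_ : ℤ) h]
  rw [sum_sub_distrib, ← e1, ← smul_sum, e5, ← Int.cast_smul_eq_zsmul K, smul_smul, mul_comm h,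
    sub_eq_add_neg, ← smul_neg, neg_sub]

end TwoCopies

section Embedding

variable {N : ℕ} {A : Type*} [Ring A] [Algebra ℂ A]

/-- The matrix `T(u) T^t(-u)`. -/
def embMat (c : Kind) (N : ℕ) : Matrix (Idx N) (Idx N) (PowerSeries (Yangian N)) :=
  Tmat N * twT c ((Tmat N).map (atLin (-1) 0))

theorem linInv_neg_one_zero : linInv (-1) 0 = -X := by
  symm
  apply linInv_unique (by norm_num)
  simp

theorem evalAt_neg {p : ℂ⟦X⟧} (f : A⟦X⟧) : evalAt p (-f) = -evalAt p f := by
  ext m; simp [evalAt]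

theorem map_evalAt_mul {p : ℂ⟦X⟧} (hp : constantCoeff p = 0)
    (M M' : Matrix (Idx N) (Idx N) A⟦X⟧) :
    (M * M').map (evalAt p) = M.map (evalAt p) * M'.map (evalAt p) :=
  Matrix.map_mul (f := evalHom A hp)

theorem map_twT {B B' : Type*} [Ring B] [Ring B'] (c : Kind) (f : B →+* B')
    (M : Matrix (Idx N) (Idx N) B) : (twT c M).map f = twT c (M.map f) := by
  ext i j
  simp only [Matrix.map_apply, twT, Matrix.of_apply, map_zsmul]

theorem embMat_map_evalAt (c : Kind) {p : ℂ⟦X⟧} (hp : constantCoeff p = 0) :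
    (embMat c N).map (evalAt p)
      = (Tmat N).map (evalAt p) * twT c ((Tmat N).map (evalAt (-p))) := by
  rw [embMat, map_evalAt_mul hp]
  congr 1
  have := map_twT c (evalHom (Yangian N) hp) ((Tmat N).map (atLin (-1) 0))
  refine this.trans ?_
  congr 1
  ext i j : 2
  simp only [Matrix.map_apply, atLin_eq, evalHom_apply]
  rw [evalAt_evalAt hp (constantCoeff_linInv _ _), linInv_neg_one_zero, evalAt_neg, evalAt_X hp]

theorem reflection_embMat (c : Kind) (hc : c = .symplectic → Even N) {p q α β : ℂ⟦X⟧}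
    (hp : constantCoeff p = 0) (hq : constantCoeff q = 0) (hp0 : p ≠ 0) (hq0 : q ≠ 0)
    (hα : α * (q - p) = p * q) (hβ : β * (p + q) = p * q) :
    Reflection c ((embMat c N).map (evalAt p)) ((embMat c N).map (evalAt q)) α β := by
  have hp' : constantCoeff (-p) = 0 := by rw [map_neg, hp, neg_zero]
  have hq' : constantCoeff (-q) = 0 := by rw [map_neg, hq, neg_zero]
  rw [embMat_map_evalAt c hp, embMat_map_evalAt c hq]
  apply reflection_of_rtt c hc
  · exact rtt_evalAt hp hq hp0 hq0 hα
  · exact rtt_evalAt hp' hq (neg_ne_zero.2 hp0) hq0 (by linear_combination -hβ)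
  · exact rtt_evalAt hq' hp (neg_ne_zero.2 hq0) hp0 (by linear_combination -hβ)
  · exact rtt_evalAt hq' hp' (neg_ne_zero.2 hq0) (neg_ne_zero.2 hp0) (by linear_combination hα)

theorem embMat_symm (c : Kind) (hc : c = .symplectic → Even N) (i j : Idx N) :
    θ c i j • evalAt (-X) (embMat c N (-j) (-i))
      = embMat c N i j + (PowerSeries.C (c.pm / 2) * X : ℂ⟦X⟧) •
        (embMat c N i j - evalAt (-X) (embMat c N i j)) := by
  have hX : constantCoeff (-X : ℂ⟦X⟧) = 0 := by simp
  have hX0 : constantCoeff (X : ℂ⟦X⟧) = 0 := by simp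
  have hn0 : (-X : ℂ⟦X⟧) ≠ 0 := neg_ne_zero.2 X_ne_zero
  -- For the arguments `-u` and `u` the scalar is `1 / (-u - u)`, that is, `-X / 2`.
  have hrtt := rtt_evalAt (N := N) (p := -X) (q := X) (α := -(PowerSeries.C (1 / 2) * X)) hX hX0
    hn0 X_ne_zero (by
      have : PowerSeries.C (1 / 2 : ℂ) * 2 = 1 := by
        rw [← map_ofNat PowerSeries.C, ← map_mul]; norm_num
      linear_combination -X ^ 2 * this)
  have hT : (Tmat N).map (evalAt X) = Tmat N :=
    Matrix.ext fun i j => evalAt_X_left (Tmat N i j)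
  have hemb : embMat c N = Tmat N * twT c ((Tmat N).map (evalAt (-X))) := by
    rw [embMat, ← linInv_neg_one_zero]; rfl
  have hneg := embMat_map_evalAt (N := N) c hX
  rw [neg_neg, hT] at hneg
  rw [hT] at hrtt
  have e6 : PowerSeries.C (c.pm / 2) = (c.sgn : ℂ⟦X⟧) * PowerSeries.C (1 / 2) := by
    cases c
    · simp [Kind.pm, Kind.sgn]
    · simp only [Kind.pm, Kind.sgn, neg_div, map_neg, Int.cast_neg, Int.cast_one, neg_mul, one_mul]
  have key := smul_mul_twT_eq c hc hrtt i j
  rw [← hneg, ← hemb] at key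
  rw [e6, mul_assoc]
  exact key

theorem zcoeff_add (f g : A⟦X⟧) (r : ℤ) : zcoeff (f + g) r = zcoeff f r + zcoeff g r := by
  unfold zcoeff; split_ifs <;> simp

theorem zcoeff_sub (f g : A⟦X⟧) (r : ℤ) : zcoeff (f - g) r = zcoeff f r - zcoeff g r := by
  unfold zcoeff; split_ifs <;> simp

theorem zcoeff_zsmul (z : ℤ) (f : A⟦X⟧) (r : ℤ) : zcoeff (z • f) r = z • zcoeff f r := by
  unfold zcoeff
  split_ifs
  · simp
  · exact map_zsmul _ _ _

theorem zcoeff_C_mul_X_smul (z : ℂ) (f : A⟦X⟧) (r : ℤ) :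
    zcoeff ((PowerSeries.C z * X : ℂ⟦X⟧) • f) r = z • zcoeff f (r - 1) := by
  rw [mul_smul, C_series_smul, X_series_smul]
  unfold zcoeff
  rcases lt_trichotomy r 0 with h | rfl | h
  · rw [if_pos h, if_pos (by omega), smul_zero]
  · simp
  · obtain ⟨n, rfl⟩ : ∃ n : ℕ, r = n + 1 := ⟨(r - 1).toNat, by omega⟩
    rw [if_neg (by omega), if_neg (by omega)]
    have e1 : ((n : ℤ) + 1).toNat = n + 1 := by omega
    have e2 : ((n : ℤ) + 1 - 1).toNat = n := by omega
    rw [e1, e2, coeff_smul, coeff_succ_X_mul]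

theorem zcoeff_evalAt_neg_X (f : A⟦X⟧) (r : ℤ) :
    zcoeff (evalAt (-X) f) r = (-1 : ℂ) ^ r • zcoeff f r := by
  unfold zcoeff
  split_ifs with h
  · simp
  · obtain ⟨n, rfl⟩ := Int.eq_ofNat_of_zero_le (not_lt.1 h)
    rw [Int.toNat_natCast, zpow_natCast, evalAt, coeff_mk, sum_eq_single n]
    · rw [neg_pow, ← map_one PowerSeries.C, ← map_neg, ← map_pow, coeff_C_mul, coeff_X_pow_self,
        mul_one]
    · intro k _ hk
      rw [neg_pow, ← map_one PowerSeries.C, ← map_neg, ← map_pow, coeff_C_mul, coeff_X_pow,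
        if_neg hk.symm, mul_zero, zero_smul]
    · simp

theorem twT_one (c : Kind) (hc : c = .symplectic → Even N) :
    twT c (1 : Matrix (Idx N) (Idx N) A) = 1 := by
  ext i j
  rw [twT, Matrix.of_apply, θ_eq, Matrix.one_apply, Matrix.one_apply]
  by_cases h : i = j
  · subst h; rw [if_pos rfl, if_pos rfl, eps_mul_self c hc, one_smul]
  · rw [if_neg h, if_neg fun e => h (neg_injective e).symm, smul_zero]

theorem embMat_map_constantCoeff (c : Kind) (hc : c = .symplectic → Even N) :
    (embMat c N).map constantCoeff = 1 := by
  rw [embMat, Matrix.map_mul, Tmat_map_constantCoeff, one_mul, map_twT, Matrix.map_map]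
  have : (Tmat N).map (⇑(constantCoeff (R := Yangian N)) ∘ atLin (-1) 0) = 1 := by
    rw [← Tmat_map_constantCoeff]
    ext i j
    simp only [Matrix.map_apply, Function.comp_apply, atLin_eq, constantCoeff_evalAt]
  rw [this, twT_one c hc]

/-- The homomorphism from the free algebra with `s_{ij}^{(r)} ↦ T(u) T^t(-u)`. -/
def freeEmb (c : Kind) (N : ℕ) : FreeAlg N →ₐ[ℂ] Yangian N :=
  FreeAlgebra.lift ℂ fun x : Idx N × Idx N × ℕ => coeff (x.2.2 + 1) (embMat c N x.1 x.2.1)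

theorem freeEmb_genZ (c : Kind) (hc : c = .symplectic → Even N) (i j : Idx N) (r : ℤ) :
    freeEmb c N (genZ i j r) = zcoeff (embMat c N i j) r := by
  unfold genZ zcoeff
  split_ifs
  · exact map_zero _
  · cases r.toNat with
    | zero =>
      have := congrFun (congrFun (embMat_map_constantCoeff c hc) i) j
      rw [Matrix.map_apply] at this
      rw [coeff_zero_eq_constantCoeff_apply, this, gen, Matrix.one_apply, apply_ite (freeEmb c N),
        map_one, map_zero]
    | succ n => simp [gen, freeEmb]

theorem freeEmb_rel (c : Kind) (hc : c = .symplectic → Even N) {x y : FreeAlg N}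
    (h : TwistedRel c N x y) : freeEmb c N x = freeEmb c N y := by
  cases h with
  | quat i j k l r s =>
    -- The indices of `quatDefect` exceed those of the quaternary relation by two.
    have hd := quatDefect_eq_zero c (embMat c N) (fun a h0 h1 h2 => by
      have h1' : a - 1 ≠ 0 := sub_ne_zero.2 h1
      have h2' : a + 1 ≠ 0 := fun h => h2 (eq_neg_of_add_eq_zero_left h)
      have hT : (embMat c N).map (evalAt X) = embMat c N :=
        Matrix.ext fun i j => evalAt_X_left _
      have := reflection_embMat c hc (p := X) (q := PowerSeries.C a * X)
        (α := PowerSeries.C (a / (a - 1)) * X) (β := PowerSeries.C (a / (a + 1)) * X)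
        (by simp) (by simp) X_ne_zero (mul_ne_zero (by simpa using h0) X_ne_zero) (by
          have : (PowerSeries.C a : ℂ⟦X⟧) = PowerSeries.C (a / (a - 1)) * (PowerSeries.C a - 1) := by
            rw [← map_one PowerSeries.C, ← map_sub, ← map_mul, div_mul_cancel₀ _ h1']
          linear_combination (-X ^ 2) * this) (by
          have : (PowerSeries.C a : ℂ⟦X⟧) = PowerSeries.C (a / (a + 1)) * (PowerSeries.C a + 1) := by
            rw [← map_one PowerSeries.C, ← map_add, ← map_mul, div_mul_cancel₀ _ h2']
          linear_combination (-X ^ 2) * this)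
      rwa [hT] at this) i j k l (r + 2) (s + 2)
    have e1 : ∀ r : ℤ, r + 2 - 2 = r := fun r => by ring
    have e2 : ∀ r : ℤ, r + 2 - 1 = r + 1 := fun r => by ring
    simp only [quatDefect, e1, e2, Nat.cast_zero, sub_zero, Nat.cast_ofNat, Nat.cast_one] at hd
    simp only [map_add, map_sub, map_mul, map_zsmul, Ring.lie_def, freeEmb_genZ c hc]
    exact sub_eq_zero.1 hd
  | symm i j r =>
    have h := congrArg (fun f => zcoeff f r) (embMat_symm c hc i j)
    beta_reduce at h
    rw [zcoeff_zsmul, zcoeff_evalAt_neg_X, zcoeff_add, zcoeff_C_mul_X_smul, zcoeff_sub,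
      zcoeff_evalAt_neg_X] at h
    simp only [map_add, map_sub, map_zsmul, map_smul, freeEmb_genZ c hc]
    exact h

theorem isEmb_iff (c : Kind) (hc : c = .symplectic → Even N)
    (φ : TwistedYangian c N →ₐ[ℂ] Yangian N) :
    IsEmb φ ↔ φ.comp (RingQuot.mkAlgHom ℂ (TwistedRel c N)) = freeEmb c N := by
  have e : ∀ i j r, coeff r (PowerSeries.map (φ : TwistedYangian c N →+* Yangian N)
      (Smat c N i j)) = φ (RingQuot.mkAlgHom ℂ (TwistedRel c N) (gen i j r)) := by
    intro i j r
    rw [coeff_map, Smat, Matrix.of_apply, coeff_mk]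
    rfl
  have e' : ∀ i j (r : ℕ), freeEmb c N (gen i j r) = coeff r (embMat c N i j) := by
    intro i j r
    rw [← genZ_natCast, freeEmb_genZ c hc, zcoeff_natCast]
  constructor
  · intro h
    ext ⟨i, j, r⟩
    have h1 := congrFun (congrFun h i) j
    rw [Matrix.map_apply] at h1
    have h2 := e i j (r + 1)
    rw [h1] at h2
    exact h2.symm.trans (e' i j (r + 1)).symm
  · intro h
    refine Matrix.ext fun i j => PowerSeries.ext fun r => ?_
    rw [Matrix.map_apply, e]
    exact (congrArg (fun ψ => ψ (gen i j r)) h).trans (e' i j r)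

theorem existsUnique_isEmb (c : Kind) (hc : c = .symplectic → Even N) :
    ∃! φ : TwistedYangian c N →ₐ[ℂ] Yangian N, IsEmb φ := by
  refine ⟨RingQuot.liftAlgHom ℂ ⟨freeEmb c N, fun _ _ h => freeEmb_rel c hc h⟩, ?_, ?_⟩
  · change IsEmb _
    rw [isEmb_iff c hc]
    ext x
    simp
  · intro φ h
    rw [isEmb_iff c hc] at h
    apply RingQuot.ringQuot_ext'
    rw [h]
    ext x
    simp

end Embedding

end TwYang

end

/-! ### The product of the `Rᵗ` and the factor `γ`. -/

noncomputable section

namespace TwYang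

open Finset Matrix PowerSeries

attribute [local instance] seriesAlgebra

section ScalarWord

variable {N m : ℕ} {K B : Type*} [CommRing K] [Ring B] [Algebra K B] [Algebra ℂ B]

/-- On columns, `Q_{ab}` sees only opposite entries at `a` and `b`, and spreads them over all
opposite pairs. The evaluation of `γ` follows one column through the product by this rule. -/
theorem mul_onCopies_qMat_apply (c : Kind) {a b : Fin m} (hab : a ≠ b)
    (M : Matrix (Fin m → Idx N) (Fin m → Idx N) B) (x y : Fin m → Idx N) :
    (M * onCopies a b (qMat c N B)) x y = if y a = -y b then
      ∑ n, (eps c n * eps c (y b)) • M x (Function.update (Function.update y a (-n)) b n)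
      else 0 := by
  rw [Matrix.mul_apply, sum_eq_sum_update hab y, Fintype.sum_prod_type, sum_comm]
  · have h1 : ∀ u v : Idx N, ∀ d, d ≠ a → d ≠ b →
        Function.update (Function.update y a u) b v d = y d := by
      intro u v d h1 h2; simp [h1, h2]
    have h2 : ∀ u v : Idx N, onCopies a b (qMat c N B)
        (Function.update (Function.update y a u) b v) y
        = if u = -v ∧ y a = -y b then (eps c v * eps c (y b)) • (1 : B) else 0 := by
      intro u v
      rw [onCopies, Matrix.of_apply, if_pos (h1 u v), qMat, Matrix.of_apply, Function.update_self,
        Function.update_of_ne hab, Function.update_self]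
    simp only [h2]
    split_ifs with h
    · refine sum_congr rfl fun n _ => ?_
      rw [sum_eq_single (-n)]
      · rw [if_pos ⟨rfl, h⟩, mul_smul_comm, mul_one]
      · intro u _ hu
        rw [if_neg fun h => hu h.1, mul_zero]
      · simp
    · refine sum_eq_zero fun n _ => sum_eq_zero fun u _ => ?_
      rw [if_neg fun h' => h h'.2, mul_zero]
  · intro z hz
    rw [onCopies, Matrix.of_apply, if_neg, mul_zero]
    intro h
    exact hz fun d h1 h2 => (h d h1 h2).symm

variable {c : Kind} {r : ℕ → ℕ → K}
  {R : Fin m → Fin m → Matrix (Fin m → Idx N) (Fin m → Idx N) B}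

theorem mul_apply_of_ne (hR : ∀ a b, R a b = 1 - r a b • onCopies a b (qMat c N B))
    {a b : Fin m} (hab : a ≠ b) (M : Matrix (Fin m → Idx N) (Fin m → Idx N) B)
    (x : Fin m → Idx N) {y : Fin m → Idx N} (hy : y a ≠ -y b) : (M * R a b) x y = M x y := by
  rw [hR, mul_sub, mul_one, mul_smul_comm, Matrix.sub_apply, Matrix.smul_apply,
    mul_onCopies_qMat_apply c hab, if_neg hy, smul_zero, sub_zero]

theorem mul_prod_apply_of_ne (hR : ∀ a b, R a b = 1 - r a b • onCopies a b (qMat c N B))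
    {p : Fin m} (x : Fin m → Idx N) {y : Fin m → Idx N} (l : List (Fin m))
    (hl : ∀ q ∈ l, q ≠ p ∧ y q ≠ -y p) : ∀ M : Matrix (Fin m → Idx N) (Fin m → Idx N) B,
    (M * (l.map fun q => R q p).prod) x y = M x y := by
  induction l with
  | nil => intro M; simp
  | cons q l ih =>
    intro M
    rw [List.map_cons, List.prod_cons, ← mul_assoc, ih fun q hq => hl q (by simp [hq])]
    have := hl q (by simp)
    exact mul_apply_of_ne hR this.1 M x this.2

theorem mul_apply_eq_zero (hR : ∀ a b, R a b = 1 - r a b • onCopies a b (qMat c N B))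
    {p q a b : Fin m} (hab : a ≠ b) (h1 : p ≠ a) (h2 : p ≠ b) (h3 : q ≠ a) (h4 : q ≠ b)
    {M : Matrix (Fin m → Idx N) (Fin m → Idx N) B} (hM : ∀ x y, y p = y q → M x y = 0)
    (x y : Fin m → Idx N) (hy : y p = y q) : (M * R a b) x y = 0 := by
  rw [hR, mul_sub, mul_one, mul_smul_comm, Matrix.sub_apply, Matrix.smul_apply,
    mul_onCopies_qMat_apply c hab, hM x y hy]
  split_ifs
  · rw [sum_eq_zero, smul_zero, sub_zero]
    intro n _
    rw [hM, smul_zero]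
    simp [h1, h2, h3, h4, hy]
  · rw [smul_zero, sub_zero]

theorem mul_prod_apply_eq_zero (hR : ∀ a b, R a b = 1 - r a b • onCopies a b (qMat c N B))
    {p q a : Fin m} (h1 : p ≠ a) (h3 : q ≠ a) (l : List (Fin m)) (hp : p ∉ l) (hq : q ∉ l)
    (ha : a ∉ l) : ∀ {M : Matrix (Fin m → Idx N) (Fin m → Idx N) B}
    (_ : ∀ x y, y p = y q → M x y = 0) (x y : Fin m → Idx N) (_ : y p = y q),
    (M * (l.map (R a)).prod) x y = 0 := by
  induction l with
  | nil => intro M hM x y hy; simpa using hM x y hy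
  | cons b l ih =>
    intro M hM x y hy
    simp only [List.mem_cons, not_or] at hp hq ha
    rw [List.map_cons, List.prod_cons, ← mul_assoc]
    exact ih hp.2 hq.2 ha.2 (mul_apply_eq_zero hR ha.1 h1 hp.1 h3 hq.1 hM) x y hy

/-- The factors leave the entries of a column at `p` and `q` alone, so vanishing on columns with
equal entries there is inherited. -/
theorem mul_word_one_apply_eq_zero (hR : ∀ a b, R a b = 1 - r a b • onCopies a b (qMat c N B))
    {p q : Fin m} (l : List (Fin m)) (hp : p ∉ l) (hq : q ∉ l) (hl : l.Nodup) :
    ∀ {M : Matrix (Fin m → Idx N) (Fin m → Idx N) B}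
    (_ : ∀ x y, y p = y q → M x y = 0) (x y : Fin m → Idx N) (_ : y p = y q),
    (M * word R (fun _ => 1) l) x y = 0 := by
  induction l with
  | nil => intro M hM x y hy; simpa [word] using hM x y hy
  | cons b l ih =>
    intro M hM x y hy
    simp only [List.mem_cons, not_or] at hp hq
    rw [List.nodup_cons] at hl
    rw [word, one_mul, ← mul_assoc]
    exact ih hp.2 hq.2 hl.2 (mul_prod_apply_eq_zero hR hp.1 hq.1 l hp.2 hq.2 hl.1 hM) x y hy

theorem mul_permMat_swap_of_adjacent {X : Matrix (Fin m → Idx N) (Fin m → Idx N) B} {k : ℕ}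
    (h : ∀ a b : Fin m, (b : ℕ) = a + 1 → (b : ℕ) < k → X * permMat N B (Equiv.swap a b) = -X)
    {a b : Fin m} (hab : a < b) (hb : (b : ℕ) < k) : X * permMat N B (Equiv.swap a b) = -X := by
  obtain ⟨d, hd⟩ : ∃ d : ℕ, (b : ℕ) = a + 1 + d := ⟨b - (a + 1), by rw [Fin.lt_def] at hab; omega⟩
  induction d generalizing b with
  | zero => exact h a b hd hb
  | succ d ih =>
    have hlt : (a : ℕ) + 1 + d < m := by omega
    set b' : Fin m := ⟨a + 1 + d, hlt⟩
    have h1 := ih (b := b') (by rw [Fin.lt_def]; change (a : ℕ) < a + 1 + d; omega)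
      (by change (a : ℕ) + 1 + d < k; omega) rfl
    have h2 := h b' b (by change (b : ℕ) = a + 1 + d + 1; omega) hb
    have hne : a ≠ b' := fun e => by
      have := congrArg Fin.val e
      change (a : ℕ) = a + 1 + d at this
      omega
    have e : Equiv.swap a b = Equiv.swap b' b * Equiv.swap a b' * Equiv.swap b' b := by
      rw [Equiv.swap_mul_swap_mul_swap hne hab.ne, Equiv.swap_comm]
    rw [e, ← permMat_mul_permMat, ← permMat_mul_permMat, ← mul_assoc, ← mul_assoc, h2, neg_mul, h1,
      neg_neg, h2]

theorem apply_comp_swap {X : Matrix (Fin m → Idx N) (Fin m → Idx N) B} {k : ℕ}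
    (h : ∀ a b : Fin m, (b : ℕ) = a + 1 → (b : ℕ) < k → X * permMat N B (Equiv.swap a b) = -X)
    {a b : Fin m} (hab : a ≠ b) (ha : (a : ℕ) < k) (hb : (b : ℕ) < k) (x y : Fin m → Idx N) :
    X x (y ∘ Equiv.swap a b) = -X x y := by
  rw [← mul_permMat_apply (Equiv.swap a b) X x y]
  rcases lt_or_gt_of_ne hab with hlt | hlt
  · rw [mul_permMat_swap_of_adjacent h hlt hb, Matrix.neg_apply]
  · rw [Equiv.swap_comm, mul_permMat_swap_of_adjacent h hlt ha, Matrix.neg_apply]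

theorem comp_swap_eq_self {ι α : Type*} [DecidableEq ι] {y : ι → α} {a b : ι} (h : y a = y b) :
    y ∘ Equiv.swap a b = y := by
  funext d
  rcases eq_or_ne d a with rfl | h1
  · simp [h]
  rcases eq_or_ne d b with rfl | h2
  · simp [h]
  · simp [Equiv.swap_apply_of_ne_of_ne h1 h2]

theorem apply_eq_zero_of_eq {X : Matrix (Fin m → Idx N) (Fin m → Idx N) B} {k : ℕ}
    (h : ∀ a b : Fin m, (b : ℕ) = a + 1 → (b : ℕ) < k → X * permMat N B (Equiv.swap a b) = -X)
    {a b : Fin m} (hab : a ≠ b) (ha : (a : ℕ) < k) (hb : (b : ℕ) < k) (x y : Fin m → Idx N)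
    (hy : y a = y b) : X x y = 0 := by
  have := apply_comp_swap h hab ha hb x y
  rw [comp_swap_eq_self hy] at this
  exact eq_zero_of_eq_neg this

theorem neg_ne_self (hN : Even N) (i : Idx N) : -i ≠ i := by
  intro h
  have h1 := congrArg Subtype.val h
  change -i.1 = i.1 at h1
  have h2 := i.2
  simp only [idxSet, Finset.mem_filter] at h2
  have := h2.2 hN
  omega

end ScalarWord

section SymplecticConstant

variable {N : ℕ} {K B : Type*} [CommRing K] [Ring B] [Algebra K B] [Algebra ℂ B]
  {r : ℕ → ℕ → K} {R : Fin N → Fin N → Matrix (Fin N → Idx N) (Fin N → Idx N) B}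

/-- The antisymmetrizer times the ordered product of the `R_{pq}` with `p < q < m`. -/
def partialWord (R : Fin N → Fin N → Matrix (Fin N → Idx N) (Fin N → Idx N) B) (m : ℕ) :
    Matrix (Fin N → Idx N) (Fin N → Idx N) B :=
  antisym N N B * word R (fun _ => 1) ((List.finRange N).take m)

theorem mem_take_finRange {m : ℕ} {q : Fin N} : q ∈ (List.finRange N).take m ↔ (q : ℕ) < m := by
  rw [List.mem_take_iff_getElem]
  constructor
  · rintro ⟨i, hi, rfl⟩
    simp at hi ⊢
    omega
  · intro h
    exact ⟨q, by simp [h], by simp⟩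

theorem partialWord_succ (hp : PairOperators R) {m : ℕ} (hm : m < N) :
    partialWord R (m + 1)
      = partialWord R m * (((List.finRange N).take m).map fun q => R q ⟨m, hm⟩).prod := by
  have e : (List.finRange N).take (m + 1) = (List.finRange N).take m ++ [⟨m, hm⟩] := by
    rw [List.take_add_one, List.getElem?_eq_getElem (by simpa using hm)]
    simp
  rw [partialWord, e, word_concat hp, partialWord, mul_assoc]
  rw [← e]
  exact (List.nodup_finRange N).sublist (List.take_sublist _ _)

theorem partialWord_apply_eq_zero
    (hR : ∀ a b, R a b = 1 - r a b • onCopies a b (qMat .symplectic N B)) {m : ℕ} {p q : Fin N}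
    (hpq : p ≠ q) (hp : m ≤ p) (hq : m ≤ q) (x y : Fin N → Idx N) (hy : y p = y q) :
    partialWord R m x y = 0 := by
  refine mul_word_one_apply_eq_zero hR _ ?_ ?_ ?_ ?_ x y hy
  · rw [mem_take_finRange]; omega
  · rw [mem_take_finRange]; omega
  · exact (List.nodup_finRange N).sublist (List.take_sublist _ _)
  · intro x y hy
    exact apply_eq_zero_of_not_injective antisym_mul_permMat x y fun h => hpq (h hy)

/-- Antisymmetry in the first `2k + 1` copies lets the unpaired entry be moved to copy `2k`. The
newly adjoined factors then act trivially, because no earlier entry is the negative of that one. -/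
theorem partialWord_odd_apply (hp : PairOperators R)
    (hR : ∀ a b, R a b = 1 - r a b • onCopies a b (qMat .symplectic N B))
    (hsw : ∀ m, ∀ a b : Fin N, (b : ℕ) = a + 1 → (b : ℕ) < m →
      partialWord R m * permMat N B (Equiv.swap a b) = -partialWord R m) {k : ℕ} {z : K}
    (hk : 2 * k < N)
    (ih : ∀ x y : Fin N → Idx N, Function.Injective y →
      (∀ i : Fin N, (i : ℕ) < 2 * k → ∃ j : Fin N, (j : ℕ) < 2 * k ∧ y j = -y i) →
      partialWord R (2 * k) x y = z • antisym N N B x y)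
    (x y : Fin N → Idx N) (hy : Function.Injective y) {p : Fin N} (hpk : (p : ℕ) < 2 * k + 1)
    (hcl : ∀ i : Fin N, (i : ℕ) < 2 * k + 1 → i ≠ p →
      ∃ j : Fin N, (j : ℕ) < 2 * k + 1 ∧ j ≠ p ∧ y j = -y i) :
    partialWord R (2 * k + 1) x y = z • antisym N N B x y := by
  have base : ∀ y : Fin N → Idx N, Function.Injective y →
      (∀ i : Fin N, (i : ℕ) < 2 * k → ∃ j : Fin N, (j : ℕ) < 2 * k ∧ y j = -y i) →
      partialWord R (2 * k + 1) x y = z • antisym N N B x y := by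
    intro y hy hcl
    rw [partialWord_succ hp hk, mul_prod_apply_of_ne hR, ih x y hy hcl]
    intro q hq
    rw [mem_take_finRange] at hq
    refine ⟨fun h => ?_, fun h => ?_⟩
    · rw [h] at hq; exact lt_irrefl _ hq
    · obtain ⟨j, hj, hj'⟩ := hcl q hq
      rw [h, neg_neg] at hj'
      rw [hy hj'] at hj
      exact lt_irrefl _ hj
  set s : Fin N := ⟨2 * k, hk⟩ with hs
  rcases eq_or_ne p s with rfl | hps
  · refine base y hy fun i hi => ?_
    obtain ⟨j, h1, h2, h3⟩ := hcl i (by omega) fun h => by rw [h] at hi; exact lt_irrefl _ hi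
    refine ⟨j, lt_of_le_of_ne (by omega) fun h => h2 (Fin.ext h), h3⟩
  · have hlt : ∀ i : Fin N, (i : ℕ) < 2 * k ↔ (Equiv.swap p s i : ℕ) < 2 * k + 1 ∧
        Equiv.swap p s i ≠ p := by
      intro i
      have hsv : (s : ℕ) = 2 * k := rfl
      have hpv : (p : ℕ) ≠ s := fun h => hps (Fin.ext h)
      rcases eq_or_ne i p with rfl | h1
      · rw [Equiv.swap_apply_left]
        exact ⟨fun _ => ⟨by omega, hps.symm⟩, fun _ => by omega⟩
      rcases eq_or_ne i s with rfl | h2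
      · rw [Equiv.swap_apply_right]
        exact ⟨fun h => by omega, fun h => absurd rfl h.2⟩
      · rw [Equiv.swap_apply_of_ne_of_ne h1 h2]
        have : (i : ℕ) ≠ s := fun h => h2 (Fin.ext h)
        exact ⟨fun h => ⟨by omega, h1⟩, fun h => by omega⟩
    have h1 := base (y ∘ Equiv.swap p s) (hy.comp (Equiv.swap p s).injective) fun i hi => by
      have h := (hlt i).1 hi
      obtain ⟨j, h1, h2, h3⟩ := hcl _ h.1 h.2
      refine ⟨Equiv.swap p s j, ?_, ?_⟩
      · rw [hlt, Equiv.swap_apply_self]; exact ⟨h1, h2⟩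
      · simpa using h3
    rw [apply_comp_swap (hsw _) hps hpk (by change 2 * k < 2 * k + 1; omega),
      apply_comp_right (antisym_mul_permMat _), Equiv.Perm.sign_swap hps] at h1
    simpa using h1

/-- Move the partner of the last entry to copy `0`. Among the newly adjoined factors only
`R_{0,2k+1}` then acts nontrivially; two of the columns it produces survive and contribute equally,
whence `1 - 2 * r 0 (2 * k + 1)`. -/
theorem partialWord_even_apply (hN : Even N) (hp : PairOperators R)
    (hR : ∀ a b, R a b = 1 - r a b • onCopies a b (qMat .symplectic N B))
    (hsw : ∀ m, ∀ a b : Fin N, (b : ℕ) = a + 1 → (b : ℕ) < m →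
      partialWord R m * permMat N B (Equiv.swap a b) = -partialWord R m) {z : ℕ → K}
    (hz : z 0 = 1) (hz' : ∀ k, 2 * k + 1 < N → z (k + 1) = (1 - 2 * r 0 (2 * k + 1)) * z k)
    (k : ℕ) (hk : 2 * k ≤ N) (x y : Fin N → Idx N) (hy : Function.Injective y)
    (hcl : ∀ i : Fin N, (i : ℕ) < 2 * k → ∃ j : Fin N, (j : ℕ) < 2 * k ∧ y j = -y i) :
    partialWord R (2 * k) x y = z k • antisym N N B x y := by
  induction k generalizing x y with
  | zero => simp [partialWord, hz, word]
  | succ k ih =>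
    have hk1 : 2 * k + 1 < N := by omega
    have hodd := fun (y : Fin N → Idx N) (hy : Function.Injective y) (p : Fin N) hpk hcl =>
      partialWord_odd_apply hp hR hsw (by omega) (ih (by omega)) x y hy (p := p) hpk hcl
    -- Copy `0` is chosen because its factor is the leftmost of the new ones: those to its right
    -- leave the column unchanged, and none is left to act on the columns it creates.
    set o : Fin N := ⟨0, by omega⟩ with ho
    set l : Fin N := ⟨2 * k + 1, hk1⟩ with hl
    have hol : o ≠ l := fun h => by have := congrArg Fin.val h; simp [ho, hl] at this
    have hov : (o : ℕ) = 0 := rfl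
    have hlv : (l : ℕ) = 2 * k + 1 := rfl
    have main : ∀ y : Fin N → Idx N, Function.Injective y → y o = -y l →
        (∀ i : Fin N, (i : ℕ) < 2 * k + 2 → ∃ j : Fin N, (j : ℕ) < 2 * k + 2 ∧ y j = -y i) →
        partialWord R (2 * k + 2) x y = z (k + 1) • antisym N N B x y := by
      intro y hy hyl hcl
      have hcl' : ∀ i : Fin N, (i : ℕ) < 2 * k + 1 → i ≠ o →
          ∃ j : Fin N, (j : ℕ) < 2 * k + 1 ∧ j ≠ o ∧ y j = -y i := by
        intro i hi hio
        obtain ⟨j, h1, h2⟩ := hcl i (by omega)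
        have hjl : j ≠ l := by
          rintro rfl
          apply hio
          apply hy
          rw [hyl, h2, neg_neg]
        have hjo : j ≠ o := by
          rintro rfl
          rw [hyl, neg_inj] at h2
          rw [← hy h2] at hi
          omega
        have : (j : ℕ) ≠ l := fun h => hjl (Fin.ext h)
        exact ⟨j, by omega, hjo, h2⟩
      have hval := hodd y hy o (by omega) hcl'
      -- `n = y l` returns `y`, and `n = -y l` returns `y` with `o` and `l` exchanged. In the second
      -- case the sign of the exchange cancels against that of `eps`, so the two terms add up.
      have hsum : ∑ n, (eps .symplectic n * eps .symplectic (y l)) • partialWord R (2 * k + 1) x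
          (Function.update (Function.update y o (-n)) l n) = (2 * z k) • antisym N N B x y := by
        have hne := neg_ne_self hN (y l)
        rw [← sum_subset (subset_univ {y l, -y l}), sum_pair hne.symm]
        · have e1 : Function.update (Function.update y o (-y l)) l (y l) = y := by
            rw [← hyl]; simp
          have e2 : Function.update (Function.update y o (- -y l)) l (-y l)
              = y ∘ Equiv.swap o l := by
            rw [← hyl, hyl, neg_neg, ← hyl]
            funext d
            rcases eq_or_ne d l with rfl | h1
            · simp
            rcases eq_or_ne d o with rfl | h2
            · simp [h1]
            · simp [h1, h2, Equiv.swap_apply_of_ne_of_ne h2 h1]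
          have h2 := hodd (y ∘ Equiv.swap o l) (hy.comp (Equiv.swap o l).injective) o (by omega)
            (fun i hi hio => by
              have hsame : ∀ i : Fin N, (i : ℕ) < 2 * k + 1 → i ≠ o →
                  (y ∘ Equiv.swap o l) i = y i := by
                intro i hi hio
                rw [Function.comp_apply, Equiv.swap_apply_of_ne_of_ne hio]
                rintro rfl
                omega
              obtain ⟨j, h1, h2, h3⟩ := hcl' i hi hio
              exact ⟨j, h1, h2, by rw [hsame i hi hio, hsame j h1 h2, h3]⟩)
          rw [apply_comp_right (antisym_mul_permMat _), Equiv.Perm.sign_swap hol] at h2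
          rw [e1, e2, h2, hval, eps_neg, mul_assoc, eps_mul_self _ fun _ => hN, two_mul, add_smul]
          simp [Kind.sgn]
        · intro n _ hn
          simp only [mem_insert, mem_singleton, not_or] at hn
          rw [← smul_zero (eps .symplectic n * eps .symplectic (y l))]
          congr 1
          have hb : Function.Surjective y :=
            ((Fintype.bijective_iff_injective_and_card y).2
              ⟨hy, Fintype.card_congr (enum N)⟩).surjective
          obtain ⟨i, rfl⟩ := hb n
          have hil : i ≠ l := fun h => hn.1 (by rw [h])
          have hio : i ≠ o := fun h => hn.2 (by rw [h, hyl])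
          -- If `i` is among the first `2k + 1` copies, so is its partner `j`, and the new column
          -- repeats an entry at `o` and `j`. Otherwise it repeats one at `l` and `i`, copies not
          -- yet touched, where `A` itself is antisymmetric.
          by_cases hi : (i : ℕ) < 2 * k + 1
          · obtain ⟨j, h1, h2, h3⟩ := hcl' i hi hio
            refine apply_eq_zero_of_eq (hsw _) h2.symm (by omega) h1 _ _ ?_
            have hjl : j ≠ l := by rintro rfl; omega
            simp [hol, h2, hjl, h3]
          · have : (i : ℕ) ≠ l := fun h => hil (Fin.ext h)
            refine partialWord_apply_eq_zero hR hil.symm (by omega) (by omega) _ _ ?_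
            simp [hil, hio]
      have ho_mem : (List.finRange N).take (2 * k + 1) = o :: ((List.finRange N).take (2 * k + 1)).tail := by
        obtain ⟨n, rfl⟩ : ∃ n, N = n + 1 := ⟨N - 1, by omega⟩
        rw [List.finRange_succ, List.take_succ_cons]
        rfl
      have hnd : ((List.finRange N).take (2 * k + 1)).Nodup :=
        (List.nodup_finRange N).sublist (List.take_sublist _ _)
      rw [partialWord_succ hp hk1, ho_mem, List.map_cons, List.prod_cons, ← mul_assoc,
        mul_prod_apply_of_ne hR, hR, mul_sub, mul_one, mul_smul_comm, Matrix.sub_apply,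
        Matrix.smul_apply, mul_onCopies_qMat_apply _ hol, if_pos hyl, hsum, hval, smul_smul,
        ← sub_smul, hz' k hk1]
      · congr 1
        change z k - r 0 (2 * k + 1) * _ = _
        ring
      · intro q hq
        have hqm : (q : ℕ) < 2 * k + 1 := mem_take_finRange.1 (List.mem_of_mem_tail hq)
        refine ⟨fun h => ?_, fun h => ?_⟩
        · rw [h] at hqm; exact lt_irrefl _ hqm
        · rw [← hyl] at h
          rw [ho_mem, List.nodup_cons] at hnd
          rw [hy h] at hq
          exact hnd.1 hq
    change partialWord R (2 * k + 2) x y = _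
    obtain ⟨j, hj, hjl⟩ := hcl l (by omega)
    rcases eq_or_ne j o with rfl | hjo
    · exact main y hy hjl hcl
    · have hlj : l ≠ j := fun h => neg_ne_self hN (y l) (by rw [← hjl, ← h])
      have hlt : ∀ i : Fin N, (i : ℕ) < 2 * k + 2 ↔ (Equiv.swap o j i : ℕ) < 2 * k + 2 := by
        intro i
        rcases eq_or_ne i o with rfl | h1
        · rw [Equiv.swap_apply_left]; exact ⟨fun _ => hj, fun _ => by omega⟩
        rcases eq_or_ne i j with rfl | h2
        · rw [Equiv.swap_apply_right]; exact ⟨fun _ => by omega, fun _ => hj⟩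
        · rw [Equiv.swap_apply_of_ne_of_ne h1 h2]
      have h1 := main (y ∘ Equiv.swap o j) (hy.comp (Equiv.swap o j).injective)
        (by simp [Equiv.swap_apply_of_ne_of_ne hol.symm hlj, hjl]) fun i hi => by
          obtain ⟨d, h1, h2⟩ := hcl _ ((hlt i).1 hi)
          refine ⟨Equiv.swap o j d, (hlt d).1 h1, ?_⟩
          simpa using h2
      rw [apply_comp_swap (hsw (2 * k + 2)) hjo.symm (by omega) hj,
        apply_comp_right (antisym_mul_permMat _), Equiv.Perm.sign_swap hjo.symm] at h1
      simpa using h1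

end SymplecticConstant

/-! ### Evaluation of `γ` in the two cases. -/

section Constant

variable {N : ℕ} {A : Type*} [Ring A] [Algebra ℂ A]

theorem partialWord_Rt_mul_permMat_swap (c : Kind) (hc : c = .symplectic → Even N) (m : ℕ)
    (a b : Fin N) (hab : (b : ℕ) = a + 1) (hb : (b : ℕ) < m) :
    partialWord (Rt c) m * permMat N A⟦X⟧ (Equiv.swap a b) = -partialWord (Rt c) m := by
  have hlen : (a : ℕ) + 1 < ((List.finRange N).take m).length := by
    simp only [List.length_take, List.length_finRange]; omega
  have e := eq_take_append ((List.finRange N).take m) hlen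
  have e1 : ((List.finRange N).take m)[(a : ℕ)] = a := by simp
  have e2 : ((List.finRange N).take m)[(a : ℕ) + 1] = b := by
    apply Fin.ext; simp [hab]
  rw [e1, e2] at e
  have hnd : ((List.finRange N).take m).Nodup :=
    (List.nodup_finRange N).sublist (List.take_sublist _ _)
  rw [partialWord, e]
  rw [e] at hnd
  exact (exchange_word_one c hc).antisym_mul hab hnd

/-- `A Q = A P Q = -A Q`, since `P Q = Q` in the orthogonal case; hence `A Q = 0`. -/
theorem antisym_mul_Rt_orthogonal {a b : Fin N} (hab : a ≠ b) :
    antisym N N A⟦X⟧ * Rt .orthogonal a b = antisym N N A⟦X⟧ := by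
  have h : antisym N N A⟦X⟧ * onCopies a b (qMat .orthogonal N A⟦X⟧) = 0 := by
    apply eq_zero_of_eq_neg
    rw [← neg_mul, ← antisym_mul_permMat_swap hab, mul_assoc, permMat_swap hab,
      ← onCopies_mul hab, flipMat_mul_qMat]
    simp [Kind.sgn]
  rw [Rt_eq, mul_sub, mul_one, mul_smul_comm, h, smul_zero, sub_zero]

theorem mul_word_one_eq_self {ι M : Type*} [Monoid M] {R : ι → ι → M} {x : M}
    (h : ∀ a b, a ≠ b → x * R a b = x) (l : List ι) (hl : l.Nodup) :
    x * word R (fun _ => 1) l = x := by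
  induction l with
  | nil => simp [word]
  | cons p ps ih =>
    rw [List.nodup_cons] at hl
    have : ∀ l : List ι, p ∉ l → x * (l.map (R p)).prod = x := by
      intro l
      induction l with
      | nil => simp
      | cons q l ih =>
        intro hp
        simp only [List.mem_cons, not_or] at hp
        rw [List.map_cons, List.prod_cons, ← mul_assoc, h p q hp.1, ih hp.2]
    rw [word, one_mul, ← mul_assoc, this ps hl.1, ih hl.2]

/-- The series `(2u + 1) / (2u - 2k + 1)`. -/
def symplecticFactor (k : ℕ) : ℂ⟦X⟧ :=
  (PowerSeries.C 2 + X) * (PowerSeries.C 2 + PowerSeries.C (1 - 2 * (k : ℂ)) * X)⁻¹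

theorem symplecticFactor_mul (k : ℕ) :
    symplecticFactor k * (PowerSeries.C 2 + PowerSeries.C (1 - 2 * (k : ℂ)) * X)
      = PowerSeries.C 2 + X := by
  rw [symplecticFactor, mul_assoc, PowerSeries.inv_mul_cancel, mul_one]
  simp

theorem symplecticFactor_zero : symplecticFactor 0 = 1 := by
  have h : (PowerSeries.C 2 + X : ℂ⟦X⟧) ≠ 0 := fun h => by
    have := congrArg constantCoeff h
    simp at this
  apply mul_right_cancel₀ h
  have := symplecticFactor_mul 0
  simpa using this

/-- `1 - 2 / (-2u + 2k + 1) = (2u - 2k + 1) / (2u - 2k - 1)`, whose numerator cancels the previous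
denominator. -/
theorem symplecticFactor_succ (k : ℕ) : symplecticFactor (k + 1)
    = (1 - 2 * linInv (-2) (((0 : ℕ) : ℂ) + ((2 * k + 1 : ℕ) : ℂ))) * symplecticFactor k := by
  have h : (PowerSeries.C 2 + PowerSeries.C (1 - 2 * ((k + 1 : ℕ) : ℂ)) * X : ℂ⟦X⟧) ≠ 0 :=
    fun h => by
      have := congrArg constantCoeff h
      simp at this
  apply mul_right_cancel₀ h
  rw [symplecticFactor_mul, ← symplecticFactor_mul k]
  have h1 := linInv_spec (a := -2) (by norm_num) (((0 : ℕ) : ℂ) + ((2 * k + 1 : ℕ) : ℂ))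
  have e1 : PowerSeries.C (1 - 2 * ((k + 1 : ℕ) : ℂ))
      = -PowerSeries.C (((0 : ℕ) : ℂ) + ((2 * k + 1 : ℕ) : ℂ)) := by
    rw [← map_neg]; congr 1; push_cast; ring
  have e2 : PowerSeries.C (1 - 2 * (k : ℂ))
      = -PowerSeries.C (((0 : ℕ) : ℂ) + ((2 * k + 1 : ℕ) : ℂ)) + 2 := by
    rw [← map_neg, ← map_ofNat PowerSeries.C, ← map_add]; congr 1; push_cast; ring
  rw [e1, e2]
  rw [map_neg] at h1
  linear_combination (-2 * symplecticFactor k) * h1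

theorem antisym_mul_word_one (c : Kind) (hc : c = .symplectic → Even N) :
    antisym N N A⟦X⟧ * word (Rt c) (fun _ => 1) (List.finRange N)
      = antisym N N A⟦X⟧ * Matrix.scalar (Fin N → Idx N) (scalarSeries A (γ N c)) := by
  cases c with
  | orthogonal =>
    rw [mul_word_one_eq_self (fun a b => antisym_mul_Rt_orthogonal) _ (List.nodup_finRange N), γ,
      map_one, map_one, mul_one]
  | symplectic =>
    -- The product is already known to be `A` times a series, so one entry suffices; `enum N` serves
    -- because its reversal is its negative.
    obtain ⟨g, hg, -⟩ := (exchange_word_one (N := N) (m := N) (A := A) .symplectic hc).exists_det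
    have h := partialWord_even_apply (hc rfl) (pairOperators_Rt (A := A) .symplectic)
      (r := fun a b => linInv (-2) ((a : ℂ) + (b : ℂ))) (fun a b => Rt_eq .symplectic)
      (partialWord_Rt_mul_permMat_swap .symplectic hc) symplecticFactor_zero
      (fun k _ => symplecticFactor_succ k) (N / 2) (by omega) (enum N) (enum N)
      (enum N).injective fun i _ => ⟨i.rev, by
        have := i.2
        have := Nat.even_iff.1 (hc rfl)
        rw [Fin.val_rev]
        omega, enum_rev N i⟩
    have e : (List.finRange N).take (2 * (N / 2)) = List.finRange N := by
      have := Nat.even_iff.1 (hc rfl)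
      apply List.take_of_length_le
      rw [List.length_finRange]
      omega
    rw [partialWord, e, hg, mul_scalar_apply, antisym_apply_enum, one_mul, series_smul_def,
      mul_one] at h
    rw [hg, h]
    rfl

end Constant

end TwYang

end

/-! ### Transposed products and the final formula. -/

noncomputable section

namespace TwYang

open Finset Matrix PowerSeries

attribute [local instance] seriesAlgebra

section Transposition

variable {N m : ℕ} {B : Type*} [Ring B]

/-- Factors in distinct copies leave a single path of intermediate indices, and their entries are
multiplied in list order, so commutativity plays no role. -/
theorem prod_onCopy_apply (V : Fin m → Matrix (Idx N) (Idx N) B) (l : List (Fin m))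
    (hl : l.Nodup) (x y : Fin m → Idx N) : (l.map fun a => onCopy a (V a)).prod x y
      = if ∀ d, d ∉ l → x d = y d then (l.map fun a => V a (x a) (y a)).prod else 0 := by
  induction l generalizing x with
  | nil =>
    simp only [List.map_nil, List.prod_nil, Matrix.one_apply, List.not_mem_nil, not_false_eq_true,
      true_imp_iff, funext_iff]
  | cons p l ih =>
    rw [List.nodup_cons] at hl
    have hu : ∀ d, d ≠ p → Function.update x p (y p) d = x d := fun d hd => by simp [hd]
    rw [List.map_cons, List.prod_cons, Matrix.mul_apply,
      sum_eq_single (Function.update x p (y p)), ih hl.2]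
    · rw [onCopy, Matrix.of_apply, if_pos fun d hd => (hu d hd).symm, Function.update_self, mul_ite,
        mul_zero, List.map_cons, List.prod_cons]
      have e : (l.map fun a => V a (Function.update x p (y p) a) (y a))
          = l.map fun a => V a (x a) (y a) :=
        List.map_congr_left fun a ha => by rw [hu a fun h => hl.1 (h ▸ ha)]
      rw [e]
      congr 1
      refine propext ⟨fun h d hd => ?_, fun h d hd => ?_⟩
      · rw [List.mem_cons, not_or] at hd
        rw [← hu d hd.1, h d hd.2]
      · by_cases hdp : d = p
        · rw [hdp, Function.update_self]
        · rw [hu d hdp, h d (by simp [hdp, hd])]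
    · intro z _ hz
      rw [ih hl.2, onCopy, Matrix.of_apply]
      split_ifs with h1 h2
      · exfalso
        apply hz
        funext d
        by_cases hdp : d = p
        · rw [hdp, Function.update_self, h2 p hl.1]
        · rw [hu d hdp, h1 d hdp]
      all_goals simp
    · simp

theorem prod_finRange_onCopy_apply (V : Fin m → Matrix (Idx N) (Idx N) B) (x y : Fin m → Idx N) :
    ((List.finRange m).map fun a => onCopy a (V a)).prod x y
      = ((List.finRange m).map fun a => V a (x a) (y a)).prod := by
  rw [prod_onCopy_apply V _ (List.nodup_finRange m), if_pos]
  intro d hd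
  exact absurd (List.mem_finRange d) hd

theorem prod_map_zsmul {ι : Type*} (z : ι → ℤ) (v : ι → B) (l : List ι) :
    (l.map fun a => z a • v a).prod = (l.map z).prod • (l.map v).prod := by
  induction l with
  | nil => simp
  | cons p l ih => simp only [List.map_cons, List.prod_cons, ih, smul_mul_smul_comm]

/-- The product of the signs of the indices. -/
def signProd (c : Kind) (x : Fin m → Idx N) : ℤ := ∏ a, eps c (-x a)

theorem signProd_mul_self (c : Kind) (hc : c = .symplectic → Even N) (x : Fin m → Idx N) :
    signProd c x * signProd c x = 1 := by
  rw [signProd, ← prod_mul_distrib]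
  exact prod_eq_one fun a _ => eps_mul_self c hc _

/-- Transposing each factor preserves the order in which the entries are multiplied; the product is
transposed without being reversed. -/
theorem prod_onCopy_twT_apply (c : Kind) (V : Fin m → Matrix (Idx N) (Idx N) B)
    (x y : Fin m → Idx N) : ((List.finRange m).map fun a => onCopy a (twT c (V a))).prod x y
      = (signProd c x * signProd c y) •
        ((List.finRange m).map fun a => onCopy a (V a)).prod (-y) (-x) := by
  rw [prod_finRange_onCopy_apply, prod_finRange_onCopy_apply]
  simp only [twT_apply]
  rw [prod_map_zsmul, List.prod_map_mul, signProd, signProd, Fin.prod_univ_def, Fin.prod_univ_def,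
    mul_comm]
  rfl

theorem signProd_smul_antisym (c : Kind) (x y : Fin m → Idx N) :
    signProd c x • antisym N m B x y = signProd c y • antisym N m B x y := by
  rw [antisym, Matrix.of_apply, smul_sum, smul_sum]
  refine sum_congr rfl fun σ _ => ?_
  split_ifs with h
  · congr 1
    subst h
    exact Equiv.prod_comp σ fun a => eps c (-y a)
  · rw [smul_zero, smul_zero]

theorem antisym_neg_neg (x y : Fin m → Idx N) : antisym N m B (-y) (-x) = antisym N m B x y := by
  rw [antisym, Matrix.of_apply, Matrix.of_apply, ← Equiv.sum_comp (Equiv.inv _)]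
  refine sum_congr rfl fun σ _ => ?_
  rw [Equiv.inv_apply, Equiv.Perm.sign_inv]
  congr 1
  refine propext ⟨fun h => ?_, fun h => ?_⟩
  · funext d
    have := congrFun h (σ d)
    simpa using this.symm
  · subst h
    funext d
    simp

/-- The transpose of the hypothesis. The entries of `A` are integers and commute with everything,
`A` is its own transpose up to signs, and the signs of row and column agree wherever `A` is nonzero.
-/
theorem antisym_mul_prod_twT (c : Kind) (hc : c = .symplectic → Even N)
    {V : Fin m → Matrix (Idx N) (Idx N) B} {q : B}
    (h : ((List.finRange m).map fun a => onCopy a (V a)).prod * antisym N m B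
      = antisym N m B * Matrix.scalar (Fin m → Idx N) q) :
    antisym N m B * ((List.finRange m).map fun a => onCopy a (twT c (V a))).prod
      = antisym N m B * Matrix.scalar (Fin m → Idx N) q := by
  have hcomm : ∀ (x y : Fin m → Idx N) (b : B), antisym N m B x y * b = b * antisym N m B x y := by
    intro x y b
    rw [antisym, Matrix.of_apply, sum_mul, mul_sum]
    refine sum_congr rfl fun σ _ => ?_
    split_ifs
    · exact Int.cast_commute _ _
    · rw [zero_mul, mul_zero]
  ext x y
  have h1 := congrFun (congrFun h (-y)) (-x)
  rw [Matrix.scalar_apply, Matrix.mul_diagonal, antisym_neg_neg, Matrix.mul_apply] at h1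
  rw [Matrix.scalar_apply, Matrix.mul_diagonal, Matrix.mul_apply]
  have h2 : ∀ z, antisym N m B x z
        * ((List.finRange m).map fun a => onCopy a (twT c (V a))).prod z y
      = (signProd c x * signProd c y) • (((List.finRange m).map fun a => onCopy a (V a)).prod (-y)
        (-z) * antisym N m B (-z) (-x)) := by
    intro z
    rw [prod_onCopy_twT_apply, mul_smul_comm, hcomm, antisym_neg_neg, mul_smul, mul_smul,
      smul_comm (signProd c z), smul_comm (signProd c x), ← mul_smul_comm, ← mul_smul_comm (signProd c x),
      signProd_smul_antisym]
  simp only [h2]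
  have h3 := Equiv.sum_comp (Equiv.neg (Fin m → Idx N)) fun z =>
    ((List.finRange m).map fun a => onCopy a (V a)).prod (-y) z * antisym N m B z (-x)
  simp only [Equiv.neg_apply] at h3
  rw [← smul_sum, h3, h1,
    mul_smul, ← smul_mul_assoc, ← signProd_smul_antisym, smul_mul_assoc, smul_smul,
    signProd_mul_self c hc, one_smul]

end Transposition

section Reversal

variable {N : ℕ} {A : Type*} [Ring A] [Algebra ℂ A]

theorem shifted_map_evalHom {m : ℕ} (T : Matrix (Idx N) (Idx N) A⟦X⟧) (s : ℂ) (a : Fin m) :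
    (shifted T a).map (evalHom A (constantCoeff_linInv (-1) s))
      = onCopy a (T.map (atLin (-1) (s - a))) := by
  rw [shifted, map_onCopy, Matrix.map_map]
  congr 1
  refine Matrix.ext fun i j => ?_
  simp only [Matrix.map_apply, Function.comp_apply, evalHom_apply]
  rw [← atLin_eq, atLin_atLin one_ne_zero (by norm_num), one_mul, one_mul, sub_eq_add_neg]

/-- Substituting `-u + N - 1` into `T_N ⋯ T_1 A` gives copy `a` the argument `-u + N - 1 - a`.
Renumbering the copies by the reversal turns this into `-u + a`, in increasing order; the sign of
the reversal occurs on both sides and cancels. -/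
theorem IsQdet.prod_mul_antisym {T : Matrix (Idx N) (Idx N) A⟦X⟧} {q : A⟦X⟧} (h : IsQdet T q) :
    ((List.finRange N).map fun a => onCopy a (T.map (atLin (-1) ((a : ℕ) : ℂ)))).prod
        * antisym N N A⟦X⟧
      = antisym N N A⟦X⟧ * Matrix.scalar (Fin N → Idx N) (atLin (-1) ((N : ℂ) - 1) q) := by
  have hp := constantCoeff_linInv (-1) ((N : ℂ) - 1)
  have h1 := congrArg (fun M => M.map (evalHom A hp)) h.2.2
  beta_reduce at h1
  rw [map_mul_scalar, Matrix.map_mul, map_antisym] at h1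
  have e := map_list_prod (evalHom A hp).mapMatrix ((List.finRange N).reverse.map (shifted T))
  rw [RingHom.mapMatrix_apply] at e
  rw [e, List.finRange_reverse, List.map_map, List.map_map] at h1
  have e1 : ((evalHom A hp).mapMatrix ∘ shifted T) ∘ Fin.rev
      = fun a : Fin N => onCopy (Fin.revPerm a) (T.map (atLin (-1) ((a : ℕ) : ℂ))) := by
    funext a
    simp only [Function.comp_apply, RingHom.mapMatrix_apply]
    rw [shifted_map_evalHom]
    congr 3
    have : ((a.rev : ℕ) : ℂ) + (a : ℕ) + 1 = N := by
      rw [Fin.val_rev]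
      exact_mod_cast (by omega : N - (a + 1) + a + 1 = N)
    linear_combination -this
  rw [e1] at h1
  have h2 := semiconj_prod (r := permMat N A⟦X⟧ Fin.revPerm)
    (f := fun a : Fin N => onCopy (Fin.revPerm a) (T.map (atLin (-1) ((a : ℕ) : ℂ))))
    (g := fun a : Fin N => onCopy a (T.map (atLin (-1) ((a : ℕ) : ℂ)))) (List.finRange N)
    fun a _ => permMat_mul_onCopy _ _ _
  have h3 := congrArg (fun M => permMat N A⟦X⟧ Fin.revPerm * M) h1
  beta_reduce at h3
  rw [← mul_assoc, ← mul_assoc, h2, mul_assoc, permMat_mul_antisym, mul_smul_comm,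
    smul_mul_assoc] at h3
  have h4 := congrArg (fun M => (Equiv.Perm.sign (Fin.revPerm (n := N)) : ℤ) • M) h3
  beta_reduce at h4
  rw [smul_smul, smul_smul, ← Units.val_mul, Int.units_mul_self, Units.val_one, one_smul,
    one_smul] at h4
  exact h4

theorem IsQdet.antisym_mul_prod_twT (c : Kind) (hc : c = .symplectic → Even N)
    {T : Matrix (Idx N) (Idx N) A⟦X⟧} {q : A⟦X⟧} (h : IsQdet T q) :
    antisym N N A⟦X⟧ * ((List.finRange N).map fun a =>
        onCopy a (twT c (T.map (atLin (-1) ((a : ℕ) : ℂ))))).prod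
      = antisym N N A⟦X⟧ * Matrix.scalar (Fin N → Idx N) (atLin (-1) ((N : ℂ) - 1) q) :=
  TwYang.antisym_mul_prod_twT c hc h.prod_mul_antisym

variable {A' : Type*} [Ring A'] [Algebra ℂ A']

theorem map_atLin (φ : A →ₐ[ℂ] A') (a b : ℂ) (f : A⟦X⟧) :
    PowerSeries.map (φ : A →+* A') (atLin a b f) = atLin a b (PowerSeries.map (φ : A →+* A') f) := by
  ext n
  simp [atLin]

theorem map_scalarSeries (φ : A →ₐ[ℂ] A') (f : ℂ⟦X⟧) :
    PowerSeries.map (φ : A →+* A') (scalarSeries A f) = scalarSeries A' f := by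
  ext n
  simp [scalarSeries]

theorem map_shifted (φ : A →ₐ[ℂ] A') {m : ℕ} (S : Matrix (Idx N) (Idx N) A⟦X⟧) (a : Fin m) :
    (shifted S a).map (PowerSeries.map (φ : A →+* A'))
      = shifted (S.map (PowerSeries.map (φ : A →+* A'))) a := by
  rw [shifted, map_onCopy, shifted, Matrix.map_map, Matrix.map_map]
  congr 1
  exact Matrix.ext fun i j => map_atLin φ _ _ _

theorem map_Rt (φ : A →ₐ[ℂ] A') (c : Kind) {m : ℕ} (a b : Fin m) :
    (Rt c a b : Matrix (Fin m → Idx N) (Fin m → Idx N) A⟦X⟧).map (PowerSeries.map (φ : A →+* A'))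
      = Rt c a b := by
  rw [Rt, Matrix.map_sub _ (map_sub _), map_onCopies, Matrix.map_map,
    Matrix.map_one _ (map_zero _) (map_one _), Rt]
  congr 2
  exact Matrix.ext fun i j => map_scalarSeries φ _

theorem map_bracket (φ : A →ₐ[ℂ] A') (c : Kind) {m : ℕ} (S : Matrix (Idx N) (Idx N) A⟦X⟧)
    (l : List (Fin m)) : (bracket c S l).map (PowerSeries.map (φ : A →+* A'))
      = bracket c (S.map (PowerSeries.map (φ : A →+* A'))) l := by
  rw [bracket_eq_word, bracket_eq_word]
  refine (map_word (PowerSeries.map (φ : A →+* A')).mapMatrix.toMonoidHom (Rt c)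
    (shifted S) l).trans ?_
  congr 1
  · funext a b; exact map_Rt φ c a b
  · funext a; exact map_shifted φ S a

theorem neg_linInv (b : ℂ) : -linInv 1 (-b) = linInv (-1) b := by
  apply linInv_unique (by norm_num)
  have := linInv_spec one_ne_zero (-b)
  rw [map_neg] at this ⊢
  linear_combination this

end Reversal

section Bracket

variable {N m : ℕ}

theorem shifted_embMat (c : Kind) (a : Fin m) : shifted (embMat c N) a
    = shifted (Tmat N) a * onCopy a (twT c ((Tmat N).map (atLin (-1) ((a : ℕ) : ℂ)))) := by
  have h := embMat_map_evalAt (N := N) c (constantCoeff_linInv 1 (-((a : ℕ) : ℂ)))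
  rw [neg_linInv] at h
  exact (congrArg (onCopy a) h).trans (onCopy_mul a _ _)

/-- The crossing relation is the partial transpose of `RTT` for `-u + p` and `u - q`; the difference
`-2u + p + q` is exactly the argument of `Rᵗ`. -/
theorem bracket_embMat (c : Kind) (hc : c = .symplectic → Even N) (l : List (Fin m))
    (hl : l.Nodup) : bracket c (embMat c N) l
      = (l.map (shifted (Tmat N))).prod * word (Rt c) (fun _ => 1) l
        * (l.map fun a => onCopy a (twT c ((Tmat N).map (atLin (-1) ((a : ℕ) : ℂ))))).prod := by
  rw [bracket_eq_word, funext (shifted_embMat (m := m) c)]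
  refine word_mul (fun p a b ha hb => commute_onCopy_Rt c p a b ha hb _)
    (fun p a b ha hb => commute_onCopy_Rt c p a b ha hb _) (fun p q hpq => ?_) l hl
  rw [Rt_eq]
  exact rtt_copies_twT c hc hpq (rtt_evalAt (constantCoeff_linInv _ _) (constantCoeff_linInv _ _)
    (linInv_ne_zero (by norm_num) _) (linInv_ne_zero one_ne_zero _) (linInv_neg_two_mul_sub _ _))

theorem commute_antisym_scalar {B : Type*} [Ring B] (q : B) :
    Commute (antisym N m B) (Matrix.scalar (Fin m → Idx N) q) := by
  ext x y
  rw [Matrix.scalar_apply, Matrix.mul_diagonal, Matrix.diagonal_mul, antisym, Matrix.of_apply,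
    sum_mul, mul_sum]
  refine sum_congr rfl fun σ _ => ?_
  split_ifs
  · exact Int.cast_commute _ _
  · rw [zero_mul, mul_zero]

/-- `A` absorbs `t`, passes the resulting scalar, absorbs `D`, passes again and absorbs `t'`. -/
theorem mul_eq_of_mul_eq {M : Type*} [Monoid M] {A t D t' s g s' : M} (hs : Commute A s)
    (hg : Commute A g) (h : A * t = A * s) (hD : A * D = A * g) (h' : A * t' = A * s') :
    A * (t * D * t') = A * (s * g * s') := by
  rw [← mul_assoc, ← mul_assoc, h, hs.eq, mul_assoc s, hD, hg.eq, mul_assoc, mul_assoc, h',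
    ← mul_assoc g, ← hg.eq, ← mul_assoc, ← mul_assoc, ← hs.eq]
  simp only [mul_assoc]

theorem scalarSeries_commute {A : Type*} [Ring A] [Algebra ℂ A] (z : ℂ⟦X⟧) (f : A⟦X⟧) :
    scalarSeries A z * f = f * scalarSeries A z :=
  Algebra.commutes z f

theorem sdet_embMat (c : Kind) (hc : c = .symplectic → Even N) {q d : (Yangian N)⟦X⟧}
    (hq : IsQdet (Tmat N) q) (hd : antisym N N (Yangian N)⟦X⟧ * bracket c (embMat c N)
      (List.finRange N) = antisym N N (Yangian N)⟦X⟧ * Matrix.scalar (Fin N → Idx N) d) :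
    d = scalarSeries (Yangian N) (γ N c) * q * atLin (-1) ((N : ℂ) - 1) q := by
  apply antisym_mul_scalar_injective (N := N)
  rw [← hd, bracket_embMat c hc _ (List.nodup_finRange N),
    mul_eq_of_mul_eq (commute_antisym_scalar _) (commute_antisym_scalar _) hq.2.1
      (antisym_mul_word_one c hc) (hq.antisym_mul_prod_twT c hc), ← map_mul, ← map_mul,
    scalarSeries_commute]

theorem map_sdet (c : Kind) (hc : c = .symplectic → Even N)
    {φ : TwistedYangian c N →ₐ[ℂ] Yangian N} {q : (Yangian N)⟦X⟧} {d : (TwistedYangian c N)⟦X⟧}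
    (hφ : IsEmb φ) (hq : IsQdet (Tmat N) q) (hd : IsSdet c (Smat c N) d) :
    PowerSeries.map (φ : TwistedYangian c N →+* Yangian N) d
      = scalarSeries (Yangian N) (γ N c) * q * atLin (-1) ((N : ℂ) - 1) q := by
  apply sdet_embMat c hc hq
  have h := congrArg
    (fun M => M.map (PowerSeries.map (φ : TwistedYangian c N →+* Yangian N))) hd.2.1
  beta_reduce at h
  rw [map_mul_scalar, Matrix.map_mul, map_antisym, map_bracket] at h
  rw [← h]
  congr 2
  exact hφ.symm

end Bracket

end TwYang

end

theorem mainTheorem9 (N : ℕ) (hN : 0 < N) (c : TwYang.Kind)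
    (hc : c = TwYang.Kind.symplectic → Even N) :
    (∃! φ : TwYang.TwistedYangian c N →ₐ[ℂ] TwYang.Yangian N, TwYang.IsEmb φ) ∧
    (∃! q : PowerSeries (TwYang.Yangian N), TwYang.IsQdet (TwYang.Tmat N) q) ∧
    (∃! d : PowerSeries (TwYang.TwistedYangian c N), TwYang.IsSdet c (TwYang.Smat c N) d) ∧
    ∀ (φ : TwYang.TwistedYangian c N →ₐ[ℂ] TwYang.Yangian N)
      (q : PowerSeries (TwYang.Yangian N)) (d : PowerSeries (TwYang.TwistedYangian c N)),
      TwYang.IsEmb φ → TwYang.IsQdet (TwYang.Tmat N) q → TwYang.IsSdet c (TwYang.Smat c N) d →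
      PowerSeries.map (φ : TwYang.TwistedYangian c N →+* TwYang.Yangian N) d
        = TwYang.scalarSeries (TwYang.Yangian N) (TwYang.γ N c) * q
            * TwYang.atLin (-1) ((N : ℂ) - 1) q := by
  obtain ⟨q, hq⟩ := TwYang.exists_isQdet N
  obtain ⟨d, hd⟩ := TwYang.exists_isSdet c N hc
  exact ⟨TwYang.existsUnique_isEmb c hc, ⟨q, hq, fun _ h => TwYang.isQdet_unique h hq⟩,
    ⟨d, hd, fun _ h => TwYang.isSdet_unique h hd⟩,
    fun _ _ _ hφ hq hd => TwYang.map_sdet c hc hφ hq hd⟩
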